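/- **Setting.** Fix $r\ge 1$, $p>0$, $s\neq 0$. For every $n\ge1$ let $d,l\ge 1$ be integers, let $x^{(i)},\bar x^{(i)}\in\mathbb R^n$, $y^{(i)}\in\mathbb R^d$ ($1\le i\le l$) with $\|x^{(i)}\|_2=\|y^{(i)}\|_2=1$, let $f_{\bar x^{(i)}}:\mathbb R^n\to\mathbb R$ be functions, and let $\beta\ge 0$; all of these may depend on $n$, and $\beta^2/\sqrt n$ is bounded (for instance, $\beta$ is constant). A vector $\mathbf m=(\mathbf m_0,\dots,\mathbf m_{r+1})$ is *admissible* if $\mathbf m_0=\mathbf m_1=1$, $\mathbf m_{r+1}=0$ and $\mathbf m_k\ne0$ for $1\le k\le r$. Let $1=\mathbf p_0\ge\dots\ge\mathbf p_{r+1}=0$, $1=\mathbf q_0\ge\dots\ge\mathbf q_{r+1}=0$, $a_k=\sqrt{\mathbf p_{k-1}\mathbf q_{k-1}-\mathbf p_k\mathbf q_k}$, $b_k=\sqrt{\mathbf p_{k-1}-\mathbf p_k}$, $c_k=\sqrt{\mathbf q_{k-1}-\mathbf q_k}$. Let the entries of $G\in\mathbb R^{d\times n}$ and of $\mathcal U_k=(u^{(4,k)},u^{(2,k)},h^{(k)})\in\mathbb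 R\times\mathbb R^d\times\mathbb R^n$, $1\le k\le r+1$, be independent standard normals; $\mathbb E$ with a subscript integrates over the variables named. Put $$D_{0,S}^{(i_1,i_2,i_3)}=\sqrt t\,(y^{(i_2)})^TGx^{(i_1)}+\sqrt{1-t}\,\|x^{(i_1)}\|_2(y^{(i_2)})^T\sum_{k=1}^{r+1} b_ku^{(2,k)}+\sqrt{1-t}\,\|y^{(i_2)}\|_2\Big(\sum_{k=1}^{r+1} c_kh^{(k)}\Big)^Tx^{(i_1)}+f_{\bar x^{(i_3)}}(x^{(i_1)}),$$ $$D_0^{(i_1,i_2,i_3)}=D_{0,S}^{(i_1,i_2,i_3)}+\sqrt t\,\|x^{(i_1)}\|_2\|y^{(i_2)}\|_2\sum_{k=1}^{r+1} a_ku^{(4,k)}.$$ With $A_{i_3}^{(i_1,i_2)}=e^{\beta D_0^{(i_1,i_2,i_3)}}$, $C_{i_3}^{(i_1)}=\sum_{i_2}A_{i_3}^{(i_1,i_2)}$, $Z_{i_3}=\sum_{i_1}(C_{i_3}^{(i_1)})^s$, let $\zeta_1=\sum_{i_3}(\mathbb E_{\mathcal U_1}Z_{i_3}^{\mathbf m_1})^p$,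 $\zeta_k=\mathbb E_{\mathcal U_k}\zeta_{k-1}^{\mathbf m_k/\mathbf m_{k-1}}$ for $k\ge2$, and $$\psi(\mathbf p,\mathbf q,\mathbf m,t)=\mathbb E_{G,\mathcal U_{r+1}}\frac{\log\zeta_r}{p|s|\sqrt n\,\mathbf m_r};$$ $\psi_S$ is the same expression with $D_{0,S}$ in place of $D_0$. Define the operators $\Phi_{\mathcal U_1}^{(i_3)}F=\mathbb E_{\mathcal U_1}\big[Z_{i_3}^{\mathbf m_1}F\big]/\mathbb E_{\mathcal U_1}Z_{i_3}^{\mathbf m_1}$ and $\Phi_{\mathcal U_k}F=\mathbb E_{\mathcal U_k}\big[\zeta_{k-1}^{\mathbf m_k/\mathbf m_{k-1}}F\big]/\zeta_k$ ($k\ge2$), where $\Phi_{\mathcal U_b}\cdots\Phi_{\mathcal U_a}$ is the identity if $b<a$, the weights $\gamma_{00}(i_3)=(\mathbb E_{\mathcal U_1}Z_{i_3}^{\mathbf m_1})^p/\zeta_1$ and $\gamma_0(i_1,i_2;i_3)=\frac{(C_{i_3}^{(i_1)})^s}{Z_{i_3}}\frac{A_{i_3}^{(i_1,i_2)}}{C_{i_3}^{(i_1)}}$,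 and $$\gamma_1=\Phi_{\mathcal U_r}\cdots\Phi_{\mathcal U_2}\,\gamma_{00}(i_3)\Phi_{\mathcal U_1}^{(i_3)}\big(\gamma_0(i_1,i_2;i_3)\gamma_0(p_1,p_2;i_3)\big),$$ $$\gamma_{22}=\Phi_{\mathcal U_r}\cdots\Phi_{\mathcal U_2}\,\gamma_{00}(i_3)\big(\Phi_{\mathcal U_1}^{(i_3)}\gamma_0(i_1,i_2;i_3)\big)\big(\Phi_{\mathcal U_1}^{(i_3)}\gamma_0(p_1,p_2;i_3)\big),$$ $$\gamma_{k+1}=\Phi_{\mathcal U_r}\cdots\Phi_{\mathcal U_{k+1}}\Big(\big(\Phi_{\mathcal U_k}\cdots\Phi_{\mathcal U_2}\gamma_{00}(i_3)\Phi_{\mathcal U_1}^{(i_3)}\gamma_0(i_1,i_2;i_3)\big)\big(\Phi_{\mathcal U_k}\cdots\Phi_{\mathcal U_2}\gamma_{00}(p_3)\Phi_{\mathcal U_1}^{(p_3)}\gamma_0(p_1,p_2;p_3)\big)\Big),\quad 1\le k\le r.$$ Write $\langle F\rangle_\gamma$ for the sum of $F\gamma$ over all indices, and let $X=(x^{(p_1)})^Tx^{(i_1)}$,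 $Y=(y^{(p_2)})^Ty^{(i_2)}$, $\omega(1;p)=1$, $\omega(k;p)=p$ for $k\ge2$, $c=\frac{\mathrm{sign}(s)s\beta^2}{2\sqrt n}$. For $1\le k\le r$ let $$\nu_k[F]=(\mathbf m_k-\mathbf m_{k+1})\,p\;\mathbb E_{G,\mathcal U_{r+1}}\langle F\rangle_{\gamma_{k+1}}+\mathbf 1_{k=1}\,\mathbf m_1(1-p)\,\mathbb E_{G,\mathcal U_{r+1}}\langle F\rangle_{\gamma_{22}},$$ and let $|\nu_k|$ be the same with the two coefficients replaced by their absolute values. Finally let $$\psi_1=\psi-c\sum_{k=1}^{r+1}\big(\mathbf p_{k-1}\mathbf q_{k-1}\mathbb E\langle N\rangle_{\gamma_k}-\mathbf p_k\mathbf q_k\mathbb E\langle N\rangle_{\gamma_{k+1}}\big)\mathbf m_k\,\omega(k;p),\qquad N=\|x^{(i_1)}\|_2\|x^{(p_1)}\|_2\|y^{(i_2)}\|_2\|y^{(p_2)}\|_2$$ (the term with $\mathbf p_{r+1}\mathbf q_{r+1}=0$ is zero). **Hypotheses (modulo-$\mathbf m$ sfl LD RDT frame).** Let $\mathbf m$ be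 a fixed admissible vector. For every $n\ge1$ let $\bar{\mathbf p}(t),\bar{\mathbf q}(t)$, $t\in[0,1]$, be paths of vectors ordered as above, with components differentiable in $t$, that satisfy the $\mathbf p$- and $\mathbf q$-stationarity equations $$(1-t)\,c\,\nu_k[\bar{\mathbf q}_k(t)-Y]=0,\qquad (1-t)\,c\,\nu_k[\bar{\mathbf p}_k(t)-X]=0\qquad(1\le k\le r)$$ (everything evaluated at $\bar{\mathbf p}(t),\bar{\mathbf q}(t),\mathbf m,t$). Assume moreover that, for every $t\in[0,1]$ and $1\le k\le r$, either $\bar{\mathbf p}_k(t),\bar{\mathbf q}_k(t)$ are the concentration points of the overlaps, i.e. $|\nu_k|[(\bar{\mathbf p}_k(t)-X)^2]\to0$ and $|\nu_k|[(\bar{\mathbf q}_k(t)-Y)^2]\to0$ as $n\to\infty$, or $$\nu_k\big[(\bar{\mathbf p}_k(t)-X)(\bar{\mathbf q}_k(t)-Y)\big]=0\quad\text{for all }n.\tag{$*$}$$ **Conclusions.** (i) $t\mapsto\psi_1(\bar{\mathbf p}(t),\bar{\mathbf q}(t),\mathbf m,t)$ is differentiable on $[0,1]$; its derivative is $0$ at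 every $t$ and $n$ at which the equality in $(*)$ holds for all $1\le k\le r$, and in any case it tends to $0$ as $n\to\infty$ for every $t\in[0,1]$. (ii) For all $t,t'\in[0,1]$, $\psi_1(\bar{\mathbf p}(t),\bar{\mathbf q}(t),\mathbf m,t)-\psi_1(\bar{\mathbf p}(t'),\bar{\mathbf q}(t'),\mathbf m,t')\to0$ as $n\to\infty$; in particular $$\lim_{n\to\infty}\psi_1(\bar{\mathbf p}(t),\bar{\mathbf q}(t),\mathbf m,t)=\lim_{n\to\infty}\psi_1(\bar{\mathbf p}(0),\bar{\mathbf q}(0),\mathbf m,0)=\lim_{n\to\infty}\psi_1(\bar{\mathbf p}(1),\bar{\mathbf q}(1),\mathbf m,1),$$ in the sense that if one of the limits exists in $[-\infty,\infty]$, then all exist and are equal. (iii) For every set $\mathcal M$ of admissible vectors with $\mathbf m\in\mathcal M$ (for instance, all of them), $$\lim_{n\to\infty}\psi_S(\bar{\mathbf p}(1),\bar{\mathbf q}(1),\mathbf m,1)\;\ge\;\lim_{n\to\infty}\inf_{\boldsymbol\mu\in\mathcal M}\Big(-c\sum_{k=1}^{r+1}\big(\bar{\mathbf p}_{k-1}(0)\bar{\mathbf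 q}_{k-1}(0)-\bar{\mathbf p}_k(0)\bar{\mathbf q}_k(0)\big)\boldsymbol\mu_k\,\omega(k;p)+\psi_S(\bar{\mathbf p}(0),\bar{\mathbf q}(0),\boldsymbol\mu,0)\Big),$$ where infimum and limits are taken in $[-\infty,\infty]$; the inequality holds for the limits if they exist, and in general both for the lower and for the upper limits. -/

import Mathlib

open MeasureTheory ProbabilityTheory Filter Topology Set

noncomputable section

namespace Blirp

/-- The deterministic ingredients of a bilinearly indexed random process in dimension `n`:
the number `d` of rows of the Gaussian matrix, the families `x`, `xbar` (in `ℝⁿ`) and `y`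
(in `ℝᵈ`), each with `l` members, and the functions `f_{x̄} : ℝⁿ → ℝ`. -/
structure Data (n : ℕ) where
  d : ℕ
  l : ℕ
  x : Fin l → EuclideanSpace ℝ (Fin n)
  xbar : Fin l → EuclideanSpace ℝ (Fin n)
  y : Fin l → EuclideanSpace ℝ (Fin d)
  f : EuclideanSpace ℝ (Fin n) → EuclideanSpace ℝ (Fin n) → ℝ

/-- The scalar parameters `β, p, s`, the time `t`, and the lifting vectors
`𝐦 = (m 0, …, m (r+1))`, `𝐩 = (P 0, …, P (r+1))`, `𝐪 = (Q 0, …, Q (r+1))`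
(only these entries are ever used). -/
structure Params where
  β : ℝ
  p : ℝ
  s : ℝ
  t : ℝ
  m : ℕ → ℝ
  P : ℕ → ℝ
  Q : ℕ → ℝ

/-- `𝒰ₖ = (u^{(4,k)}, u^{(2,k)}, h^{(k)}) ∈ ℝ × ℝᵈ × ℝⁿ`. -/
abbrev NoiseU (n d : ℕ) : Type := ℝ × (Fin d → ℝ) × (Fin n → ℝ)

/-- The entries of the matrix `G ∈ ℝ^{d × n}`. -/
abbrev NoiseG (n d : ℕ) : Type := Fin d → Fin n → ℝ

/-- All the randomness: `G` and the sequence of the `𝒰ₖ`. -/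
abbrev Config (n d : ℕ) : Type := NoiseG n d × (ℕ → NoiseU n d)

/-- All components of `𝒰ₖ` are independent standard normals. -/
def gaussU (n d : ℕ) : Measure (NoiseU n d) :=
  (gaussianReal 0 1).prod
    ((Measure.pi fun _ : Fin d => gaussianReal 0 1).prod
      (Measure.pi fun _ : Fin n => gaussianReal 0 1))

/-- All entries of `G` are independent standard normals. -/
def gaussG (n d : ℕ) : Measure (NoiseG n d) :=
  Measure.pi fun _ : Fin d => Measure.pi fun _ : Fin n => gaussianReal 0 1

/-- `𝔼_{𝒰ₖ} F`, as a function of the remaining randomness. -/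
def expU {n d : ℕ} (k : ℕ) (F : Config n d → ℝ) : Config n d → ℝ :=
  fun w => ∫ u, F (w.1, Function.update w.2 k u) ∂(gaussU n d)

/-- `𝔼_{G, 𝒰_{r+1}} F`, for `F` depending on `G` and `𝒰_{r+1}` only. -/
def expTop {n d : ℕ} (r : ℕ) (F : Config n d → ℝ) : ℝ :=
  ∫ z, F (z.1, Function.update 0 (r + 1) z.2) ∂((gaussG n d).prod (gaussU n d))

/-- `aₖ`. -/
def Params.a (θ : Params) (k : ℕ) : ℝ :=
  Real.sqrt (θ.P (k - 1) * θ.Q (k - 1) - θ.P k * θ.Q k)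

/-- `bₖ`. -/
def Params.b (θ : Params) (k : ℕ) : ℝ := Real.sqrt (θ.P (k - 1) - θ.P k)

/-- `cₖ`. -/
def Params.c (θ : Params) (k : ℕ) : ℝ := Real.sqrt (θ.Q (k - 1) - θ.Q k)

/-- `ω(k; p)`. -/
def omega (k : ℕ) (p : ℝ) : ℝ := if k = 1 then 1 else p

/-- A random energy indexed by `i₁, i₂, i₃`. -/
abbrev Energy (n d l : ℕ) : Type := Config n d → Fin l → Fin l → Fin l → ℝ

section Functionals

variable {n : ℕ} (r : ℕ) (S : Data n) (θ : Params)

/-- The energy without the `u^{(4,k)}` terms, `D_{0,S}^{(i₁,i₂,i₃)}`. -/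
def D0S : Energy n S.d S.l := fun w i₁ i₂ i₃ =>
  Real.sqrt θ.t * ∑ j, S.y i₂ j * ∑ i, w.1 j i * S.x i₁ i
    + Real.sqrt (1 - θ.t) * ‖S.x i₁‖ *
        ∑ j, S.y i₂ j * ∑ k ∈ Finset.Icc 1 (r + 1), θ.b k * (w.2 k).2.1 j
    + Real.sqrt (1 - θ.t) * ‖S.y i₂‖ *
        ∑ i, (∑ k ∈ Finset.Icc 1 (r + 1), θ.c k * (w.2 k).2.2 i) * S.x i₁ i
    + S.f (S.xbar i₃) (S.x i₁)

/-- The energy `D_0^{(i₁,i₂,i₃)}`. -/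
def D0 : Energy n S.d S.l := fun w i₁ i₂ i₃ =>
  D0S r S θ w i₁ i₂ i₃
    + Real.sqrt θ.t * ‖S.x i₁‖ * ‖S.y i₂‖ *
        ∑ k ∈ Finset.Icc 1 (r + 1), θ.a k * (w.2 k).1

section Nested

variable {d l : ℕ} (D : Energy n d l)

/-- `A_{i₃}^{(i₁,i₂)}`. -/
def Afun (w : Config n d) (i₁ i₂ i₃ : Fin l) : ℝ := Real.exp (θ.β * D w i₁ i₂ i₃)

/-- `C_{i₃}^{(i₁)}`. -/
def Cfun (w : Config n d) (i₁ i₃ : Fin l) : ℝ := ∑ i₂, Afun θ D w i₁ i₂ i₃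

/-- `Z_{i₃}`. -/
def Zfun (i₃ : Fin l) (w : Config n d) : ℝ := ∑ i₁, Cfun θ D w i₁ i₃ ^ θ.s

/-- `𝔼_{𝒰₁} Z_{i₃}^{m₁}`. -/
def EZ (i₃ : Fin l) : Config n d → ℝ := expU 1 fun w => Zfun θ D i₃ w ^ θ.m 1

/-- `ζₖ` for `k ≥ 1`: `ζ₁ = ∑_{i₃} (𝔼_{𝒰₁} Z_{i₃}^{m₁})^p` and
`ζₖ = 𝔼_{𝒰ₖ} ζ_{k-1}^{mₖ / m_{k-1}}` for `k ≥ 2`. The value at `k = 0` is not used. -/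
def zeta : ℕ → Config n d → ℝ
  | 0 => fun _ => 1
  | 1 => fun w => ∑ i₃, EZ θ D i₃ w ^ θ.p
  | k + 2 => expU (k + 2) fun w => zeta (k + 1) w ^ (θ.m (k + 2) / θ.m (k + 1))

/-- `𝔼_{G,𝒰_{r+1}} (1 / (p |s| √n m_r)) log ζ_r` for the energy `D`. -/
def freeEnergy : ℝ :=
  expTop r fun w => 1 / (θ.p * |θ.s| * Real.sqrt n * θ.m r) * Real.log (zeta θ D r w)

/-- The operator `Φ_{𝒰₁}^{(i₃)}`. -/
def Phi1 (i₃ : Fin l) (F : Config n d → ℝ) : Config n d → ℝ :=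
  expU 1 fun w => Zfun θ D i₃ w ^ θ.m 1 / EZ θ D i₃ w * F w

/-- The operator `Φ_{𝒰ₖ}`, `k ≥ 2`. -/
def Phi (k : ℕ) (F : Config n d → ℝ) : Config n d → ℝ :=
  expU k fun w => zeta θ D (k - 1) w ^ (θ.m k / θ.m (k - 1)) / zeta θ D k w * F w

/-- The composition `Φ_{𝒰_{a+j}} ⋯ Φ_{𝒰_{a+2}} Φ_{𝒰_{a+1}}` (the identity if `j = 0`). -/
def iterPhi (a : ℕ) : ℕ → (Config n d → ℝ) → Config n d → ℝ
  | 0 => fun F => F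
  | j + 1 => fun F => Phi θ D (a + j + 1) (iterPhi a j F)

/-- `γ₀₀(i₃)`. -/
def gamma00 (i₃ : Fin l) (w : Config n d) : ℝ :=
  EZ θ D i₃ w ^ θ.p / ∑ i₃', EZ θ D i₃' w ^ θ.p

/-- `γ₀(i₁, i₂; i₃)`. -/
def gamma0 (i₁ i₂ i₃ : Fin l) (w : Config n d) : ℝ :=
  Cfun θ D w i₁ i₃ ^ θ.s / Zfun θ D i₃ w * (Afun θ D w i₁ i₂ i₃ / Cfun θ D w i₁ i₃)

/-- `γ₁^{(r)}`. -/
def gamma1 (i₁ i₂ p₁ p₂ i₃ : Fin l) : Config n d → ℝ :=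
  iterPhi θ D 1 (r - 1) fun w => gamma00 θ D i₃ w *
    Phi1 θ D i₃ (fun w' => gamma0 θ D i₁ i₂ i₃ w' * gamma0 θ D p₁ p₂ i₃ w') w

/-- `γ₂₂^{(r)}`. -/
def gamma22 (i₁ i₂ p₁ p₂ i₃ : Fin l) : Config n d → ℝ :=
  iterPhi θ D 1 (r - 1) fun w => gamma00 θ D i₃ w *
    (Phi1 θ D i₃ (gamma0 θ D i₁ i₂ i₃) w * Phi1 θ D i₃ (gamma0 θ D p₁ p₂ i₃) w)

/-- `γ_{k+1}^{(r)}` for `1 ≤ k ≤ r`; for `k = 1` it is `γ₂^{(r)} = γ₂₁^{(r)}`. -/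
def gammaPair (k : ℕ) (i₁ i₂ p₁ p₂ i₃ p₃ : Fin l) : Config n d → ℝ :=
  iterPhi θ D k (r - k) fun w =>
    iterPhi θ D 1 (k - 1)
        (fun w' => gamma00 θ D i₃ w' * Phi1 θ D i₃ (gamma0 θ D i₁ i₂ i₃) w') w *
      iterPhi θ D 1 (k - 1)
        (fun w' => gamma00 θ D p₃ w' * Phi1 θ D p₃ (gamma0 θ D p₁ p₂ p₃) w') w

end Nested

/-- The interpolating function `ψ(𝐩, 𝐪, 𝐦, t)`. -/
def psi : ℝ := freeEnergy (n := n) r θ (D0 r S θ)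

/-- The function `ψ_S(𝐩, 𝐪, 𝐦, t)`: as `ψ`, but without the `u^{(4,k)}` terms. -/
def psiS : ℝ := freeEnergy (n := n) r θ (D0S r S θ)

/-- `𝔼_{G,𝒰_{r+1}} ⟨F⟩` with respect to `γ₂₂^{(r)}`, `F = F(i₁, i₂, p₁, p₂)`. -/
def avg22 (F : Fin S.l → Fin S.l → Fin S.l → Fin S.l → ℝ) : ℝ :=
  expTop r fun w => ∑ i₁, ∑ i₂, ∑ p₁, ∑ p₂, ∑ i₃,
    F i₁ i₂ p₁ p₂ * gamma22 r θ (D0 r S θ) i₁ i₂ p₁ p₂ i₃ w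

/-- `𝔼_{G,𝒰_{r+1}} ⟨F⟩` with respect to `γₖ^{(r)}`, `k ≥ 1`. -/
def avg : ℕ → (Fin S.l → Fin S.l → Fin S.l → Fin S.l → ℝ) → ℝ
  | 0 => fun _ => 0
  | 1 => fun F => expTop r fun w => ∑ i₁, ∑ i₂, ∑ p₁, ∑ p₂, ∑ i₃,
      F i₁ i₂ p₁ p₂ * gamma1 r θ (D0 r S θ) i₁ i₂ p₁ p₂ i₃ w
  | k + 2 => fun F => expTop r fun w => ∑ i₁, ∑ i₂, ∑ p₁, ∑ p₂, ∑ i₃, ∑ p₃,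
      F i₁ i₂ p₁ p₂ * gammaPair r θ (D0 r S θ) (k + 1) i₁ i₂ p₁ p₂ i₃ p₃ w

/-- `‖x^{(i₁)}‖ ‖x^{(p₁)}‖ ‖y^{(i₂)}‖ ‖y^{(p₂)}‖`. -/
def mags (i₁ i₂ p₁ p₂ : Fin S.l) : ℝ := ‖S.x i₁‖ * ‖S.x p₁‖ * ‖S.y i₂‖ * ‖S.y p₂‖

/-- `𝐩ₖ ‖x^{(i₁)}‖ ‖x^{(p₁)}‖ - (x^{(p₁)})ᵀ x^{(i₁)}`. -/
def devX (k : ℕ) (i₁ _i₂ p₁ _p₂ : Fin S.l) : ℝ :=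
  θ.P k * (‖S.x i₁‖ * ‖S.x p₁‖) - inner ℝ (S.x p₁) (S.x i₁)

/-- `𝐪ₖ ‖y^{(i₂)}‖ ‖y^{(p₂)}‖ - (y^{(p₂)})ᵀ y^{(i₂)}`. -/
def devY (k : ℕ) (_i₁ i₂ _p₁ p₂ : Fin S.l) : ℝ :=
  θ.Q k * (‖S.y i₂‖ * ‖S.y p₂‖) - inner ℝ (S.y p₂) (S.y i₂)

/-- `sign(s) s β² / (2 √n)`. -/
def pref (n : ℕ) (θ : Params) : ℝ :=
  Real.sign θ.s * θ.s * θ.β ^ 2 / (2 * Real.sqrt n)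

/-- The function `ψ₁(𝐩, 𝐪, 𝐦, t)`. -/
def psi1 : ℝ :=
  -pref n θ * ∑ k ∈ Finset.Icc 1 (r + 1),
      (θ.P (k - 1) * θ.Q (k - 1) * avg r S θ k (mags S)
        - θ.P k * θ.Q k * avg r S θ (k + 1) (mags S)) * θ.m k * omega k θ.p
    + psi r S θ

/-- The left side of the `𝐩ₖ`-stationarity equation, `1 ≤ k ≤ r`. -/
def statP (k : ℕ) : ℝ :=
  (1 - θ.t) * (θ.m k - θ.m (k + 1)) * θ.p * pref n θ *
      avg r S θ (k + 1) (fun i₁ i₂ p₁ p₂ => ‖S.x i₁‖ * ‖S.x p₁‖ * devY S θ k i₁ i₂ p₁ p₂)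
    - if k = 1 then (1 - θ.t) * θ.m 1 * (θ.p - 1) * pref n θ *
        avg22 r S θ (fun i₁ i₂ p₁ p₂ => ‖S.x i₁‖ * ‖S.x p₁‖ * devY S θ 1 i₁ i₂ p₁ p₂)
      else 0

/-- The left side of the `𝐪ₖ`-stationarity equation, `1 ≤ k ≤ r`. -/
def statQ (k : ℕ) : ℝ :=
  (1 - θ.t) * (θ.m k - θ.m (k + 1)) * θ.p * pref n θ *
      avg r S θ (k + 1) (fun i₁ i₂ p₁ p₂ => ‖S.y i₂‖ * ‖S.y p₂‖ * devX S θ k i₁ i₂ p₁ p₂)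
    - if k = 1 then (1 - θ.t) * θ.m 1 * (θ.p - 1) * pref n θ *
        avg22 r S θ (fun i₁ i₂ p₁ p₂ => ‖S.y i₂‖ * ‖S.y p₂‖ * devX S θ 1 i₁ i₂ p₁ p₂)
      else 0

/-- `φₖ^{(r)}`, `1 ≤ k ≤ r + 1`. -/
def phi (k : ℕ) : ℝ :=
  -θ.s * (θ.m (k - 1) - θ.m k) * omega k θ.p *
    avg r S θ k (fun i₁ i₂ p₁ p₂ =>
      devX S θ (k - 1) i₁ i₂ p₁ p₂ * devY S θ (k - 1) i₁ i₂ p₁ p₂)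

/-- `φ₂₂^{(r)}`. -/
def phi22 : ℝ :=
  -θ.s * θ.m 1 * (1 - θ.p) *
    avg22 r S θ (fun i₁ i₂ p₁ p₂ => devX S θ 1 i₁ i₂ p₁ p₂ * devY S θ 1 i₁ i₂ p₁ p₂)

/-- `φ_{k+1}^{(r)} = 0` for `2 ≤ k ≤ r`, and `φ₂^{(r)} + φ₂₂^{(r)} = 0` for `k = 1`. -/
def PhiVanishes (k : ℕ) : Prop :=
  phi r S θ (k + 1) + (if k = 1 then phi22 r S θ else 0) = 0

/-- Mean square of `F` in the total variation of the signed measure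
`(mₖ - m_{k+1}) p γ_{k+1}`, to which `m₁ (1 - p) γ₂₂` is added for `k = 1`. This is the
signed measure that the `k`-th stationarity equations and `φ_{k+1}` (with `φ₂₂`, if `k = 1`)
integrate against. -/
def meanSq (k : ℕ) (F : Fin S.l → Fin S.l → Fin S.l → Fin S.l → ℝ) : ℝ :=
  |(θ.m k - θ.m (k + 1)) * θ.p| * avg r S θ (k + 1) (fun i₁ i₂ p₁ p₂ => F i₁ i₂ p₁ p₂ ^ 2)
    + if k = 1 then
        |θ.m 1 * (1 - θ.p)| * avg22 r S θ (fun i₁ i₂ p₁ p₂ => F i₁ i₂ p₁ p₂ ^ 2)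
      else 0

/-- The explicit correction plus `ψ_S`, as it appears under the infimum. -/
def bound : ℝ :=
  -pref n θ * ∑ k ∈ Finset.Icc 1 (r + 1),
      (θ.P (k - 1) * θ.Q (k - 1) - θ.P k * θ.Q k) * θ.m k * omega k θ.p
    + psiS r S θ

end Functionals

/-- The conditions on the vector `𝐦`: `m₀ = m₁ = 1`, `m_{r+1} = 0`, and the entries that are
divided by do not vanish. -/
def Admissible (r : ℕ) (m : ℕ → ℝ) : Prop :=
  m 0 = 1 ∧ m 1 = 1 ∧ m (r + 1) = 0 ∧ ∀ k ∈ Finset.Icc 1 r, m k ≠ 0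

/-- `1 = v₀ ≥ v₁ ≥ ⋯ ≥ v_r ≥ v_{r+1} = 0`. -/
def Ordered (r : ℕ) (v : ℕ → ℝ) : Prop :=
  v 0 = 1 ∧ v (r + 1) = 0 ∧ ∀ k ∈ Finset.Icc 1 (r + 1), v k ≤ v (k - 1)

/-- The overlaps concentrate, as `n → ∞`, at the `k`-th components of `𝐩` and `𝐪`. -/
def Concentrates (r : ℕ) (S : ∀ n : ℕ, Data n) (θ : ℕ → Params) (k : ℕ) : Prop :=
  Tendsto (fun n => meanSq r (S n) (θ n) k (devX (S n) (θ n) k)) atTop (𝓝 0) ∧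
    Tendsto (fun n => meanSq r (S n) (θ n) k (devY (S n) (θ n) k)) atTop (𝓝 0)

end Blirp

end

/-! With unit norms, `D0` is a linear function of independent standard Gaussians `z c`. Each carries
a direction `e c i₁ i₂` and a level, the index of the expectation that integrates it; the entries of
`G` have level `r + 1`. The coefficients are `√(v c)`, and the variances `v c` are polynomials in
`t`, `𝐩(t)`, `𝐪(t)`. Differentiating `ψ` along a path thus means differentiating the free energy in
the variances.

In a coefficient `α c`, the derivative is a nested average of `z c * e c`. Gaussian integration by
parts at the level of `z c` turns it into `α c` times a multiple of a curvature average `L_k(e c)`,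
`k = lev c` (`LinModel.expTop_mean1_coordEnergy`). The factor `α c` makes the free energy
differentiable in `v c = α c ^ 2` even at `v c = 0` (`hasFDerivWithinAt_comp_sqrt`), which covers `t
= 0`, `t = 1` and coinciding components of `𝐩` or `𝐪`.

Each further level costs a square: `L_{k+1}(e) = L_k(e) - s νₖ[e ⊗ e]` (`levelAvg_succ`,
`lossAvg_eq`). After an exchange of sums, `νₖ` is tested against the `t`-derivative of the
covariance of the levels above `k`, which is `t (X Y + 𝐩ₖ 𝐪ₖ) + (1 - t) (𝐩ₖ Y + 𝐪ₖ X)`. That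
derivative is `(𝐩ₖ - X)(𝐪ₖ - Y)` plus `(𝐩ₖ 𝐪ₖ)' - (1 - t) 𝐩ₖ' (𝐪ₖ - Y) - (1 - t) 𝐪ₖ' (𝐩ₖ - X)`. The
`L_1` terms cancel, because for `p₁ = i₁` the total covariance is `1 + Y`, independent of `t`.

The constant `(𝐩ₖ 𝐪ₖ)'` is cancelled by the correction in `ψ₁` after summation by parts, and
stationarity removes the two linear terms. What remains is `ψ₁' = -c ∑ νₖ[(𝐩ₖ - X)(𝐪ₖ - Y)]`
(`hasDerivWithinAt_psi1`). It is zero under `(*)`, and tends to zero under concentration by `2 |a b|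
≤ a² + b²`. As it is bounded uniformly in `n` and `t`, dominated convergence makes `ψ₁`
asymptotically constant in `t` (`tendsto_sub_of_tendsto_deriv`).

At `t = 1` the `u^{(4,k)}` terms are noise common to all indices. They factor out of every `ζₖ` and
contribute exactly the correction, so `ψ₁ = ψ_S` (`psi1_one`). At `t = 0` they are absent, so `ψ₁`
is the functional under the infimum at `𝐦` (`psi1_zero`), which is at least the infimum. -/

noncomputable section

/-! ### Gaussian integration by parts for functions of exponential growth. -/

namespace Blirp

/-- All exponential moments of the norm are finite. -/
def ExpMoments {Y : Type*} [NormedAddCommGroup Y] [MeasurableSpace Y] (μ : Measure Y) : Prop :=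
  ∀ C : ℝ, Integrable (fun y => Real.exp (C * ‖y‖)) μ

/-- At most exponential growth. -/
def ExpGrowth {Y : Type*} [NormedAddCommGroup Y] (F : Y → ℝ) : Prop :=
  ∃ C : ℝ, ∀ y, |F y| ≤ Real.exp (C * (1 + ‖y‖))

/-- Gaussian integration by parts for the coordinate `z` of `μ` in the direction `δ`. -/
structure GaussIBP {Y : Type*} [NormedAddCommGroup Y] [NormedSpace ℝ Y] [MeasurableSpace Y]
    (μ : Measure Y) (z : Y → ℝ) (δ : Y) : Prop where
  cont : Continuous z
  le_norm : ∀ y, |z y| ≤ ‖y‖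
  ibp : ∀ F F' : Y → ℝ, Continuous F → Continuous F' → ExpGrowth F → ExpGrowth F' →
    (∀ y, HasDerivAt (fun τ : ℝ => F (y + τ • δ)) (F' y) 0) →
    ∫ y, z y * F y ∂μ = ∫ y, F' y ∂μ

section Growth

variable {Y : Type*} [NormedAddCommGroup Y]

lemma le_exp_self (x : ℝ) : x ≤ Real.exp x := by linarith [Real.add_one_le_exp x]

lemma ExpGrowth.mul {F G : Y → ℝ} (hF : ExpGrowth F) (hG : ExpGrowth G) :
    ExpGrowth (fun y => F y * G y) := by
  obtain ⟨C, hC⟩ := hF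
  obtain ⟨C', hC'⟩ := hG
  refine ⟨C + C', fun y => ?_⟩
  rw [abs_mul, add_mul, Real.exp_add]
  exact mul_le_mul (hC y) (hC' y) (abs_nonneg _) (Real.exp_pos _).le

lemma ExpGrowth.of_le_norm {z : Y → ℝ} (h : ∀ y, |z y| ≤ ‖y‖) : ExpGrowth z :=
  ⟨1, fun y => (h y).trans (by linarith [le_exp_self (1 * (1 + ‖y‖))])⟩

variable [MeasurableSpace Y] [OpensMeasurableSpace Y]

lemma ExpMoments.integrable {μ : Measure Y} (hμ : ExpMoments μ) {F : Y → ℝ}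
    (hc : Continuous F) (hF : ExpGrowth F) : Integrable F μ := by
  obtain ⟨C, hC⟩ := hF
  refine ((hμ C).const_mul (Real.exp C)).mono' hc.aestronglyMeasurable (.of_forall fun y => ?_)
  rw [← Real.exp_add, Real.norm_eq_abs]
  convert hC y using 2
  ring

end Growth

lemma expMoments_gaussianReal : ExpMoments (gaussianReal 0 1) := by
  intro C
  refine ((integrable_exp_mul_gaussianReal (μ := 0) (v := 1) C).add
    (integrable_exp_mul_gaussianReal (-C))).mono'
    (by fun_prop) (.of_forall fun y => ?_)
  rw [Real.norm_eq_abs, abs_of_pos (Real.exp_pos _), Real.norm_eq_abs]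
  simp only [Pi.add_apply]
  rcases abs_cases y with ⟨h, _⟩ | ⟨h, _⟩ <;> rw [h]
  · linarith [Real.exp_pos (-C * y)]
  · rw [show C * -y = -C * y by ring]
    linarith [Real.exp_pos (C * y)]

section Prod

variable {Y Y' : Type*} [NormedAddCommGroup Y] [MeasurableSpace Y] [OpensMeasurableSpace Y]
  [SecondCountableTopology Y] [NormedAddCommGroup Y'] [MeasurableSpace Y']
  [OpensMeasurableSpace Y'] [SecondCountableTopology Y'] {μ : Measure Y} {ν : Measure Y'}

lemma ExpMoments.prod [SFinite μ] [SFinite ν] (hμ : ExpMoments μ) (hν : ExpMoments ν) :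
    ExpMoments (μ.prod ν) := by
  intro C
  refine ((hμ |C|).mul_prod (hν |C|)).mono' (by fun_prop) (.of_forall fun y => ?_)
  rw [Real.norm_eq_abs, abs_of_pos (Real.exp_pos _), ← Real.exp_add, Real.exp_le_exp, ← mul_add]
  have h : ‖y‖ ≤ ‖y.1‖ + ‖y.2‖ := by
    rw [Prod.norm_def]
    exact max_le_add_of_nonneg (norm_nonneg _) (norm_nonneg _)
  exact (mul_le_mul_of_nonneg_right (le_abs_self C) (norm_nonneg _)).trans
    (mul_le_mul_of_nonneg_left h (abs_nonneg _))

lemma ExpMoments.pi [SigmaFinite μ] (hμ : ExpMoments μ) (d : ℕ) :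
    ExpMoments (Measure.pi fun _ : Fin d => μ) := by
  intro C
  refine (Integrable.fintype_prod (μ := fun _ : Fin d => μ)
    (f := fun _ y => Real.exp (|C| * ‖y‖)) fun _ => hμ |C|).mono' ?_ (.of_forall fun y => ?_)
  · exact Continuous.aestronglyMeasurable (by fun_prop)
  · rw [Real.norm_eq_abs, abs_of_pos (Real.exp_pos _), ← Real.exp_sum, Real.exp_le_exp,
      ← Finset.mul_sum]
    have h : ‖y‖ ≤ ∑ i, ‖y i‖ :=
      (pi_norm_le_iff_of_nonneg (Finset.sum_nonneg fun _ _ => norm_nonneg _)).2 fun i =>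
        Finset.single_le_sum (f := fun i => ‖y i‖) (fun _ _ => norm_nonneg _) (Finset.mem_univ i)
    exact (mul_le_mul_of_nonneg_right (le_abs_self C) (norm_nonneg _)).trans
      (mul_le_mul_of_nonneg_left h (abs_nonneg _))

end Prod

/-- The density satisfies `φ' = -x φ`, so this is integration by parts on the line; exponential
growth makes all products with `φ` integrable. -/
lemma gaussIBP_gaussianReal : GaussIBP (gaussianReal 0 1) (fun x : ℝ => x) 1 where
  cont := continuous_id
  le_norm y := by simp
  ibp F F' hc hc' hg hg' hd := by
    have hone : (1 : NNReal) ≠ 0 := one_ne_zero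
    have hint : ∀ G : ℝ → ℝ, Continuous G → ExpGrowth G →
        Integrable (fun x => gaussianPDFReal 0 1 x * G x) := by
      intro G hG hG'
      have := expMoments_gaussianReal.integrable hG hG'
      rw [gaussianReal_of_var_ne_zero _ hone,
        integrable_withDensity_iff_integrable_smul' (measurable_gaussianPDF 0 1)
          (.of_forall fun _ => gaussianPDF_lt_top)] at this
      simpa [toReal_gaussianPDF] using this
    have hpdf : ∀ x : ℝ, HasDerivAt (gaussianPDFReal 0 1) (-(x * gaussianPDFReal 0 1 x)) x := by
      intro x
      rw [gaussianPDFReal_def]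
      have h1 : HasDerivAt (fun x : ℝ => -(x - 0) ^ 2 / (2 * ((1 : NNReal) : ℝ))) (-x) x :=
        ((((hasDerivAt_id' x).sub_const (0 : ℝ)).fun_pow 2).fun_neg.div_const
          (2 * ((1 : NNReal) : ℝ))).congr_deriv (by simp; ring)
      exact (h1.exp.const_mul ((√(2 * Real.pi * ((1 : NNReal) : ℝ)))⁻¹)).congr_deriv (by ring)
    -- The hypothesis gives the derivative of a translate at `0`; the substitution `τ = u - x` moves
    -- it to `x`.
    have hF : ∀ x, HasDerivAt F (F' x) x := by
      intro x
      have h := hd x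
      have h2 : HasDerivAt (fun τ : ℝ => F (x + τ • (1 : ℝ))) (F' x) (x - x) := by simpa using h
      have h3 := HasDerivAt.comp x (h₂ := fun τ : ℝ => F (x + τ • (1 : ℝ))) (h := fun u => u - x) h2
        ((hasDerivAt_id x).sub_const x)
      simpa [Function.comp_def] using h3
    rw [integral_gaussianReal_eq_integral_smul hone, integral_gaussianReal_eq_integral_smul hone]
    have key := integral_mul_deriv_eq_deriv_mul_of_integrable
      (u := gaussianPDFReal 0 1) (u' := fun x => -(x * gaussianPDFReal 0 1 x)) (v := F) (v' := F')
      (fun x _ => hpdf x) (fun x _ => hF x) (hint F' hc' hg') ?_ (hint F hc hg)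
    · simp only [smul_eq_mul]
      rw [key, ← integral_neg]
      congr 1 with x
      ring
    · have hxF := hint (fun x => x * F x) (by fun_prop)
        ((ExpGrowth.of_le_norm (z := fun x : ℝ => x) fun y => by simp).mul hg)
      exact hxF.neg.congr (.of_forall fun x => by simp only [Pi.neg_apply, Pi.mul_apply]; ring)

section IBPProd

variable {Y Y' W : Type*} [NormedAddCommGroup Y] [NormedSpace ℝ Y] [MeasurableSpace Y]
  [OpensMeasurableSpace Y] [SecondCountableTopology Y] [NormedAddCommGroup Y']
  [MeasurableSpace Y'] [OpensMeasurableSpace Y'] [SecondCountableTopology Y']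
  [NormedAddCommGroup W] [NormedSpace ℝ W] [MeasurableSpace W] [BorelSpace W]
  {μ : Measure Y} {ν : Measure Y'} {κ : Measure W}

/-- Integration by parts for a measure that has a factor for which it holds. -/
lemma GaussIBP.of_factor [SFinite μ] [SFinite ν] (hμ : ExpMoments μ) (hν : ExpMoments ν)
    {z : Y → ℝ} {δ : Y} (h : GaussIBP μ z δ) {J : Y × Y' → W} (hJ : Continuous J)
    (hJm : MeasurePreserving J (μ.prod ν) κ) (hJn : ∀ y, ‖J y‖ ≤ ‖y.1‖ + ‖y.2‖)
    {z' : W → ℝ} {δ' : W} (hz' : Continuous z') (hzn : ∀ y, |z' y| ≤ ‖y‖)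
    (hzJ : ∀ y, z' (J y) = z y.1)
    (hδ : ∀ a b (τ : ℝ), J (a + τ • δ, b) = J (a, b) + τ • δ') : GaussIBP κ z' δ' where
  cont := hz'
  le_norm := hzn
  ibp F F' hc hc' hg hg' hd := by
    have growth : ∀ {G : W → ℝ}, ExpGrowth G → ∃ C, ∀ y : Y × Y',
        |G (J y)| ≤ Real.exp (|C| * (1 + (‖y.1‖ + ‖y.2‖))) := by
      rintro G ⟨C, hC⟩
      refine ⟨C, fun y => (hC _).trans (Real.exp_le_exp.2 ?_)⟩
      exact (mul_le_mul_of_nonneg_right (le_abs_self C) (by positivity)).trans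
        (mul_le_mul_of_nonneg_left (by linarith [hJn y]) (abs_nonneg _))
    have growthJ : ∀ {G : W → ℝ}, ExpGrowth G → ExpGrowth fun y => G (J y) := by
      intro G hG
      obtain ⟨C, hC⟩ := growth hG
      refine ⟨2 * |C|, fun y => (hC y).trans (Real.exp_le_exp.2 ?_)⟩
      rw [mul_comm 2, mul_assoc]
      exact mul_le_mul_of_nonneg_left (by linarith [norm_fst_le y, norm_snd_le y]) (abs_nonneg _)
    -- The growth constant may depend on `b`: the one-factor formula is applied for each frozen `b`
    -- separately, and only the joint bound `growthJ` is used for Fubini.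
    have growthS : ∀ {G : W → ℝ}, ExpGrowth G → ∀ b, ExpGrowth fun a => G (J (a, b)) := by
      intro G hG b
      obtain ⟨C, hC⟩ := growth hG
      refine ⟨|C| * (1 + ‖b‖), fun a => (hC (a, b)).trans (Real.exp_le_exp.2 ?_)⟩
      rw [mul_assoc]
      refine mul_le_mul_of_nonneg_left ?_ (abs_nonneg _)
      simp only
      nlinarith [norm_nonneg a, norm_nonneg b, mul_nonneg (norm_nonneg b) (norm_nonneg a)]
    have fub : ∀ {G : W → ℝ}, Continuous G → ExpGrowth G →
        ∫ y, G y ∂κ = ∫ b, ∫ a, G (J (a, b)) ∂μ ∂ν := by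
      intro G hG hG'
      rw [← hJm.map_eq, integral_map hJm.measurable.aemeasurable hG.aestronglyMeasurable]
      exact integral_prod_symm (fun y => G (J y)) ((hμ.prod hν).integrable (hG.comp hJ)
        (growthJ hG'))
    rw [fub (G := fun y => z' y * F y) (by fun_prop) ((ExpGrowth.of_le_norm hzn).mul hg),
      fub hc' hg']
    congr 1 with b
    simp only [hzJ]
    refine h.ibp (fun a => F (J (a, b))) (fun a => F' (J (a, b))) (by fun_prop) (by fun_prop)
      (growthS hg b) (growthS hg' b) fun a => ?_
    simpa only [hδ] using hd (J (a, b))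

end IBPProd

section Products

variable {Y Y' : Type*} [NormedAddCommGroup Y] [NormedSpace ℝ Y] [MeasurableSpace Y]
  [BorelSpace Y] [SecondCountableTopology Y] [NormedAddCommGroup Y'] [NormedSpace ℝ Y']
  [MeasurableSpace Y'] [BorelSpace Y'] [SecondCountableTopology Y']
  {μ : Measure Y} {ν : Measure Y'}

lemma GaussIBP.prod_left [SFinite μ] [SFinite ν] (hμ : ExpMoments μ) (hν : ExpMoments ν)
    {z : Y → ℝ} {δ : Y} (h : GaussIBP μ z δ) :
    GaussIBP (μ.prod ν) (fun y => z y.1) (δ, 0) :=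
  h.of_factor hμ hν (J := fun y => y) continuous_id (.id _)
    (fun y => by
      rw [Prod.norm_def]
      exact max_le_add_of_nonneg (norm_nonneg _) (norm_nonneg _))
    (h.cont.comp continuous_fst) (fun y => (h.le_norm y.1).trans (norm_fst_le y)) (fun _ => rfl)
    (fun a b τ => by simp)

lemma GaussIBP.prod_right [SFinite μ] [SFinite ν] (hμ : ExpMoments μ) (hν : ExpMoments ν)
    {z : Y' → ℝ} {δ : Y'} (h : GaussIBP ν z δ) :
    GaussIBP (μ.prod ν) (fun y => z y.2) (0, δ) :=
  h.of_factor hν hμ (J := Prod.swap) continuous_swap Measure.measurePreserving_swap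
    (fun y => by
      rw [Prod.norm_def, add_comm]
      exact max_le_add_of_nonneg (norm_nonneg _) (norm_nonneg _))
    (h.cont.comp continuous_snd) (fun y => (h.le_norm y.2).trans (norm_snd_le y)) (fun _ => rfl)
    (fun a b τ => by simp)

/-- `Fin.insertNth i` presents the power of `μ` as the `i`-th factor times the rest, which reduces
the claim to a product of two measures. -/
lemma GaussIBP.pi [SigmaFinite μ] (hμ : ExpMoments μ) {z : Y → ℝ} {δ : Y} (h : GaussIBP μ z δ)
    {d : ℕ} (i : Fin d) :
    GaussIBP (Measure.pi fun _ : Fin d => μ) (fun y => z (y i)) (Pi.single i δ) := by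
  obtain ⟨d, rfl⟩ : ∃ d', d = d' + 1 := Nat.exists_eq_succ_of_ne_zero (by
    rintro rfl
    exact i.elim0)
  have hJc : Continuous fun y : Y × (Fin d → Y) => (i.insertNth y.1 y.2 : Fin (d + 1) → Y) := by
    fun_prop
  refine h.of_factor hμ (hμ.pi d)
    (J := fun y : Y × (Fin d → Y) => (i.insertNth y.1 y.2 : Fin (d + 1) → Y)) hJc
    ?_ ?_ (h.cont.comp (continuous_apply i)) (fun y => (h.le_norm _).trans (norm_le_pi_norm y i))
    (fun y => by simp) (fun a b τ => ?_)
  · exact (measurePreserving_piFinSuccAbove (fun _ : Fin (d + 1) => μ) i).symm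
  · intro y
    refine (pi_norm_le_iff_of_nonneg (by positivity)).2 fun j => ?_
    refine Fin.succAboveCases i ?_ (fun j => ?_) j
    · simp
    · simpa using (norm_le_pi_norm y.2 j).trans (by simp)
  · ext j
    refine Fin.succAboveCases i ?_ (fun j => ?_) j <;> simp

end Products

variable {n d : ℕ}

instance : IsProbabilityMeasure (gaussU n d) := by unfold gaussU; infer_instance

instance : IsProbabilityMeasure (gaussG n d) := by unfold gaussG; infer_instance

lemma expMoments_gaussU : ExpMoments (gaussU n d) :=
  expMoments_gaussianReal.prod
    ((expMoments_gaussianReal.pi d).prod (expMoments_gaussianReal.pi n))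

lemma expMoments_gaussG : ExpMoments (gaussG n d) := (expMoments_gaussianReal.pi n).pi d

lemma gaussIBP_gaussU_fst : GaussIBP (gaussU n d) (fun u => u.1) (1, 0) :=
  gaussIBP_gaussianReal.prod_left expMoments_gaussianReal
    ((expMoments_gaussianReal.pi d).prod (expMoments_gaussianReal.pi n))

lemma gaussIBP_gaussU_snd (j : Fin d) :
    GaussIBP (gaussU n d) (fun u => u.2.1 j) (0, Pi.single j 1, 0) :=
  ((gaussIBP_gaussianReal.pi expMoments_gaussianReal j).prod_left (expMoments_gaussianReal.pi d)
    (expMoments_gaussianReal.pi n)).prod_right expMoments_gaussianReal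
      ((expMoments_gaussianReal.pi d).prod (expMoments_gaussianReal.pi n))

lemma gaussIBP_gaussU_trd (j : Fin n) :
    GaussIBP (gaussU n d) (fun u => u.2.2 j) (0, 0, Pi.single j 1) :=
  ((gaussIBP_gaussianReal.pi expMoments_gaussianReal j).prod_right (expMoments_gaussianReal.pi d)
    (expMoments_gaussianReal.pi n)).prod_right expMoments_gaussianReal
      ((expMoments_gaussianReal.pi d).prod (expMoments_gaussianReal.pi n))

lemma gaussIBP_gaussG (j : Fin d) (i : Fin n) :
    GaussIBP (gaussG n d) (fun g => g j i) (Pi.single j (Pi.single i 1)) :=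
  (gaussIBP_gaussianReal.pi expMoments_gaussianReal i).pi (expMoments_gaussianReal.pi n) j

/-! ### Growth classes of functions of the randomness, stable under all operations of the model. -/

section Tame

variable {n d : ℕ}

/-- A weight on configurations that grows linearly, and with the constant `C`. -/
def weight (C : ℕ) (w : Config n d) : ℝ :=
  C * (1 + (‖w.1‖ + ∑ k ∈ Finset.range C, ‖w.2 k‖))

lemma weight_nonneg (C : ℕ) (w : Config n d) : 0 ≤ weight C w := by unfold weight; positivity

lemma continuous_weight (C : ℕ) : Continuous (weight C : Config n d → ℝ) := by
  unfold weight
  fun_prop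

lemma weight_mono {C C' : ℕ} (h : C ≤ C') (w : Config n d) : weight C w ≤ weight C' w := by
  unfold weight
  have h1 : ∑ k ∈ Finset.range C, ‖w.2 k‖ ≤ ∑ k ∈ Finset.range C', ‖w.2 k‖ :=
    Finset.sum_le_sum_of_subset_of_nonneg (Finset.range_mono h) fun _ _ _ => norm_nonneg _
  have h2 : (C : ℝ) ≤ C' := by exact_mod_cast h
  gcongr

/-- A configuration is an infinite sequence, so growth is measured in finitely many components. One
natural number serves both as slope and as number of visible components, and sums and multiples of
weights are dominated by a weight of larger index. -/
lemma weight_add (C C' : ℕ) (w : Config n d) : weight C w + weight C' w ≤ weight (C + C') w := by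
  have h1 := weight_mono (Nat.le_add_right C C') w
  unfold weight at *
  have h2 : ∑ k ∈ Finset.range C, ‖w.2 k‖ ≤ ∑ k ∈ Finset.range (C + C'), ‖w.2 k‖ :=
    Finset.sum_le_sum_of_subset_of_nonneg (Finset.range_mono (by omega)) fun _ _ _ => norm_nonneg _
  have h3 : ∑ k ∈ Finset.range C', ‖w.2 k‖ ≤ ∑ k ∈ Finset.range (C + C'), ‖w.2 k‖ :=
    Finset.sum_le_sum_of_subset_of_nonneg (Finset.range_mono (by omega)) fun _ _ _ => norm_nonneg _
  push_cast
  rw [add_mul]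
  gcongr

lemma le_weight_one_add (C : ℕ) (w : Config n d) : (C : ℝ) ≤ weight C w := by
  unfold weight
  have : 0 ≤ ‖w.1‖ + ∑ k ∈ Finset.range C, ‖w.2 k‖ := by positivity
  nlinarith [Nat.cast_nonneg (α := ℝ) C]

lemma add_weight_le (K C : ℕ) (w : Config n d) : K + weight C w ≤ weight (K + C) w :=
  (by linarith [le_weight_one_add K w] : _ ≤ weight K w + weight C w).trans (weight_add K C w)

lemma mul_weight_le (K C : ℕ) (w : Config n d) : K * weight C w ≤ weight (K * C) w := by
  induction K with
  | zero => simpa using weight_nonneg _ w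
  | succ K ih =>
    rw [Nat.succ_mul]
    refine le_trans ?_ (weight_add _ _ w)
    push_cast
    linarith

variable {X : Type*} [TopologicalSpace X]

/-- Continuous, and of linear growth in the configuration, locally uniformly in the parameter. -/
structure LinTame (F : X → Config n d → ℝ) : Prop where
  cont : Continuous fun q : X × Config n d => F q.1 q.2
  bound : ∀ x₀, ∃ C : ℕ, ∀ᶠ x in 𝓝 x₀, ∀ w, |F x w| ≤ weight C w

/-- Continuous, and of exponential growth in the configuration, locally uniformly in the
parameter. -/
structure Tame (F : X → Config n d → ℝ) : Prop where
  cont : Continuous fun q : X × Config n d => F q.1 q.2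
  bound : ∀ x₀, ∃ C : ℕ, ∀ᶠ x in 𝓝 x₀, ∀ w, |F x w| ≤ Real.exp (weight C w)

/-- Positive, with a logarithm of linear growth. -/
structure PosTame (F : X → Config n d → ℝ) : Prop where
  pos : ∀ x w, 0 < F x w
  log : LinTame fun x w => Real.log (F x w)

namespace LinTame

variable {F G : X → Config n d → ℝ}

lemma add (hF : LinTame F) (hG : LinTame G) : LinTame fun x w => F x w + G x w where
  cont := hF.cont.add hG.cont
  bound x₀ := by
    obtain ⟨C, hC⟩ := hF.bound x₀
    obtain ⟨C', hC'⟩ := hG.bound x₀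
    refine ⟨C + C', ?_⟩
    filter_upwards [hC, hC'] with x h h' w
    exact (abs_add_le _ _).trans ((add_le_add (h w) (h' w)).trans (weight_add _ _ w))

lemma param_mul {a : X → ℝ} (ha : Continuous a) (hF : LinTame F) :
    LinTame fun x w => a x * F x w where
  cont := (ha.comp continuous_fst).mul hF.cont
  bound x₀ := by
    obtain ⟨C, hC⟩ := hF.bound x₀
    obtain ⟨K, hK⟩ := exists_nat_gt |a x₀|
    refine ⟨K * C, ?_⟩
    filter_upwards [hC, (ha.abs.tendsto x₀).eventually_lt_const hK] with x h h' w
    rw [abs_mul]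
    exact (mul_le_mul h'.le (h w) (abs_nonneg _) (Nat.cast_nonneg K)).trans (mul_weight_le K C w)

lemma const_mul (a : ℝ) (hF : LinTame F) : LinTame fun x w => a * F x w :=
  param_mul continuous_const hF

lemma const (a : ℝ) : LinTame fun (_ : X) (_ : Config n d) => a where
  cont := continuous_const
  bound _ := by
    obtain ⟨K, hK⟩ := exists_nat_gt |a|
    exact ⟨K, .of_forall fun _ w => hK.le.trans (le_weight_one_add K w)⟩

lemma sum {ι : Type*} (s : Finset ι) {F : ι → X → Config n d → ℝ} (h : ∀ i ∈ s, LinTame (F i)) :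
    LinTame fun x w => ∑ i ∈ s, F i x w := by
  classical
  induction s using Finset.induction_on with
  | empty => simpa using const 0
  | insert a s ha ih =>
    simp only [Finset.sum_insert ha]
    exact (h a (by simp)).add (ih fun i hi => h i (by simp [hi]))

lemma tame (hF : LinTame F) : Tame F where
  cont := hF.cont
  bound x₀ := by
    obtain ⟨C, hC⟩ := hF.bound x₀
    exact ⟨C, hC.mono fun x h w => (h w).trans (le_exp_self _)⟩

lemma exp (hF : LinTame F) : PosTame fun x w => Real.exp (F x w) where
  pos _ _ := Real.exp_pos _
  log := by simpa only [Real.log_exp] using hF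

lemma comp_param {X' : Type*} [TopologicalSpace X'] {a : X' → X} (ha : Continuous a)
    (hF : LinTame F) : LinTame fun x w => F (a x) w where
  cont := hF.cont.comp ((ha.comp continuous_fst).prodMk continuous_snd)
  bound x₀ := by
    obtain ⟨C, hC⟩ := hF.bound (a x₀)
    exact ⟨C, ha.continuousAt.eventually hC⟩

end LinTame

namespace Tame

variable {F G : X → Config n d → ℝ}

lemma add (hF : Tame F) (hG : Tame G) : Tame fun x w => F x w + G x w where
  cont := hF.cont.add hG.cont
  bound x₀ := by
    obtain ⟨C, hC⟩ := hF.bound x₀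
    obtain ⟨C', hC'⟩ := hG.bound x₀
    refine ⟨1 + (C + C'), ?_⟩
    filter_upwards [hC, hC'] with x h h' w
    have h1 := Real.exp_le_exp.2 (weight_mono (Nat.le_add_right C C') w)
    have h2 := Real.exp_le_exp.2 (weight_mono (Nat.le_add_left C' C) w)
    have h3 := Real.exp_le_exp.2 (add_weight_le 1 (C + C') w)
    rw [Real.exp_add] at h3
    have h4 : (2 : ℝ) ≤ Real.exp (1 : ℕ) := by
      have := Real.add_one_le_exp (1 : ℝ)
      push_cast
      linarith
    have h5 := mul_le_mul_of_nonneg_right h4 (Real.exp_pos (weight (C + C') w)).le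
    exact (abs_add_le _ _).trans (by linarith [h w, h' w])

lemma mul (hF : Tame F) (hG : Tame G) : Tame fun x w => F x w * G x w where
  cont := hF.cont.mul hG.cont
  bound x₀ := by
    obtain ⟨C, hC⟩ := hF.bound x₀
    obtain ⟨C', hC'⟩ := hG.bound x₀
    refine ⟨C + C', ?_⟩
    filter_upwards [hC, hC'] with x h h' w
    rw [abs_mul]
    refine (mul_le_mul (h w) (h' w) (abs_nonneg _) (Real.exp_pos _).le).trans ?_
    rw [← Real.exp_add]
    exact Real.exp_le_exp.2 (weight_add _ _ w)

lemma const (a : ℝ) : Tame fun (_ : X) (_ : Config n d) => a := (LinTame.const a).tame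

lemma const_mul (a : ℝ) (hF : Tame F) : Tame fun x w => a * F x w := (const a).mul hF

lemma sum {ι : Type*} (s : Finset ι) {F : ι → X → Config n d → ℝ} (h : ∀ i ∈ s, Tame (F i)) :
    Tame fun x w => ∑ i ∈ s, F i x w := by
  classical
  induction s using Finset.induction_on with
  | empty => simpa using const 0
  | insert a s ha ih =>
    simp only [Finset.sum_insert ha]
    exact (h a (by simp)).add (ih fun i hi => h i (by simp [hi]))

lemma pow (hF : Tame F) (k : ℕ) : Tame fun x w => F x w ^ k := by
  induction k with
  | zero => simpa using const 1
  | succ k ih =>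
    simp only [pow_succ]
    exact ih.mul hF

lemma slice (hF : Tame F) (x : X) : Tame fun (_ : Unit) w => F x w where
  cont := hF.cont.comp ((continuous_const (y := x)).prodMk continuous_snd)
  bound _ := by
    obtain ⟨C, hC⟩ := hF.bound x
    exact ⟨C, .of_forall fun _ => hC.self_of_nhds⟩

lemma comp_param {X' : Type*} [TopologicalSpace X'] {a : X' → X} (ha : Continuous a)
    (hF : Tame F) : Tame fun x w => F (a x) w where
  cont := hF.cont.comp ((ha.comp continuous_fst).prodMk continuous_snd)
  bound x₀ := by
    obtain ⟨C, hC⟩ := hF.bound (a x₀)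
    exact ⟨C, ha.continuousAt.eventually hC⟩

end Tame

namespace PosTame

variable {F G : X → Config n d → ℝ}

lemma ne_zero (hF : PosTame F) (x : X) (w : Config n d) : F x w ≠ 0 := (hF.pos x w).ne'

lemma cont (hF : PosTame F) : Continuous fun q : X × Config n d => F q.1 q.2 :=
  (Real.continuous_exp.comp hF.log.cont).congr fun _ => Real.exp_log (hF.pos _ _)

lemma of_bounds (hc : Continuous fun q : X × Config n d => F q.1 q.2)
    (h : ∀ x₀, ∃ C : ℕ, ∀ᶠ x in 𝓝 x₀, ∀ w,
      Real.exp (-weight C w) ≤ F x w ∧ F x w ≤ Real.exp (weight C w)) : PosTame F := by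
  have hpos : ∀ x w, 0 < F x w := fun x w => by
    obtain ⟨C, hC⟩ := h x
    exact (Real.exp_pos _).trans_le (hC.self_of_nhds w).1
  refine ⟨hpos, hc.log fun q => (hpos _ _).ne', fun x₀ => ?_⟩
  obtain ⟨C, hC⟩ := h x₀
  refine ⟨C, hC.mono fun x hx w => abs_le.2 ⟨?_, ?_⟩⟩
  · exact (Real.le_log_iff_exp_le (hpos x w)).2 (hx w).1
  · exact (Real.log_le_iff_le_exp (hpos x w)).2 (hx w).2

lemma bounds (hF : PosTame F) (x₀ : X) : ∃ C : ℕ, ∀ᶠ x in 𝓝 x₀, ∀ w,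
    Real.exp (-weight C w) ≤ F x w ∧ F x w ≤ Real.exp (weight C w) := by
  obtain ⟨C, hC⟩ := hF.log.bound x₀
  refine ⟨C, hC.mono fun x hx w => ⟨?_, ?_⟩⟩
  · exact (Real.le_log_iff_exp_le (hF.pos x w)).1 (abs_le.1 (hx w)).1
  · exact (Real.log_le_iff_le_exp (hF.pos x w)).1 (abs_le.1 (hx w)).2

lemma tame (hF : PosTame F) : Tame F where
  cont := hF.cont
  bound x₀ := by
    obtain ⟨C, hC⟩ := hF.bounds x₀
    refine ⟨C, hC.mono fun x hx w => ?_⟩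
    rw [abs_of_pos (hF.pos x w)]
    exact (hx w).2

lemma rpow (hF : PosTame F) (q : ℝ) : PosTame fun x w => F x w ^ q where
  pos x w := Real.rpow_pos_of_pos (hF.pos x w) q
  log := by
    simp only [Real.log_rpow (hF.pos _ _)]
    exact hF.log.const_mul q

lemma mul (hF : PosTame F) (hG : PosTame G) : PosTame fun x w => F x w * G x w where
  pos x w := mul_pos (hF.pos x w) (hG.pos x w)
  log := by
    simp only [Real.log_mul (hF.ne_zero _ _) (hG.ne_zero _ _)]
    exact hF.log.add hG.log

lemma inv (hF : PosTame F) : PosTame fun x w => (F x w)⁻¹ where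
  pos x w := inv_pos.2 (hF.pos x w)
  log := by
    simp only [Real.log_inv]
    simpa using hF.log.const_mul (-1)

lemma div (hF : PosTame F) (hG : PosTame G) : PosTame fun x w => F x w / G x w := by
  simpa only [div_eq_mul_inv] using hF.mul hG.inv

lemma add (hF : PosTame F) (hG : PosTame G) : PosTame fun x w => F x w + G x w := by
  refine of_bounds (hF.cont.add hG.cont) fun x₀ => ?_
  obtain ⟨C, hC⟩ := hF.bounds x₀
  obtain ⟨C', hC'⟩ := (hF.tame.add hG.tame).bound x₀
  refine ⟨C + C', ?_⟩
  filter_upwards [hC, hC'] with x h h' w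
  constructor
  · have h1 := Real.exp_le_exp.2 (neg_le_neg (weight_mono (Nat.le_add_right C C') w))
    linarith [(h w).1, hG.pos x w]
  · exact (le_abs_self _).trans
      ((h' w).trans (Real.exp_le_exp.2 (weight_mono (Nat.le_add_left C' C) w)))

lemma sum {ι : Type*} {s : Finset ι} (hs : s.Nonempty) {F : ι → X → Config n d → ℝ}
    (h : ∀ i ∈ s, PosTame (F i)) : PosTame fun x w => ∑ i ∈ s, F i x w := by
  classical
  induction hs using Finset.Nonempty.cons_induction with
  | singleton a => simpa using h a (by simp)
  | cons a s ha _ ih =>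
    simp only [Finset.sum_cons]
    exact (h a (by simp)).add (ih fun i hi => h i (by simp [hi]))

end PosTame

/-- `φ w y` replaces a part of the randomness `w` by a fresh sample `y` of law `μ`. -/
structure Resample {Y : Type*} [NormedAddCommGroup Y] [MeasurableSpace Y] (μ : Measure Y)
    (φ : Config n d → Y → Config n d) : Prop where
  moments : ExpMoments μ
  cont : Continuous fun q : Config n d × Y => φ q.1 q.2
  bound : ∀ (C : ℕ) w y, weight C (φ w y) ≤ weight C w + (2 * C) * ‖y‖

namespace Resample

variable {Y : Type*} [NormedAddCommGroup Y] [MeasurableSpace Y] [OpensMeasurableSpace Y]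
  {μ : Measure Y} {φ : Config n d → Y → Config n d} (hφ : Resample μ φ)

include hφ

omit [OpensMeasurableSpace Y] in
lemma continuous_right (w : Config n d) : Continuous (φ w) :=
  hφ.cont.comp (continuous_const.prodMk continuous_id)

omit [OpensMeasurableSpace Y] in
lemma exp_bound (C : ℕ) (w : Config n d) (y : Y) :
    Real.exp (weight C (φ w y)) ≤ Real.exp (weight C w) * Real.exp ((2 * C) * ‖y‖) := by
  rw [← Real.exp_add]
  exact Real.exp_le_exp.2 (hφ.bound C w y)

lemma integrable {F : X → Config n d → ℝ} (hF : Tame F) (x : X) (w : Config n d) :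
    Integrable (fun y => F x (φ w y)) μ := by
  obtain ⟨C, hC⟩ := hF.bound x
  refine ((hφ.moments (2 * C)).const_mul (Real.exp (weight C w))).mono' ?_
    (.of_forall fun y => (hC.self_of_nhds _).trans (hφ.exp_bound C w y))
  exact (hF.cont.comp (continuous_const.prodMk (hφ.continuous_right w))).aestronglyMeasurable

omit [TopologicalSpace X] [OpensMeasurableSpace Y] in
lemma abs_integral_le {F : X → Config n d → ℝ} (x : X) {C : ℕ}
    (hC : ∀ w, |F x w| ≤ Real.exp (weight C w)) (w : Config n d) :
    |∫ y, F x (φ w y) ∂μ| ≤ Real.exp (weight C w) * ∫ y, Real.exp ((2 * C) * ‖y‖) ∂μ := by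
  rw [← integral_const_mul, ← Real.norm_eq_abs]
  exact norm_integral_le_of_norm_le ((hφ.moments (2 * C)).const_mul _)
    (.of_forall fun y => (hC (φ w y)).trans (hφ.exp_bound C w y))

lemma tame [FirstCountableTopology X] {F : X → Config n d → ℝ} (hF : Tame F) :
    Tame fun x w => ∫ y, F x (φ w y) ∂μ where
  cont := by
    refine continuous_iff_continuousAt.2 fun q₀ => ?_
    obtain ⟨C, hC⟩ := hF.bound q₀.1
    -- The slack `1` pays for moving `w`: near `q₀` the weight exceeds its value at `q₀.2` by less
    -- than `1`.
    refine continuousAt_of_dominated (bound := fun y =>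
      Real.exp (weight C q₀.2 + 1) * Real.exp ((2 * C) * ‖y‖)) ?_ ?_
      ((hφ.moments (2 * C)).const_mul _) ?_
    · exact .of_forall fun q => (hφ.integrable hF q.1 q.2).aestronglyMeasurable
    · have h1 : ∀ᶠ q : X × Config n d in 𝓝 q₀, ∀ w, |F q.1 w| ≤ Real.exp (weight C w) :=
        continuous_fst.continuousAt.eventually hC
      have h2 : ∀ᶠ q : X × Config n d in 𝓝 q₀, weight C q.2 < weight C q₀.2 + 1 :=
        (((continuous_weight C).comp continuous_snd).tendsto q₀).eventually_lt_const
          (lt_add_one _)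
      filter_upwards [h1, h2] with q h1 h2
      refine .of_forall fun y => (h1 _).trans ((hφ.exp_bound C q.2 y).trans ?_)
      exact mul_le_mul_of_nonneg_right (Real.exp_le_exp.2 h2.le) (Real.exp_pos _).le
    · refine .of_forall fun y => Continuous.continuousAt ?_
      exact hF.cont.comp (continuous_fst.prodMk
        (hφ.cont.comp (continuous_snd.prodMk continuous_const)))
  bound x₀ := by
    obtain ⟨C, hC⟩ := hF.bound x₀
    obtain ⟨K, hK⟩ := exists_nat_gt (∫ y, Real.exp ((2 * C) * ‖y‖) ∂μ)
    refine ⟨K + C, hC.mono fun x hx w => (hφ.abs_integral_le x hx w).trans ?_⟩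
    refine le_trans ?_ (Real.exp_le_exp.2 (add_weight_le K C w))
    rw [Real.exp_add, mul_comm]
    exact mul_le_mul_of_nonneg_right (hK.le.trans (le_exp_self _)) (Real.exp_pos _).le

/-- The integrand is at least `exp (-weight C w) * exp (-2C‖y‖)`, and the integral of the second
factor is a positive constant that a larger weight absorbs. This lower bound permits dividing by
partition functions and taking their logarithms. -/
lemma posTame [IsProbabilityMeasure μ] [FirstCountableTopology X]
    {F : X → Config n d → ℝ} (hF : PosTame F) :
    PosTame fun x w => ∫ y, F x (φ w y) ∂μ := by
  refine .of_bounds (hφ.tame hF.tame).cont fun x₀ => ?_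
  obtain ⟨C, hC⟩ := hF.bounds x₀
  obtain ⟨C', hC'⟩ := (hφ.tame hF.tame).bound x₀
  have hI : 0 < ∫ y, Real.exp (-(2 * C) * ‖y‖) ∂μ :=
    integral_exp_pos (hφ.moments (-(2 * C)))
  obtain ⟨K, hK⟩ := exists_nat_gt (-Real.log (∫ y, Real.exp (-(2 * C) * ‖y‖) ∂μ))
  refine ⟨K + C + C', ?_⟩
  filter_upwards [hC, hC'] with x h h' w
  constructor
  · have h1 : Real.exp (-weight C w) * ∫ y, Real.exp (-(2 * C) * ‖y‖) ∂μ
        ≤ ∫ y, F x (φ w y) ∂μ := by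
      rw [← integral_const_mul]
      refine integral_mono ((hφ.moments _).const_mul _) (hφ.integrable hF.tame x w) fun y => ?_
      refine le_trans ?_ (h _).1
      simp only
      rw [← Real.exp_add]
      exact Real.exp_le_exp.2 (by linarith [hφ.bound C w y])
    refine le_trans ?_ h1
    rw [← Real.exp_log hI, ← Real.exp_add]
    refine Real.exp_le_exp.2 ?_
    linarith [add_weight_le K C w, weight_mono (Nat.le_add_right (K + C) C') w]
  · exact (le_abs_self _).trans
      ((h' w).trans (Real.exp_le_exp.2 (weight_mono (Nat.le_add_left C' _) w)))

end Resample

/-- A tame family with a tame derivative in its real parameter. -/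
structure DTame (F F' : ℝ → Config n d → ℝ) : Prop where
  tame : Tame F
  tame' : Tame F'
  deriv : ∀ τ w, HasDerivAt (fun τ => F τ w) (F' τ w) τ

namespace DTame

variable {F F' G G' : ℝ → Config n d → ℝ}

lemma congr' (hF : DTame F F') {H : ℝ → Config n d → ℝ} (h : ∀ τ w, F' τ w = H τ w) :
    DTame F H := by
  have : F' = H := funext fun τ => funext fun w => h τ w
  exact this ▸ hF

lemma const (a : ℝ) : DTame (fun _ (_ : Config n d) => a) (fun _ _ => 0) :=
  ⟨.const a, .const 0, fun _ _ => hasDerivAt_const _ _⟩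

lemma mul (hF : DTame F F') (hG : DTame G G') :
    DTame (fun τ w => F τ w * G τ w) (fun τ w => F' τ w * G τ w + F τ w * G' τ w) :=
  ⟨hF.tame.mul hG.tame, (hF.tame'.mul hG.tame).add (hF.tame.mul hG.tame'),
    fun τ w => (hF.deriv τ w).mul (hG.deriv τ w)⟩

lemma const_mul (a : ℝ) (hF : DTame F F') :
    DTame (fun τ w => a * F τ w) (fun τ w => a * F' τ w) :=
  ((const a).mul hF).congr' fun _ _ => by ring

lemma sum {ι : Type*} (s : Finset ι) {F F' : ι → ℝ → Config n d → ℝ}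
    (h : ∀ i ∈ s, DTame (F i) (F' i)) :
    DTame (fun τ w => ∑ i ∈ s, F i τ w) (fun τ w => ∑ i ∈ s, F' i τ w) :=
  ⟨.sum s fun i hi => (h i hi).tame, .sum s fun i hi => (h i hi).tame',
    fun τ w => HasDerivAt.fun_sum fun i hi => (h i hi).deriv τ w⟩

/-- Derivatives of powers, with the derivative `F * L` of `F` given through the logarithmic
derivative `L`. -/
lemma rpow (hF : PosTame F) {L : ℝ → Config n d → ℝ} (hL : Tame L)
    (h : DTame F fun τ w => F τ w * L τ w) (q : ℝ) :
    DTame (fun τ w => F τ w ^ q) (fun τ w => F τ w ^ q * (q * L τ w)) := by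
  refine ⟨(hF.rpow q).tame, (hF.rpow q).tame.mul (hL.const_mul q), fun τ w => ?_⟩
  refine ((h.deriv τ w).rpow_const (p := q) (Or.inl (hF.ne_zero τ w))).congr_deriv ?_
  rw [Real.rpow_sub_one (hF.ne_zero τ w)]
  field_simp [hF.ne_zero τ w]

/-- The growth bound on the derivative is locally uniform in the parameter, which is the domination
needed to differentiate under the integral. -/
lemma integral {Y : Type*} [NormedAddCommGroup Y] [MeasurableSpace Y] [OpensMeasurableSpace Y]
    {μ : Measure Y} {φ : Config n d → Y → Config n d}
    (hφ : Resample μ φ) (hF : DTame F F') :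
    DTame (fun τ w => ∫ y, F τ (φ w y) ∂μ) (fun τ w => ∫ y, F' τ (φ w y) ∂μ) := by
  refine ⟨hφ.tame hF.tame, hφ.tame hF.tame', fun τ w => ?_⟩
  obtain ⟨C, hC⟩ := hF.tame'.bound τ
  refine (hasDerivAt_integral_of_dominated_loc_of_deriv_le (F := fun τ y => F τ (φ w y))
    (F' := fun τ y => F' τ (φ w y)) (bound := fun y =>
      Real.exp (weight C w) * Real.exp ((2 * C) * ‖y‖)) hC ?_
    (hφ.integrable hF.tame τ w) (hφ.integrable hF.tame' τ w).aestronglyMeasurable ?_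
    ((hφ.moments (2 * C)).const_mul _) ?_).2
  · exact .of_forall fun τ => (hφ.integrable hF.tame τ w).aestronglyMeasurable
  · exact .of_forall fun y τ hτ => (hτ _).trans (hφ.exp_bound C w y)
  · exact .of_forall fun y τ _ => hF.deriv τ _

end DTame

lemma weight_update_le (C k : ℕ) (w : Config n d) (u : NoiseU n d) :
    weight C ((w.1, Function.update w.2 k u) : Config n d) ≤ weight C w + C * ‖u‖ := by
  have h : ∑ j ∈ Finset.range C, ‖Function.update w.2 k u j‖
      ≤ ∑ j ∈ Finset.range C, ‖w.2 j‖ + ‖u‖ := by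
    calc ∑ j ∈ Finset.range C, ‖Function.update w.2 k u j‖
        ≤ ∑ j ∈ Finset.range C, (‖w.2 j‖ + if j = k then ‖u‖ else 0) := by
          refine Finset.sum_le_sum fun j _ => ?_
          by_cases hj : j = k
          · subst hj
            simp
          · simp [hj]
      _ ≤ _ := by
          rw [Finset.sum_add_distrib, Finset.sum_ite_eq']
          split_ifs <;> simp
  have h2 := mul_le_mul_of_nonneg_left h (Nat.cast_nonneg (α := ℝ) C)
  simp only [weight]
  linarith

lemma resample_expU (k : ℕ) : Resample (gaussU n d)
    (fun (w : Config n d) u => (w.1, Function.update w.2 k u)) where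
  moments := expMoments_gaussU
  cont := by fun_prop
  bound C w u := by
    have h2 : (0 : ℝ) ≤ C * ‖u‖ := by positivity
    linarith [weight_update_le C k w u]

/-- Both `G` and `𝒰_{r+1}` are replaced, each at a cost of at most `C * ‖z‖`; hence the factor `2`
in `Resample.bound`. The other components become zero, so `w` is needed only for the constant part
of its weight. -/
lemma resample_expTop (r : ℕ) : Resample ((gaussG n d).prod (gaussU n d))
    (fun (_ : Config n d) z => ((z.1, Function.update 0 (r + 1) z.2) : Config n d)) where
  moments := expMoments_gaussG.prod expMoments_gaussU
  cont := by fun_prop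
  bound C w z := by
    have h0 := weight_update_le C (r + 1) ((z.1, 0) : Config n d) z.2
    have h1 : weight C ((z.1, 0) : Config n d) = C * (1 + ‖z.1‖) := by
      simp [weight]
    have h2 := mul_le_mul_of_nonneg_left (norm_fst_le z) (Nat.cast_nonneg (α := ℝ) C)
    have h3 := mul_le_mul_of_nonneg_left (norm_snd_le z) (Nat.cast_nonneg (α := ℝ) C)
    have h4 := le_weight_one_add C w
    rw [h1] at h0
    simp only at h0
    linarith

end Tame

/-! ### Nested averages of a direction, and the curvature they produce. -/

section Averages

variable {n d l : ℕ} (θ : Params) (D : Energy n d l)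

/-- The `γ₀`-average of `h` for fixed `i₃`. -/
def mean0 (h : Energy n d l) (i₃ : Fin l) (w : Config n d) : ℝ :=
  ∑ i₁, ∑ i₂, h w i₁ i₂ i₃ * gamma0 θ D i₁ i₂ i₃ w

/-- The logarithmic second derivative of `Z_{i₃}` in the direction `e`, up to a factor. -/
def quad0 (e : Fin l → Fin l → ℝ) (i₃ : Fin l) (w : Config n d) : ℝ :=
  ∑ i₁, ((∑ i₂, e i₁ i₂ ^ 2 * gamma0 θ D i₁ i₂ i₃ w)
    + (θ.s - 1) * (Cfun θ D w i₁ i₃ ^ θ.s / Zfun θ D i₃ w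
      * (∑ i₂, e i₁ i₂ * (Afun θ D w i₁ i₂ i₃ / Cfun θ D w i₁ i₃)) ^ 2))

/-- The average of `h` after the first level. -/
def mean1 (h : Energy n d l) (w : Config n d) : ℝ :=
  ∑ i₃, gamma00 θ D i₃ w * Phi1 θ D i₃ (mean0 θ D h i₃) w

/-- A direction that depends on `i₁, i₂` only, as an energy. -/
def constEnergy (e : Fin l → Fin l → ℝ) : Energy n d l := fun _ i₁ i₂ _ => e i₁ i₂

/-- The average of the direction `e` after `j + 1` levels. -/
def meanLevel (e : Fin l → Fin l → ℝ) (j : ℕ) : Config n d → ℝ :=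
  iterPhi θ D 1 j (mean1 θ D (constEnergy e))

/-- The curvature in the direction `e` after `j + 1` levels. -/
def curv (e : Fin l → Fin l → ℝ) : ℕ → Config n d → ℝ
  | 0 => fun w => (∑ i₃, gamma00 θ D i₃ w * Phi1 θ D i₃ (quad0 θ D e i₃) w)
      - (1 - θ.p) * θ.s * (∑ i₃, gamma00 θ D i₃ w
          * Phi1 θ D i₃ (mean0 θ D (constEnergy e) i₃) w ^ 2)
      - θ.p * θ.s * (θ.m 1 - θ.m 2) * meanLevel θ D e 0 w ^ 2
  | j + 1 => fun w => Phi θ D (j + 2) (curv e j) w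
      - θ.p * θ.s * (θ.m (j + 2) - θ.m (j + 3)) * meanLevel θ D e (j + 1) w ^ 2

/-- `w` with a fresh value of `𝒰ₖ`. -/
abbrev setU (k : ℕ) (w : Config n d) (u : NoiseU n d) : Config n d :=
  (w.1, Function.update w.2 k u)

lemma expU_setU (k : ℕ) (F : Config n d → ℝ) (w : Config n d) (u : NoiseU n d) :
    expU k F (setU k w u) = expU k F w := by
  simp [expU]

lemma EZ_setU (i₃ : Fin l) (w : Config n d) (u : NoiseU n d) :
    EZ θ D i₃ (setU 1 w u) = EZ θ D i₃ w := expU_setU 1 _ w u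

lemma zeta_setU (k : ℕ) (w : Config n d) (u : NoiseU n d) :
    zeta θ D (k + 2) (setU (k + 2) w u) = zeta θ D (k + 2) w := expU_setU (k + 2) _ w u

lemma expU_div (k : ℕ) (F G : Config n d → ℝ) (hG : ∀ w u, G (setU k w u) = G w)
    (w : Config n d) : expU k (fun w => F w / G w) w = expU k F w / G w := by
  unfold expU
  rw [← integral_div]
  exact integral_congr_ae (.of_forall fun u => by simp only [hG w u])

/-- The normaliser no longer depends on the integrated variable and leaves the integral. In this
form products such as `Z * mean` can be differentiated without differentiating a quotient. -/
lemma Phi1_eq (i₃ : Fin l) (F : Config n d → ℝ) (w : Config n d) :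
    Phi1 θ D i₃ F w = expU 1 (fun w => Zfun θ D i₃ w ^ θ.m 1 * F w) w / EZ θ D i₃ w := by
  rw [← expU_div 1 _ _ (EZ_setU θ D i₃)]
  unfold Phi1
  simp only [div_mul_eq_mul_div]

lemma Phi_eq (k : ℕ) (F : Config n d → ℝ) (w : Config n d) :
    Phi θ D (k + 2) F w = expU (k + 2)
      (fun w => zeta θ D (k + 1) w ^ (θ.m (k + 2) / θ.m (k + 1)) * F w) w
        / zeta θ D (k + 2) w := by
  rw [← expU_div (k + 2) _ _ (zeta_setU θ D k)]
  unfold Phi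
  simp only [div_mul_eq_mul_div, show k + 2 - 1 = k + 1 from rfl]

end Averages

/-! ### All functionals of a tame energy are tame, jointly in a parameter. -/

section Tameness

variable {n d l : ℕ} (θ : Params) {X : Type*} [TopologicalSpace X]

/-- All components of a family of energies have linear growth. -/
def EnergyTame (D : X → Energy n d l) : Prop :=
  ∀ i₁ i₂ i₃, LinTame fun x w => D x w i₁ i₂ i₃

lemma EnergyTame.slice {D : X → Energy n d l} (hD : EnergyTame D) (x : X) :
    EnergyTame fun _ : Unit => D x := fun i₁ i₂ i₃ =>
  (hD i₁ i₂ i₃).comp_param (a := fun _ : Unit => x) continuous_const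

lemma energyTame_const (e : Fin l → Fin l → ℝ) :
    EnergyTame fun _ : X => (constEnergy e : Energy n d l) :=
  fun i₁ i₂ _ => LinTame.const (e i₁ i₂)

lemma tame_expU [FirstCountableTopology X] {F : X → Config n d → ℝ} (hF : Tame F) (k : ℕ) :
    Tame fun x w => expU k (F x) w := (resample_expU k).tame hF

lemma posTame_expU [FirstCountableTopology X] {F : X → Config n d → ℝ} (hF : PosTame F) (k : ℕ) :
    PosTame fun x w => expU k (F x) w := (resample_expU k).posTame hF

lemma tame_expTop [FirstCountableTopology X] {F : X → Config n d → ℝ} (hF : Tame F) (r : ℕ) :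
    Tame fun x (_ : Config n d) => expTop r (F x) := (resample_expTop r).tame hF

variable {D : X → Energy n d l} (hD : EnergyTame D)
include hD

lemma posTame_Afun (i₁ i₂ i₃ : Fin l) : PosTame fun x w => Afun θ (D x) w i₁ i₂ i₃ :=
  ((hD i₁ i₂ i₃).const_mul θ.β).exp

lemma posTame_Cfun (i₁ i₃ : Fin l) : PosTame fun x w => Cfun θ (D x) w i₁ i₃ :=
  .sum ⟨i₁, Finset.mem_univ _⟩ fun i₂ _ => posTame_Afun θ hD i₁ i₂ i₃

lemma posTame_Zfun (i₃ : Fin l) : PosTame fun x w => Zfun θ (D x) i₃ w :=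
  .sum ⟨i₃, Finset.mem_univ _⟩ fun i₁ _ => (posTame_Cfun θ hD i₁ i₃).rpow θ.s

lemma posTame_gamma0 (i₁ i₂ i₃ : Fin l) : PosTame fun x w => gamma0 θ (D x) i₁ i₂ i₃ w :=
  (((posTame_Cfun θ hD i₁ i₃).rpow θ.s).div (posTame_Zfun θ hD i₃)).mul
    ((posTame_Afun θ hD i₁ i₂ i₃).div (posTame_Cfun θ hD i₁ i₃))

lemma tame_mean0 {h : X → Energy n d l} (hh : EnergyTame h) (i₃ : Fin l) :
    Tame fun x w => mean0 θ (D x) (h x) i₃ w :=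
  .sum _ fun i₁ _ => .sum _ fun i₂ _ => (hh i₁ i₂ i₃).tame.mul (posTame_gamma0 θ hD i₁ i₂ i₃).tame

lemma tame_quad0 (e : Fin l → Fin l → ℝ) (i₃ : Fin l) : Tame fun x w => quad0 θ (D x) e i₃ w :=
  .sum _ fun i₁ _ => .add
    (.sum _ fun i₂ _ => (posTame_gamma0 θ hD i₁ i₂ i₃).tame.const_mul _)
    (.const_mul _ (.mul (((posTame_Cfun θ hD i₁ i₃).rpow θ.s).div (posTame_Zfun θ hD i₃)).tame
      (.pow (.sum _ fun i₂ _ =>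
        ((posTame_Afun θ hD i₁ i₂ i₃).div (posTame_Cfun θ hD i₁ i₃)).tame.const_mul _) 2)))

variable [FirstCountableTopology X]

lemma posTame_EZ (i₃ : Fin l) : PosTame fun x w => EZ θ (D x) i₃ w :=
  posTame_expU ((posTame_Zfun θ hD i₃).rpow (θ.m 1)) 1

lemma posTame_gamma00 (i₃ : Fin l) : PosTame fun x w => gamma00 θ (D x) i₃ w :=
  ((posTame_EZ θ hD i₃).rpow θ.p).div
    (.sum ⟨i₃, Finset.mem_univ _⟩ fun i _ => (posTame_EZ θ hD i).rpow θ.p)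

lemma tame_Phi1 (i₃ : Fin l) {F : X → Config n d → ℝ} (hF : Tame F) :
    Tame fun x w => Phi1 θ (D x) i₃ (F x) w :=
  tame_expU ((((posTame_Zfun θ hD i₃).rpow (θ.m 1)).div (posTame_EZ θ hD i₃)).tame.mul hF) 1

lemma tame_mean1 {h : X → Energy n d l} (hh : EnergyTame h) :
    Tame fun x w => mean1 θ (D x) (h x) w :=
  .sum _ fun i₃ _ => (posTame_gamma00 θ hD i₃).tame.mul
    (tame_Phi1 θ hD i₃ (tame_mean0 θ hD hh i₃))

variable [Nonempty (Fin l)]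

lemma posTame_zeta (k : ℕ) : PosTame fun x w => zeta θ (D x) (k + 1) w := by
  induction k with
  | zero => exact .sum Finset.univ_nonempty fun i₃ _ => (posTame_EZ θ hD i₃).rpow θ.p
  | succ k ih => exact posTame_expU (ih.rpow _) (k + 2)

lemma tame_Phi (k : ℕ) {F : X → Config n d → ℝ} (hF : Tame F) :
    Tame fun x w => Phi θ (D x) (k + 2) (F x) w :=
  tame_expU ((((posTame_zeta θ hD k).rpow _).div (posTame_zeta θ hD (k + 1))).tame.mul hF) (k + 2)

/-- The starting index is `a + 1` so that only `Phi` of level at least `2` occurs; level `1` would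
involve the placeholder `zeta 0`. -/
lemma tame_iterPhi (a j : ℕ) {F : X → Config n d → ℝ} (hF : Tame F) :
    Tame fun x w => iterPhi θ (D x) (a + 1) j (F x) w := by
  induction j with
  | zero => exact hF
  | succ j ih =>
    have := tame_Phi θ hD (a + j) ih
    simpa only [iterPhi, show a + 1 + j + 1 = a + j + 2 by ring] using this

lemma tame_meanLevel (e : Fin l → Fin l → ℝ) (j : ℕ) :
    Tame fun x w => meanLevel θ (D x) e j w :=
  tame_iterPhi θ hD 0 j (tame_mean1 θ hD (energyTame_const e))

lemma tame_curv (e : Fin l → Fin l → ℝ) (j : ℕ) : Tame fun x w => curv θ (D x) e j w := by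
  have hsub : ∀ {F G : X → Config n d → ℝ}, Tame F → Tame G → Tame fun x w => F x w - G x w := by
    intro F G hF hG
    simpa only [sub_eq_add_neg, neg_one_mul] using hF.add (hG.const_mul (-1))
  induction j with
  | zero =>
    exact hsub (hsub
      (.sum _ fun i₃ _ => (posTame_gamma00 θ hD i₃).tame.mul
        (tame_Phi1 θ hD i₃ (tame_quad0 θ hD e i₃)))
      (.const_mul _ (.sum _ fun i₃ _ => (posTame_gamma00 θ hD i₃).tame.mul
        (.pow (tame_Phi1 θ hD i₃ (tame_mean0 θ hD (energyTame_const e) i₃)) 2))))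
      (.const_mul _ (.pow (tame_meanLevel θ hD e 0) 2))
  | succ j ih =>
    exact hsub (tame_Phi θ hD j ih) (.const_mul _ (.pow (tame_meanLevel θ hD e (j + 1)) 2))

end Tameness

/-! ### Linearity, positivity and normalisation of the operators `Φ`. -/

section Linearity

variable {n d l : ℕ} (θ : Params) {D : Energy n d l}

lemma expU_sum (k : ℕ) {ι : Type*} (s : Finset ι) {F : ι → Config n d → ℝ}
    (hF : ∀ i ∈ s, Tame fun _ : Unit => F i) (w : Config n d) :
    expU k (fun w => ∑ i ∈ s, F i w) w = ∑ i ∈ s, expU k (F i) w :=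
  integral_finsetSum s fun i hi => (resample_expU k).integrable (hF i hi) () w

lemma expTop_sum (r : ℕ) {ι : Type*} (s : Finset ι) {F : ι → Config n d → ℝ}
    (hF : ∀ i ∈ s, Tame fun _ : Unit => F i) :
    expTop r (fun w => ∑ i ∈ s, F i w) = ∑ i ∈ s, expTop r (F i) :=
  integral_finsetSum s fun i hi => (resample_expTop r).integrable (hF i hi) () 0

lemma expTop_const_mul (r : ℕ) (a : ℝ) (F : Config n d → ℝ) :
    expTop r (fun w => a * F w) = a * expTop r F := integral_const_mul _ _

lemma expTop_const (r : ℕ) (a : ℝ) : expTop r (fun _ : Config n d => a) = a := by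
  simp [expTop]

variable (hD : EnergyTame fun _ : Unit => D)

lemma Phi1_const_mul (i₃ : Fin l) (a : ℝ) (F : Config n d → ℝ) :
    Phi1 θ D i₃ (fun w => a * F w) = fun w => a * Phi1 θ D i₃ F w := by
  ext w
  simp only [Phi1, expU, ← integral_const_mul]
  congr 1 with u
  ring

lemma Phi_mul_of_invariant (k : ℕ) {g : Config n d → ℝ} (hg : ∀ w u, g (setU k w u) = g w)
    (F : Config n d → ℝ) : Phi θ D k (fun w => g w * F w) = fun w => g w * Phi θ D k F w := by
  ext w
  simp only [Phi, expU, ← integral_const_mul]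
  congr 1 with u
  have := hg w u
  simp only [setU] at this
  rw [this]
  ring

lemma Phi1_mul_of_invariant (i₃ : Fin l) {g : Config n d → ℝ} (hg : ∀ w u, g (setU 1 w u) = g w)
    (F : Config n d → ℝ) :
    Phi1 θ D i₃ (fun w => g w * F w) = fun w => g w * Phi1 θ D i₃ F w := by
  ext w
  simp only [Phi1, expU, ← integral_const_mul]
  congr 1 with u
  have := hg w u
  simp only [setU] at this
  rw [this]
  ring

/-- This lets a Gaussian coordinate of an outer level be pulled through all inner averages until its
own level is reached. -/
lemma iterPhi_mul_of_invariant (a j : ℕ) {g : Config n d → ℝ}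
    (hg : ∀ k, a < k → k ≤ a + j → ∀ w u, g (setU k w u) = g w) (F : Config n d → ℝ) :
    iterPhi θ D a j (fun w => g w * F w) = fun w => g w * iterPhi θ D a j F w := by
  induction j with
  | zero => rfl
  | succ j ih =>
    simp only [iterPhi]
    rw [ih fun k hk hk' => hg k hk (by omega)]
    exact Phi_mul_of_invariant θ _ (hg _ (by omega) (by omega)) _

lemma iterPhi_const_mul (a j : ℕ) (c : ℝ) (F : Config n d → ℝ) :
    iterPhi θ D a j (fun w => c * F w) = fun w => c * iterPhi θ D a j F w :=
  iterPhi_mul_of_invariant θ a j (fun _ _ _ _ _ => rfl) F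

lemma Phi1_nonneg (hD : EnergyTame fun _ : Unit => D) (i₃ : Fin l) {F : Config n d → ℝ}
    (hF : ∀ w, 0 ≤ F w) (w : Config n d) : 0 ≤ Phi1 θ D i₃ F w :=
  integral_nonneg fun _ => mul_nonneg (div_nonneg
    (((posTame_Zfun θ hD i₃).rpow _).pos () _).le ((posTame_EZ θ hD i₃).pos () _).le) (hF _)

include hD

lemma Phi1_sum (i₃ : Fin l) {ι : Type*} (s : Finset ι) {F : ι → Config n d → ℝ}
    (hF : ∀ i ∈ s, Tame fun _ : Unit => F i) :
    Phi1 θ D i₃ (fun w => ∑ i ∈ s, F i w) = fun w => ∑ i ∈ s, Phi1 θ D i₃ (F i) w := by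
  ext w
  unfold Phi1
  rw [← expU_sum 1 s fun i hi =>
    (((posTame_Zfun θ hD i₃).rpow (θ.m 1)).div (posTame_EZ θ hD i₃)).tame.mul (hF i hi)]
  simp only [Finset.mul_sum]

lemma Phi1_one (i₃ : Fin l) : Phi1 θ D i₃ (fun _ => 1) = fun _ => 1 := by
  ext w
  rw [Phi1_eq]
  simp only [mul_one]
  exact div_self ((posTame_EZ θ hD i₃).ne_zero () w)

variable [Nonempty (Fin l)]

lemma Phi_nonneg (k : ℕ) {F : Config n d → ℝ} (hF : ∀ w, 0 ≤ F w) (w : Config n d) :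
    0 ≤ Phi θ D (k + 2) F w :=
  integral_nonneg fun _ => mul_nonneg (div_nonneg
    (((posTame_zeta θ hD k).rpow _).pos () _).le ((posTame_zeta θ hD (k + 1)).pos () _).le) (hF _)

lemma iterPhi_nonneg (a j : ℕ) {F : Config n d → ℝ} (hF : ∀ w, 0 ≤ F w) (w : Config n d) :
    0 ≤ iterPhi θ D (a + 1) j F w := by
  induction j generalizing w with
  | zero => exact hF w
  | succ j ih =>
    have := Phi_nonneg θ hD (a + j) ih w
    simpa only [iterPhi, show a + 1 + j + 1 = a + j + 2 by ring] using this

lemma Phi_sum (k : ℕ) {ι : Type*} (s : Finset ι) {F : ι → Config n d → ℝ}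
    (hF : ∀ i ∈ s, Tame fun _ : Unit => F i) :
    Phi θ D (k + 2) (fun w => ∑ i ∈ s, F i w) = fun w => ∑ i ∈ s, Phi θ D (k + 2) (F i) w := by
  ext w
  have := expU_sum (k + 2) s (F := fun i w =>
    zeta θ D (k + 1) w ^ (θ.m (k + 2) / θ.m (k + 1)) / zeta θ D (k + 2) w * F i w) (fun i hi =>
    (((posTame_zeta θ hD k).rpow (θ.m (k + 2) / θ.m (k + 1))).div
      (posTame_zeta θ hD (k + 1))).tame.mul (hF i hi)) w
  simp only [← Finset.mul_sum] at this
  exact this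

lemma Phi_one (k : ℕ) : Phi θ D (k + 2) (fun _ => 1) = fun _ => 1 := by
  ext w
  rw [Phi_eq]
  simp only [mul_one]
  exact div_self ((posTame_zeta θ hD (k + 1)).ne_zero () w)

lemma iterPhi_one (a j : ℕ) : iterPhi θ D (a + 1) j (fun _ => 1) = fun _ => 1 := by
  induction j with
  | zero => rfl
  | succ j ih =>
    simp only [iterPhi]
    rw [ih, show a + 1 + j + 1 = a + j + 2 by ring, Phi_one θ hD]

lemma iterPhi_sum (a j : ℕ) {ι : Type*} (s : Finset ι) {F : ι → Config n d → ℝ}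
    (hF : ∀ i ∈ s, Tame fun _ : Unit => F i) :
    iterPhi θ D (a + 1) j (fun w => ∑ i ∈ s, F i w)
      = fun w => ∑ i ∈ s, iterPhi θ D (a + 1) j (F i) w := by
  induction j with
  | zero => rfl
  | succ j ih =>
    simp only [iterPhi]
    rw [ih, show a + 1 + j + 1 = a + j + 2 by ring,
      Phi_sum θ hD (a + j) s (F := fun i => iterPhi θ D (a + 1) j (F i))
        fun i hi => tame_iterPhi θ hD a j (hF i hi)]

end Linearity

/-! ### First derivatives of the partition functions. -/

section Derivatives

variable {n d l : ℕ} (θ : Params)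

/-- A differentiable family of energies, with its derivative. -/
structure EnergyDeriv (D D' : ℝ → Energy n d l) : Prop where
  tame : EnergyTame D
  tame' : EnergyTame D'
  deriv : ∀ τ w i₁ i₂ i₃, HasDerivAt (fun τ => D τ w i₁ i₂ i₃) (D' τ w i₁ i₂ i₃) τ

lemma DTame.expU {F F' : ℝ → Config n d → ℝ} (hF : DTame F F') (k : ℕ) :
    DTame (fun τ w => expU k (F τ) w) (fun τ w => expU k (F' τ) w) :=
  hF.integral (resample_expU k)

variable {D D' : ℝ → Energy n d l} (hD : EnergyDeriv D D')
include hD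

/-- The average of `h` over `i₂`. -/
lemma tame_meanC (i₁ i₃ : Fin l) :
    Tame fun τ w => ∑ i₂, D' τ w i₁ i₂ i₃ * (Afun θ (D τ) w i₁ i₂ i₃ / Cfun θ (D τ) w i₁ i₃) :=
  .sum _ fun i₂ _ => (hD.tame' i₁ i₂ i₃).tame.mul
    ((posTame_Afun θ hD.tame i₁ i₂ i₃).div (posTame_Cfun θ hD.tame i₁ i₃)).tame

/-- Derivatives are kept in the form `F * L`: a power multiplies the logarithmic derivative `L` by
its exponent, and a sum or expectation replaces `L` by the average with normalised weights. -/
lemma dTame_Afun (i₁ i₂ i₃ : Fin l) :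
    DTame (fun τ w => Afun θ (D τ) w i₁ i₂ i₃)
      (fun τ w => Afun θ (D τ) w i₁ i₂ i₃ * (θ.β * D' τ w i₁ i₂ i₃)) where
  tame := (posTame_Afun θ hD.tame i₁ i₂ i₃).tame
  tame' := (posTame_Afun θ hD.tame i₁ i₂ i₃).tame.mul ((hD.tame' i₁ i₂ i₃).tame.const_mul _)
  deriv τ w := ((hD.deriv τ w i₁ i₂ i₃).const_mul θ.β).exp

lemma dTame_Cfun (i₁ i₃ : Fin l) :
    DTame (fun τ w => Cfun θ (D τ) w i₁ i₃)
      (fun τ w => Cfun θ (D τ) w i₁ i₃ * (θ.β * ∑ i₂, D' τ w i₁ i₂ i₃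
        * (Afun θ (D τ) w i₁ i₂ i₃ / Cfun θ (D τ) w i₁ i₃))) := by
  refine (DTame.sum Finset.univ fun i₂ _ => dTame_Afun θ hD i₁ i₂ i₃).congr' fun τ w => ?_
  have := (posTame_Cfun θ hD.tame i₁ i₃).ne_zero τ w
  simp only [Finset.mul_sum]
  exact Finset.sum_congr rfl fun i₂ _ => by field_simp

lemma dTame_Cfun_rpow (i₁ i₃ : Fin l) (q : ℝ) :
    DTame (fun τ w => Cfun θ (D τ) w i₁ i₃ ^ q)
      (fun τ w => Cfun θ (D τ) w i₁ i₃ ^ q * (q * (θ.β * ∑ i₂, D' τ w i₁ i₂ i₃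
        * (Afun θ (D τ) w i₁ i₂ i₃ / Cfun θ (D τ) w i₁ i₃)))) :=
  DTame.rpow (posTame_Cfun θ hD.tame i₁ i₃) ((tame_meanC θ hD i₁ i₃).const_mul _)
    (dTame_Cfun θ hD i₁ i₃) q

lemma dTame_Zfun (i₃ : Fin l) :
    DTame (fun τ w => Zfun θ (D τ) i₃ w)
      (fun τ w => Zfun θ (D τ) i₃ w * (θ.s * θ.β * mean0 θ (D τ) (D' τ) i₃ w)) := by
  refine (DTame.sum Finset.univ fun i₁ _ => dTame_Cfun_rpow θ hD i₁ i₃ θ.s).congr' fun τ w => ?_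
  have := (posTame_Zfun θ hD.tame i₃).ne_zero τ w
  simp only [mean0, gamma0, Finset.mul_sum]
  exact Finset.sum_congr rfl fun i₁ _ => Finset.sum_congr rfl fun i₂ _ => by field_simp

lemma dTame_EZ (i₃ : Fin l) :
    DTame (fun τ w => EZ θ (D τ) i₃ w)
      (fun τ w => EZ θ (D τ) i₃ w
        * (θ.m 1 * θ.s * θ.β * Phi1 θ (D τ) i₃ (mean0 θ (D τ) (D' τ) i₃) w)) := by
  refine ((DTame.rpow (posTame_Zfun θ hD.tame i₃)
    ((tame_mean0 θ hD.tame hD.tame' i₃).const_mul _) (dTame_Zfun θ hD i₃) (θ.m 1)).expU 1).congr'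
      fun τ w => ?_
  have := (posTame_EZ θ hD.tame i₃).ne_zero τ w
  rw [Phi1_eq]
  have h : expU 1 (fun w => Zfun θ (D τ) i₃ w ^ θ.m 1
      * (θ.m 1 * (θ.s * θ.β * mean0 θ (D τ) (D' τ) i₃ w))) w
      = θ.m 1 * θ.s * θ.β
        * expU 1 (fun w => Zfun θ (D τ) i₃ w ^ θ.m 1 * mean0 θ (D τ) (D' τ) i₃ w) w := by
    simp only [expU, ← integral_const_mul]
    congr 1 with u
    ring
  rw [h]
  field_simp

variable [Nonempty (Fin l)]

lemma dTame_zeta_one :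
    DTame (fun τ w => zeta θ (D τ) 1 w)
      (fun τ w => zeta θ (D τ) 1 w
        * (θ.p * θ.s * θ.β * θ.m 1 * mean1 θ (D τ) (D' τ) w)) := by
  refine (DTame.sum Finset.univ fun i₃ _ => DTame.rpow (posTame_EZ θ hD.tame i₃)
    ((tame_Phi1 θ hD.tame i₃ (tame_mean0 θ hD.tame hD.tame' i₃)).const_mul _)
    (dTame_EZ θ hD i₃) θ.p).congr' fun τ w => ?_
  have := (posTame_zeta θ hD.tame 0).ne_zero τ w
  simp only [zeta] at this
  simp only [zeta, mean1, gamma00]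
  generalize ∑ i₃, EZ θ (D τ) i₃ w ^ θ.p = S at *
  simp only [Finset.mul_sum]
  exact Finset.sum_congr rfl fun i₃ _ => by field_simp

/-- The exponent `m (j + 2) / m (j + 1)` replaces the factor `m (j + 1)` by `m (j + 2)`, so the
exponents telescope; this is why the lower entries of `m` must not vanish. -/
lemma dTame_zeta (j : ℕ) (hm : ∀ k ∈ Finset.Icc 1 j, θ.m k ≠ 0) :
    DTame (fun τ w => zeta θ (D τ) (j + 1) w)
      (fun τ w => zeta θ (D τ) (j + 1) w
        * (θ.p * θ.s * θ.β * θ.m (j + 1) * iterPhi θ (D τ) 1 j (mean1 θ (D τ) (D' τ)) w)) := by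
  induction j with
  | zero => exact dTame_zeta_one θ hD
  | succ j ih =>
    have ih := ih fun k hk => hm k (Finset.Icc_subset_Icc_right (by omega) hk)
    have hmj : θ.m (j + 1) ≠ 0 := hm (j + 1) (by simp)
    refine ((DTame.rpow (posTame_zeta θ hD.tame j)
      ((tame_iterPhi θ hD.tame 0 j (tame_mean1 θ hD.tame hD.tame')).const_mul _) ih
        (θ.m (j + 2) / θ.m (j + 1))).expU (j + 2)).congr' fun τ w => ?_
    have := (posTame_zeta θ hD.tame (j + 1)).ne_zero τ w
    have hP := Phi_eq θ (D τ) j (iterPhi θ (D τ) 1 j (mean1 θ (D τ) (D' τ))) w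
    simp only [iterPhi, show 1 + j + 1 = j + 2 by ring]
    rw [hP]
    have h : expU (j + 2) (fun w => zeta θ (D τ) (j + 1) w ^ (θ.m (j + 2) / θ.m (j + 1))
        * (θ.m (j + 2) / θ.m (j + 1) * (θ.p * θ.s * θ.β * θ.m (j + 1)
          * iterPhi θ (D τ) 1 j (mean1 θ (D τ) (D' τ)) w))) w
        = θ.p * θ.s * θ.β * θ.m (j + 2)
          * expU (j + 2) (fun w => zeta θ (D τ) (j + 1) w ^ (θ.m (j + 2) / θ.m (j + 1))
            * iterPhi θ (D τ) 1 j (mean1 θ (D τ) (D' τ)) w) w := by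
      simp only [expU, ← integral_const_mul]
      congr 1 with u
      field_simp
    simp only [zero_add] at h ⊢
    rw [h]
    field_simp

end Derivatives

/-! ### Second derivatives: how each level changes the curvature. -/

section SecondDerivatives

variable {n d l : ℕ} (θ : Params) {D : ℝ → Energy n d l} {e : Fin l → Fin l → ℝ}
  (hD : EnergyDeriv D fun _ => constEnergy e)
include hD

/-- The product equals `∑ i₁, C ^ (s - 1) * ∑ i₂, e * A`. Differentiating `A` gives the `e ^ 2` term
of `quad0`, and differentiating `C ^ (s - 1)` gives the term with `s - 1`. -/
lemma dTame_Zfun_mul_mean0 (i₃ : Fin l) :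
    DTame (fun τ w => Zfun θ (D τ) i₃ w * mean0 θ (D τ) (constEnergy e) i₃ w)
      (fun τ w => Zfun θ (D τ) i₃ w * (θ.β * quad0 θ (D τ) e i₃ w)) := by
  have h1 := DTame.sum Finset.univ fun i₁ _ => (dTame_Cfun_rpow θ hD i₁ i₃ (θ.s - 1)).mul
    (DTame.sum Finset.univ fun i₂ _ => (dTame_Afun θ hD i₁ i₂ i₃).const_mul (e i₁ i₂))
  have h2 : (fun τ w => ∑ i₁, Cfun θ (D τ) w i₁ i₃ ^ (θ.s - 1)
      * ∑ i₂, e i₁ i₂ * Afun θ (D τ) w i₁ i₂ i₃)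
      = fun τ w => Zfun θ (D τ) i₃ w * mean0 θ (D τ) (constEnergy e) i₃ w := by
    ext τ w
    have hZ := (posTame_Zfun θ hD.tame i₃).ne_zero τ w
    simp only [mean0, constEnergy, gamma0, Finset.mul_sum]
    refine Finset.sum_congr rfl fun i₁ _ => Finset.sum_congr rfl fun i₂ _ => ?_
    have hC := (posTame_Cfun θ hD.tame i₁ i₃).ne_zero τ w
    rw [Real.rpow_sub_one hC]
    field_simp
  rw [h2] at h1
  refine h1.congr' fun τ w => ?_
  have hZ := (posTame_Zfun θ hD.tame i₃).ne_zero τ w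
  simp only [quad0, gamma0]
  rw [Finset.mul_sum, Finset.mul_sum]
  refine Finset.sum_congr rfl fun i₁ _ => ?_
  have hC := (posTame_Cfun θ hD.tame i₁ i₃).ne_zero τ w
  have e1 : ∑ i₂, e i₁ i₂ * Afun θ (D τ) w i₁ i₂ i₃ = Cfun θ (D τ) w i₁ i₃
      * ∑ i₂, e i₁ i₂ * (Afun θ (D τ) w i₁ i₂ i₃ / Cfun θ (D τ) w i₁ i₃) := by
    rw [Finset.mul_sum]
    exact Finset.sum_congr rfl fun i₂ _ => by field_simp
  have e2 : ∑ i₂, e i₁ i₂ * (Afun θ (D τ) w i₁ i₂ i₃ * (θ.β * constEnergy e w i₁ i₂ i₃))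
      = θ.β * Cfun θ (D τ) w i₁ i₃
        * ∑ i₂, e i₁ i₂ ^ 2 * (Afun θ (D τ) w i₁ i₂ i₃ / Cfun θ (D τ) w i₁ i₃) := by
    rw [Finset.mul_sum]
    refine Finset.sum_congr rfl fun i₂ _ => ?_
    simp only [constEnergy]
    field_simp
  have e3 : ∑ i₂, e i₁ i₂ ^ 2 * (Cfun θ (D τ) w i₁ i₃ ^ θ.s / Zfun θ (D τ) i₃ w
      * (Afun θ (D τ) w i₁ i₂ i₃ / Cfun θ (D τ) w i₁ i₃))
      = Cfun θ (D τ) w i₁ i₃ ^ θ.s / Zfun θ (D τ) i₃ w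
        * ∑ i₂, e i₁ i₂ ^ 2 * (Afun θ (D τ) w i₁ i₂ i₃ / Cfun θ (D τ) w i₁ i₃) := by
    rw [Finset.mul_sum]
    exact Finset.sum_congr rfl fun i₂ _ => by ring
  rw [e1, e2, e3, Real.rpow_sub_one hC]
  simp only [constEnergy]
  field_simp
  ring

/-- Since `m 1 = 1`, the weight `Z ^ m 1` is `Z` itself, and the first expectation adds no square of
its own. -/
lemma dTame_expU_Zfun_mul_mean0 (hm1 : θ.m 1 = 1) (i₃ : Fin l) :
    DTame (fun τ w => EZ θ (D τ) i₃ w * Phi1 θ (D τ) i₃ (mean0 θ (D τ) (constEnergy e) i₃) w)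
      (fun τ w => EZ θ (D τ) i₃ w * (θ.β * Phi1 θ (D τ) i₃ (quad0 θ (D τ) e i₃) w)) := by
  have h1 := (dTame_Zfun_mul_mean0 θ hD i₃).expU 1
  have h2 : (fun τ w => expU 1 (fun w => Zfun θ (D τ) i₃ w
        * mean0 θ (D τ) (constEnergy e) i₃ w) w)
      = fun τ w => EZ θ (D τ) i₃ w * Phi1 θ (D τ) i₃ (mean0 θ (D τ) (constEnergy e) i₃) w := by
    ext τ w
    rw [Phi1_eq, mul_div_cancel₀ _ ((posTame_EZ θ hD.tame i₃).ne_zero τ w)]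
    simp only [hm1, Real.rpow_one]
  rw [h2] at h1
  refine h1.congr' fun τ w => ?_
  have hE := (posTame_EZ θ hD.tame i₃).ne_zero τ w
  rw [Phi1_eq]
  simp only [hm1, Real.rpow_one]
  rw [mul_left_comm, mul_div_cancel₀ _ hE]
  simp only [expU, ← integral_const_mul]
  congr 1 with u
  ring

variable [Nonempty (Fin l)]

/-- The product equals `∑ i₃, EZ ^ (p - 1) * (EZ * Phi1 mean0)`. The factor `EZ ^ (p - 1)` produces
squares of averages at a common `i₃`; they are the origin of `γ₂₂` and its coefficient `1 - p`. -/
lemma dTame_zeta_one_mul_meanLevel (hm1 : θ.m 1 = 1) :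
    DTame (fun τ w => zeta θ (D τ) 1 w * meanLevel θ (D τ) e 0 w)
      (fun τ w => zeta θ (D τ) 1 w * (θ.β *
        ((∑ i₃, gamma00 θ (D τ) i₃ w * Phi1 θ (D τ) i₃ (quad0 θ (D τ) e i₃) w)
          - (1 - θ.p) * θ.s * ∑ i₃, gamma00 θ (D τ) i₃ w
            * Phi1 θ (D τ) i₃ (mean0 θ (D τ) (constEnergy e) i₃) w ^ 2))) := by
  have h1 := DTame.sum Finset.univ fun i₃ _ =>
    (DTame.rpow (posTame_EZ θ hD.tame i₃)
      ((tame_Phi1 θ hD.tame i₃ (tame_mean0 θ hD.tame hD.tame' i₃)).const_mul _)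
      (dTame_EZ θ hD i₃) (θ.p - 1)).mul (dTame_expU_Zfun_mul_mean0 θ hD hm1 i₃)
  have hζ : ∀ τ w, ∑ i₃, EZ θ (D τ) i₃ w ^ θ.p ≠ 0 := fun τ w =>
    (posTame_zeta θ hD.tame 0).ne_zero τ w
  have h2 : (fun τ w => ∑ i₃, EZ θ (D τ) i₃ w ^ (θ.p - 1) * (EZ θ (D τ) i₃ w
        * Phi1 θ (D τ) i₃ (mean0 θ (D τ) (constEnergy e) i₃) w))
      = fun τ w => zeta θ (D τ) 1 w * meanLevel θ (D τ) e 0 w := by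
    ext τ w
    simp only [zeta, meanLevel, iterPhi, mean1, gamma00]
    have := hζ τ w
    generalize ∑ i₃, EZ θ (D τ) i₃ w ^ θ.p = S at *
    rw [Finset.mul_sum]
    refine Finset.sum_congr rfl fun i₃ _ => ?_
    have hE := (posTame_EZ θ hD.tame i₃).ne_zero τ w
    rw [Real.rpow_sub_one hE]
    field_simp
  rw [h2] at h1
  refine h1.congr' fun τ w => ?_
  simp only [zeta, gamma00]
  have := hζ τ w
  generalize ∑ i₃, EZ θ (D τ) i₃ w ^ θ.p = S at *
  rw [Finset.mul_sum, ← Finset.sum_sub_distrib, Finset.mul_sum, Finset.mul_sum]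
  refine Finset.sum_congr rfl fun i₃ _ => ?_
  have hE := (posTame_EZ θ hD.tame i₃).ne_zero τ w
  rw [Real.rpow_sub_one hE, hm1]
  field_simp
  ring

/-- Passing from the derivative of `ζ M` to the derivative of `ζ ^ q M`. -/
lemma dTame_rpow_mul_meanLevel (j : ℕ) (hm : ∀ k ∈ Finset.Icc 1 (j + 1), θ.m k ≠ 0)
    {K : ℝ → Config n d → ℝ}
    (h : DTame (fun τ w => zeta θ (D τ) (j + 1) w * meanLevel θ (D τ) e j w)
      (fun τ w => zeta θ (D τ) (j + 1) w * (θ.β * K τ w))) :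
    DTame (fun τ w => zeta θ (D τ) (j + 1) w ^ (θ.m (j + 2) / θ.m (j + 1))
        * meanLevel θ (D τ) e j w)
      (fun τ w => zeta θ (D τ) (j + 1) w ^ (θ.m (j + 2) / θ.m (j + 1))
        * (θ.β * (K τ w - θ.p * θ.s * (θ.m (j + 1) - θ.m (j + 2))
          * meanLevel θ (D τ) e j w ^ 2))) := by
  have hmj : θ.m (j + 1) ≠ 0 := hm (j + 1) (by simp)
  -- With `q = m (j + 2) / m (j + 1)`, write `ζ ^ q * M = ζ ^ (q - 1) * (ζ * M)`. The logarithmic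
  -- derivative of the first factor is `-p s β (m (j + 1) - m (j + 2)) M`, which creates the square.
  have h1 := (DTame.rpow (posTame_zeta θ hD.tame j)
    ((tame_iterPhi θ hD.tame 0 j (tame_mean1 θ hD.tame hD.tame')).const_mul _)
    (dTame_zeta θ hD j fun k hk => hm k (Finset.Icc_subset_Icc_right (by omega) hk))
    (θ.m (j + 2) / θ.m (j + 1) - 1)).mul h
  have h2 : (fun τ w => zeta θ (D τ) (j + 1) w ^ (θ.m (j + 2) / θ.m (j + 1) - 1)
        * (zeta θ (D τ) (j + 1) w * meanLevel θ (D τ) e j w))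
      = fun τ w => zeta θ (D τ) (j + 1) w ^ (θ.m (j + 2) / θ.m (j + 1))
        * meanLevel θ (D τ) e j w := by
    ext τ w
    have hζ := (posTame_zeta θ hD.tame j).ne_zero τ w
    rw [Real.rpow_sub_one hζ]
    field_simp
  rw [h2] at h1
  refine h1.congr' fun τ w => ?_
  have hζ := (posTame_zeta θ hD.tame j).ne_zero τ w
  change _ * (_ * (_ * meanLevel θ (D τ) e j w)) * _ + _ = _
  rw [Real.rpow_sub_one hζ]
  field_simp
  ring

/-- The expectation over `𝒰_{j+2}` of `ζ ^ q * M` at one level is `ζ * M` at the next, so the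
recursion for `curv` alternates an expectation with `dTame_rpow_mul_meanLevel`. -/
lemma dTame_meanLevel (hm1 : θ.m 1 = 1) (j : ℕ)
    (hm : ∀ k ∈ Finset.Icc 1 (j + 1), θ.m k ≠ 0) :
    DTame (fun τ w => zeta θ (D τ) (j + 1) w ^ (θ.m (j + 2) / θ.m (j + 1))
        * meanLevel θ (D τ) e j w)
      (fun τ w => zeta θ (D τ) (j + 1) w ^ (θ.m (j + 2) / θ.m (j + 1))
        * (θ.β * curv θ (D τ) e j w)) := by
  induction j with
  | zero => exact dTame_rpow_mul_meanLevel θ hD 0 hm (dTame_zeta_one_mul_meanLevel θ hD hm1)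
  | succ j ih =>
    have ih := (ih fun k hk => hm k (Finset.Icc_subset_Icc_right (by omega) hk)).expU (j + 2)
    refine dTame_rpow_mul_meanLevel θ hD (j + 1) hm ?_
    have h2 : (fun τ w => expU (j + 2) (fun w => zeta θ (D τ) (j + 1) w
          ^ (θ.m (j + 2) / θ.m (j + 1)) * meanLevel θ (D τ) e j w) w)
        = fun τ w => zeta θ (D τ) (j + 1 + 1) w * meanLevel θ (D τ) e (j + 1) w := by
      ext τ w
      have hP := Phi_eq θ (D τ) j (meanLevel θ (D τ) e j) w
      rw [eq_div_iff ((posTame_zeta θ hD.tame (j + 1)).ne_zero τ w)] at hP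
      rw [← hP, mul_comm]
      simp only [meanLevel, iterPhi, show 1 + j + 1 = j + 2 by ring]
    rw [h2] at ih
    refine ih.congr' fun τ w => ?_
    rw [Phi_eq, mul_left_comm, mul_div_cancel₀ _ ((posTame_zeta θ hD.tame (j + 1)).ne_zero τ w)]
    simp only [expU, ← integral_const_mul]
    congr 1 with u
    ring

end SecondDerivatives

/-! ### Shifting the configuration at outer levels amounts to shifting the energy. -/

section Shift

variable {n d l : ℕ} (θ : Params) (D : Energy n d l) (v : Config n d)

/-- The energy as seen from a shifted configuration. -/
def shiftEnergy : Energy n d l := fun w => D (w + v)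

variable {v}

lemma setU_add {k : ℕ} (hv : v.2 k = 0) (w : Config n d) (u : NoiseU n d) :
    setU k (w + v) u = setU k w u + v := by
  refine Prod.ext rfl (funext fun j => ?_)
  by_cases hj : j = k
  · subst hj
    simp [hv]
  · simp [hj]

/-- A shift that vanishes at level `k` commutes with the resampling of that level. Derivatives along
outer Gaussian coordinates thereby become derivatives along a family of energies. -/
lemma expU_shift {k : ℕ} (hv : v.2 k = 0) (F : Config n d → ℝ) (w : Config n d) :
    expU k F (w + v) = expU k (fun w => F (w + v)) w := by
  unfold expU
  congr 1 with u
  exact congrArg F (setU_add hv w u)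

lemma EZ_shift (hv : v.2 1 = 0) (i₃ : Fin l) (w : Config n d) :
    EZ θ D i₃ (w + v) = EZ θ (shiftEnergy D v) i₃ w := expU_shift hv _ w

lemma Phi1_shift (hv : v.2 1 = 0) (i₃ : Fin l) (F : Config n d → ℝ) (w : Config n d) :
    Phi1 θ D i₃ F (w + v) = Phi1 θ (shiftEnergy D v) i₃ (fun w => F (w + v)) w := by
  rw [Phi1, expU_shift hv]
  simp only [EZ_shift θ D hv]
  rfl

lemma zeta_shift (j : ℕ) (hv : ∀ k ∈ Finset.Icc 1 (j + 1), v.2 k = 0) (w : Config n d) :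
    zeta θ D (j + 1) (w + v) = zeta θ (shiftEnergy D v) (j + 1) w := by
  induction j generalizing w with
  | zero => simp only [zeta, EZ_shift θ D (hv 1 (by simp))]
  | succ j ih =>
    simp only [zeta]
    rw [expU_shift (hv _ (by simp))]
    simp only [ih fun k hk => hv k (Finset.Icc_subset_Icc_right (by omega) hk)]

lemma Phi_shift (j : ℕ) (hv : ∀ k ∈ Finset.Icc 1 (j + 2), v.2 k = 0) (F : Config n d → ℝ)
    (w : Config n d) :
    Phi θ D (j + 2) F (w + v) = Phi θ (shiftEnergy D v) (j + 2) (fun w => F (w + v)) w := by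
  rw [Phi, expU_shift (hv _ (by simp))]
  simp only [show j + 2 - 1 = j + 1 from rfl, zeta_shift θ D (j + 1) hv,
    zeta_shift θ D j fun k hk => hv k (Finset.Icc_subset_Icc_right (by omega) hk)]
  rfl

lemma meanLevel_shift (e : Fin l → Fin l → ℝ) (j : ℕ)
    (hv : ∀ k ∈ Finset.Icc 1 (j + 1), v.2 k = 0) (w : Config n d) :
    meanLevel θ D e j (w + v) = meanLevel θ (shiftEnergy D v) e j w := by
  induction j generalizing w with
  | zero =>
    have hv1 := hv 1 (by simp)
    simp only [meanLevel, iterPhi, mean1, gamma00, Phi1_shift θ D hv1, EZ_shift θ D hv1]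
    rfl
  | succ j ih =>
    have ih := ih fun k hk => hv k (Finset.Icc_subset_Icc_right (by omega) hk)
    have h := Phi_shift θ D j hv (meanLevel θ D e j) w
    simp only [ih] at h
    simpa only [meanLevel, iterPhi, show 1 + j + 1 = j + 2 by ring] using h

lemma curv_shift (e : Fin l → Fin l → ℝ) (j : ℕ)
    (hv : ∀ k ∈ Finset.Icc 1 (j + 1), v.2 k = 0) (w : Config n d) :
    curv θ D e j (w + v) = curv θ (shiftEnergy D v) e j w := by
  induction j generalizing w with
  | zero =>
    have hv1 := hv 1 (by simp)
    simp only [curv, gamma00, Phi1_shift θ D hv1, EZ_shift θ D hv1, meanLevel_shift θ D e 0 hv]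
    rfl
  | succ j ih =>
    have ih := ih fun k hk => hv k (Finset.Icc_subset_Icc_right (by omega) hk)
    simp only [curv, Phi_shift θ D j hv, ih, meanLevel_shift θ D e (j + 1) hv]

end Shift

/-! ### Integration by parts for a coordinate, carried out at its own level. -/

section IntegrationByParts

variable {n d l : ℕ}

lemma DTame.comp_mul {F F' : ℝ → Config n d → ℝ} (h : DTame F F') (a : ℝ) :
    DTame (fun τ w => F (τ * a) w) (fun τ w => a * F' (τ * a) w) where
  tame := h.tame.comp_param (a := fun τ : ℝ => τ * a) (by fun_prop)
  tame' := (h.tame'.comp_param (a := fun τ : ℝ => τ * a) (by fun_prop)).const_mul a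
  deriv τ w := by
    have := (h.deriv (τ * a) w).comp τ ((hasDerivAt_id' τ).mul_const a)
    exact this.congr_deriv (by ring)

/-- Here `hz` and `hδ` say that the coordinate and the direction of the sample become those of the
configuration; tameness supplies the growth that `GaussIBP` asks for. -/
lemma Resample.integral_mul_eq {Y : Type*} [NormedAddCommGroup Y] [NormedSpace ℝ Y]
    [MeasurableSpace Y] [OpensMeasurableSpace Y] {μ : Measure Y} {φ : Config n d → Y → Config n d}
    (hφ : Resample μ φ) {z₀ : Y → ℝ} {δ₀ : Y} (hz₀ : GaussIBP μ z₀ δ₀) {z : Config n d → ℝ}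
    {δ : Config n d} (hz : ∀ w y, z (φ w y) = z₀ y)
    (hδ : ∀ w y (τ : ℝ), φ w (y + τ • δ₀) = φ w y + τ • δ) {F F' : Config n d → ℝ}
    (hF : DTame (fun τ w => F (w + τ • δ)) (fun τ w => F' (w + τ • δ))) (w : Config n d) :
    ∫ y, z (φ w y) * F (φ w y) ∂μ = ∫ y, F' (φ w y) ∂μ := by
  have aux : ∀ {G : Config n d → ℝ}, Tame (fun (τ : ℝ) w => G (w + τ • δ)) →
      Continuous (fun y => G (φ w y)) ∧ ExpGrowth (fun y => G (φ w y)) := by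
    intro G hG
    have hG0 : Tame fun (_ : Unit) w => G w := by simpa using hG.slice 0
    constructor
    · exact hG0.cont.comp (continuous_const.prodMk (hφ.continuous_right w) : Continuous
        fun y => (((), φ w y) : Unit × Config n d))
    · obtain ⟨C, hC⟩ := hG0.bound ()
      refine ⟨weight C w + 2 * C, fun y => (hC.self_of_nhds _).trans (Real.exp_le_exp.2 ?_)⟩
      refine (hφ.bound C w y).trans ?_
      have h1 := weight_nonneg C w
      have h2 := mul_nonneg h1 (norm_nonneg y)
      have h3 : (0 : ℝ) ≤ C := Nat.cast_nonneg C
      nlinarith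
  obtain ⟨c1, g1⟩ := aux hF.tame
  obtain ⟨c2, g2⟩ := aux hF.tame'
  simp only [hz]
  refine hz₀.ibp _ _ c1 c2 g1 g2 fun y => ?_
  simpa only [hδ, zero_smul, add_zero] using hF.deriv 0 (φ w y)

/-- A Gaussian coordinate `z` of level `k`, with the direction `δ` that changes it. -/
structure GaussCoord (r k : ℕ) (z : Config n d → ℝ) (δ : Config n d) : Prop where
  tame : LinTame fun _ : Unit => z
  invariant : ∀ j, 1 ≤ j → j < k → ∀ w u, z (setU j w u) = z w
  dir : ∀ j, 1 ≤ j → j < k → δ.2 j = 0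
  expU_mul : k ≤ r → ∀ F F' : Config n d → ℝ,
    DTame (fun τ w => F (w + τ • δ)) (fun τ w => F' (w + τ • δ)) →
      ∀ w, expU k (fun w => z w * F w) w = expU k F' w
  expTop_mul : k = r + 1 → ∀ F F' : Config n d → ℝ,
    DTame (fun τ w => F (w + τ • δ)) (fun τ w => F' (w + τ • δ)) →
      expTop r (fun w => z w * F w) = expTop r F'

lemma GaussCoord.of_gaussU {r k : ℕ} (hk : 1 ≤ k) (hkr : k ≤ r + 1) {z₀ : NoiseU n d → ℝ}
    {δ₀ : NoiseU n d} (h : GaussIBP (gaussU n d) z₀ δ₀) :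
    GaussCoord r k (fun w => z₀ (w.2 k)) (0, Pi.single k δ₀) where
  tame := by
    refine ⟨h.cont.comp (by fun_prop), fun _ => ⟨k + 1, .of_forall fun _ w => ?_⟩⟩
    refine (h.le_norm _).trans ?_
    have h1 : ‖w.2 k‖ ≤ ∑ j ∈ Finset.range (k + 1), ‖w.2 j‖ :=
      Finset.single_le_sum (f := fun j => ‖w.2 j‖) (fun _ _ => norm_nonneg _) (by simp)
    have h2 : (1 : ℝ) ≤ (k + 1 : ℕ) := by exact_mod_cast Nat.succ_pos k
    unfold weight
    have h3 := norm_nonneg w.1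
    have h4 := norm_nonneg (w.2 k)
    nlinarith
  invariant j _ hj w u := by simp [Function.update_of_ne (by omega : k ≠ j)]
  dir j _ hj := Pi.single_eq_of_ne (by omega) _
  expU_mul _ F F' hF w := by
    refine (resample_expU k).integral_mul_eq (z := fun w => z₀ (w.2 k)) h (fun w u => by simp)
      (fun w u τ => ?_) hF w
    refine Prod.ext (by simp) (funext fun j => ?_)
    by_cases hj : j = k
    · subst hj
      simp
    · simp [hj]
  expTop_mul hk' F F' hF := by
    subst hk'
    refine (resample_expTop r).integral_mul_eq (z := fun w => z₀ (w.2 (r + 1)))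
      (h.prod_right expMoments_gaussG expMoments_gaussU) (fun w u => by simp)
      (fun w u τ => ?_) hF 0
    refine Prod.ext (by simp) (funext fun j => ?_)
    by_cases hj : j = r + 1
    · subst hj
      simp
    · simp [hj]

/-- `G` is integrated together with `𝒰_{r+1}`, hence the level `r + 1`; the clause about `expU` is
then vacuous. -/
lemma GaussCoord.of_gaussG {r : ℕ} {z₀ : NoiseG n d → ℝ} {δ₀ : NoiseG n d}
    (h : GaussIBP (gaussG n d) z₀ δ₀) :
    GaussCoord r (r + 1) (fun w => z₀ w.1) (δ₀, 0) where
  tame := by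
    refine ⟨h.cont.comp (by fun_prop), fun _ => ⟨1, .of_forall fun _ w => ?_⟩⟩
    refine (h.le_norm _).trans ?_
    simp only [weight, Nat.cast_one, Finset.range_one, Finset.sum_singleton]
    linarith [norm_nonneg (w.2 0)]
  invariant j _ hj w u := rfl
  dir j _ hj := rfl
  expU_mul hk := by omega
  expTop_mul _ F F' hF := by
    refine (resample_expTop r).integral_mul_eq (z := fun w => z₀ w.1)
      (h.prod_left expMoments_gaussG expMoments_gaussU) (fun w u => by simp)
      (fun w u τ => ?_) hF 0
    exact Prod.ext (by simp) (by simp)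

variable (θ : Params) {D : Energy n d l} (hD : EnergyTame fun _ : Unit => D) {r k : ℕ}
  {z : Config n d → ℝ} {δ : Config n d} (hz : GaussCoord r k z δ) {e : Fin l → Fin l → ℝ} {a : ℝ}
  (hDδ : ∀ w (τ : ℝ) i₁ i₂ i₃, D (w + τ • δ) i₁ i₂ i₃ = D w i₁ i₂ i₃ + τ * (a * e i₁ i₂))

/-- The energy with an additional drift in the direction `e`. -/
def driftEnergy (D : Energy n d l) (e : Fin l → Fin l → ℝ) (τ : ℝ) : Energy n d l :=
  fun w i₁ i₂ i₃ => D w i₁ i₂ i₃ + τ * e i₁ i₂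

include hD in
lemma energyDeriv_drift : EnergyDeriv (driftEnergy D e) fun _ => constEnergy e where
  tame i₁ i₂ i₃ := .add ((hD i₁ i₂ i₃).comp_param (a := fun _ : ℝ => ()) continuous_const)
    (LinTame.param_mul continuous_id (.const (e i₁ i₂)))
  tame' := energyTame_const e
  deriv τ w i₁ i₂ i₃ := by
    simpa [driftEnergy, constEnergy] using
      ((hasDerivAt_id' τ).mul_const (e i₁ i₂)).const_add (D w i₁ i₂ i₃)

include hDδ in
lemma shiftEnergy_eq_drift (τ : ℝ) : shiftEnergy D (τ • δ) = driftEnergy D e (τ * a) := by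
  ext w i₁ i₂ i₃
  simp only [shiftEnergy, driftEnergy, hDδ]
  ring

include hD hz hDδ

/-- Integration by parts is applied to the unnormalised `Z * mean0`. Moving along `δ` is a drift `a
* e` of the energy, so the derivative is `a` times the one in direction `e`. -/
lemma Phi1_mul_mean0 (hk : k = 1) (hr : 1 ≤ r) (hm1 : θ.m 1 = 1) (i₃ : Fin l) (w : Config n d) :
    Phi1 θ D i₃ (fun w => z w * mean0 θ D (constEnergy e) i₃ w) w
      = a * θ.β * Phi1 θ D i₃ (quad0 θ D e i₃) w := by
  subst hk
  have h := ((dTame_Zfun_mul_mean0 θ (energyDeriv_drift hD (e := e)) i₃).comp_mul a)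
  have key := hz.expU_mul hr (fun w => Zfun θ D i₃ w * mean0 θ D (constEnergy e) i₃ w)
    (fun w => a * (Zfun θ D i₃ w * (θ.β * quad0 θ D e i₃ w))) (by
      simp only [← shiftEnergy_eq_drift hDδ] at h
      exact h) w
  rw [Phi1_eq, Phi1_eq, ← mul_div_assoc]
  congr 1
  simp only [hm1, Real.rpow_one]
  have e1 : (fun w => Zfun θ D i₃ w * (z w * mean0 θ D (constEnergy e) i₃ w))
      = fun w => z w * (Zfun θ D i₃ w * mean0 θ D (constEnergy e) i₃ w) := by
    ext w
    ring
  rw [e1, key]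
  simp only [expU, ← integral_const_mul]
  congr 1 with u
  ring

variable [Nonempty (Fin l)]

/-- The levels up to `j + 1` lie below the coordinate, so its shift passes through all their
expectations and acts only as a drift of the energy. -/
lemma dTame_shift_meanLevel (hm1 : θ.m 1 = 1) (j : ℕ) (hk : j + 1 < k)
    (hm : ∀ k ∈ Finset.Icc 1 (j + 1), θ.m k ≠ 0) :
    DTame (fun τ w => zeta θ D (j + 1) (w + τ • δ) ^ (θ.m (j + 2) / θ.m (j + 1))
        * meanLevel θ D e j (w + τ • δ))
      (fun τ w => a * (zeta θ D (j + 1) (w + τ • δ) ^ (θ.m (j + 2) / θ.m (j + 1))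
        * (θ.β * curv θ D e j (w + τ • δ)))) := by
  have h := ((dTame_meanLevel θ (energyDeriv_drift hD (e := e)) hm1 j hm).comp_mul a)
  have hv : ∀ τ : ℝ, ∀ k ∈ Finset.Icc 1 (j + 1), (τ • δ).2 k = 0 := by
    intro τ i hi
    rw [Finset.mem_Icc] at hi
    have := hz.dir i hi.1 (by omega)
    simp [this]
  simp only [← shiftEnergy_eq_drift hDδ] at h
  simpa only [zeta_shift θ D j (hv _), meanLevel_shift θ D e j (hv _), curv_shift θ D e j (hv _)]
    using h

lemma Phi_mul_meanLevel (hm1 : θ.m 1 = 1) (j : ℕ) (hk : k = j + 2) (hr : k ≤ r)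
    (hm : ∀ k ∈ Finset.Icc 1 (j + 1), θ.m k ≠ 0) (w : Config n d) :
    Phi θ D (j + 2) (fun w => z w * meanLevel θ D e j w) w
      = a * θ.β * Phi θ D (j + 2) (curv θ D e j) w := by
  subst hk
  have key := hz.expU_mul hr
    (fun w => zeta θ D (j + 1) w ^ (θ.m (j + 2) / θ.m (j + 1)) * meanLevel θ D e j w)
    (fun w => a * (zeta θ D (j + 1) w ^ (θ.m (j + 2) / θ.m (j + 1)) * (θ.β * curv θ D e j w)))
    (dTame_shift_meanLevel θ hD hz hDδ hm1 j (by omega) hm) w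
  rw [Phi_eq, Phi_eq, ← mul_div_assoc]
  congr 1
  have e1 : (fun w => zeta θ D (j + 1) w ^ (θ.m (j + 2) / θ.m (j + 1))
        * (z w * meanLevel θ D e j w))
      = fun w => z w * (zeta θ D (j + 1) w ^ (θ.m (j + 2) / θ.m (j + 1))
        * meanLevel θ D e j w) := by
    ext w
    ring
  rw [e1, key]
  simp only [expU, ← integral_const_mul]
  congr 1 with u
  ring

/-- The top expectation carries no weight. It fits the pattern of the other levels because `m (r +
1) = 0` makes the exponent of `ζ_r` zero. -/
lemma expTop_mul_meanLevel (hm1 : θ.m 1 = 1) (j : ℕ) (hj : r = j + 1) (hk : k = r + 1)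
    (hmr : θ.m (r + 1) = 0) (hm : ∀ k ∈ Finset.Icc 1 (j + 1), θ.m k ≠ 0) :
    expTop r (fun w => z w * meanLevel θ D e j w) = a * θ.β * expTop r (curv θ D e j) := by
  subst hj
  have h := dTame_shift_meanLevel θ hD hz hDδ hm1 j (by omega) hm
  rw [show θ.m (j + 2) = 0 from hmr] at h
  simp only [zero_div, Real.rpow_zero, one_mul] at h
  rw [hz.expTop_mul hk (fun w => meanLevel θ D e j w) (fun w => a * (θ.β * curv θ D e j w)) h,
    ← expTop_const_mul]
  congr 1
  ext w
  ring

end IntegrationByParts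

/-! ### Total masses and quadratic forms of the `γ` weights. -/

section Rotate

variable {ι : Type*} [Fintype ι]

lemma sum_rotate_three (f : ι → ι → ι → ℝ) :
    ∑ a, ∑ b, ∑ c, f a b c = ∑ c, ∑ a, ∑ b, f a b c :=
  (Finset.sum_congr rfl fun _ _ => Finset.sum_comm).trans Finset.sum_comm

lemma sum_rotate_five (f : ι → ι → ι → ι → ι → ℝ) :
    ∑ a, ∑ b, ∑ c, ∑ d, ∑ e, f a b c d e = ∑ e, ∑ a, ∑ b, ∑ c, ∑ d, f a b c d e :=
  (Finset.sum_congr rfl fun _ _ => (Finset.sum_congr rfl fun _ _ =>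
    sum_rotate_three _).trans Finset.sum_comm).trans Finset.sum_comm

end Rotate

section Weights

variable {n d l : ℕ} (θ : Params) {D : Energy n d l}

lemma iterPhi_add (a i j : ℕ) (F : Config n d → ℝ) :
    iterPhi θ D a (i + j) F = iterPhi θ D (a + i) j (iterPhi θ D a i F) := by
  induction j with
  | zero => rfl
  | succ j ih =>
    rw [← add_assoc]
    simp only [iterPhi]
    rw [ih, add_assoc a i j]

/-- The weight of the triple `(i₁, i₂, i₃)` after `k` levels. -/
def node (D : Energy n d l) (k : ℕ) (i₁ i₂ i₃ : Fin l) : Config n d → ℝ :=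
  iterPhi θ D 1 (k - 1) fun w => gamma00 θ D i₃ w * Phi1 θ D i₃ (gamma0 θ D i₁ i₂ i₃) w

variable (hD : EnergyTame fun _ : Unit => D)
include hD

lemma tame_node_one (i₁ i₂ i₃ : Fin l) : Tame fun _ : Unit => fun w : Config n d =>
    gamma00 θ D i₃ w * Phi1 θ D i₃ (gamma0 θ D i₁ i₂ i₃) w :=
  (posTame_gamma00 θ hD i₃).tame.mul (tame_Phi1 θ hD i₃ (posTame_gamma0 θ hD i₁ i₂ i₃).tame)

lemma sum_gamma0 (i₃ : Fin l) (w : Config n d) : ∑ i₁, ∑ i₂, gamma0 θ D i₁ i₂ i₃ w = 1 := by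
  have hC : ∀ i₁, Cfun θ D w i₁ i₃ ≠ 0 := fun i₁ => (posTame_Cfun θ hD i₁ i₃).ne_zero () w
  have h : ∀ i₁, ∑ i₂, Afun θ D w i₁ i₂ i₃ / Cfun θ D w i₁ i₃ = 1 := fun i₁ => by
    rw [← Finset.sum_div]
    exact div_self (hC i₁)
  simp only [gamma0, ← Finset.mul_sum, h, mul_one]
  rw [← Finset.sum_div]
  exact div_self ((posTame_Zfun θ hD i₃).ne_zero () w)

lemma mean0_constEnergy_one (i₃ : Fin l) :
    mean0 θ D (constEnergy fun _ _ => 1) i₃ = fun _ => 1 := by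
  ext w
  simpa [mean0, constEnergy] using sum_gamma0 θ hD i₃ w

lemma sum_Phi1_gamma0 (e : Fin l → Fin l → ℝ) (i₃ : Fin l) (w : Config n d) :
    ∑ i₁, ∑ i₂, e i₁ i₂ * Phi1 θ D i₃ (gamma0 θ D i₁ i₂ i₃) w
      = Phi1 θ D i₃ (mean0 θ D (constEnergy e) i₃) w := by
  have h := Phi1_sum θ hD i₃ (Finset.univ : Finset (Fin l × Fin l))
    (F := fun q w => e q.1 q.2 * gamma0 θ D q.1 q.2 i₃ w)
    (fun q _ => (posTame_gamma0 θ hD q.1 q.2 i₃).tame.const_mul _)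
  simp only [Phi1_const_mul, Fintype.sum_prod_type] at h
  exact (congrFun h w).symm

variable [Nonempty (Fin l)]

lemma sum_gamma00 (w : Config n d) : ∑ i₃, gamma00 θ D i₃ w = 1 := by
  simp only [gamma00]
  rw [← Finset.sum_div]
  exact div_self ((posTame_zeta θ hD 0).ne_zero () w)

lemma meanLevel_one (j : ℕ) : meanLevel θ D (fun _ _ => 1) j = fun _ => 1 := by
  have h : mean1 θ D (constEnergy fun _ _ => 1) = fun _ => 1 := by
    ext w
    simpa only [mean1, mean0_constEnergy_one θ hD, Phi1_one θ hD, mul_one] using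
      sum_gamma00 θ hD w
  rw [meanLevel, h, iterPhi_one θ hD 0]

lemma tame_node (k : ℕ) (i₁ i₂ i₃ : Fin l) : Tame fun _ : Unit => node θ D k i₁ i₂ i₃ :=
  tame_iterPhi θ hD 0 (k - 1) (tame_node_one θ hD i₁ i₂ i₃)

lemma node_nonneg (k : ℕ) (i₁ i₂ i₃ : Fin l) (w : Config n d) : 0 ≤ node θ D k i₁ i₂ i₃ w :=
  iterPhi_nonneg θ hD 0 (k - 1) (fun w => mul_nonneg ((posTame_gamma00 θ hD i₃).pos () w).le
    (Phi1_nonneg θ hD i₃ (fun w => ((posTame_gamma0 θ hD i₁ i₂ i₃).pos () w).le) w)) w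

/-- `gammaPair` averages a product of two `node` weights, so this identity turns its quadratic forms
into squares of level means. -/
lemma sum_node (e : Fin l → Fin l → ℝ) (k : ℕ) (w : Config n d) :
    ∑ i₁, ∑ i₂, ∑ i₃, e i₁ i₂ * node θ D k i₁ i₂ i₃ w = meanLevel θ D e (k - 1) w := by
  have h := iterPhi_sum θ hD 0 (k - 1) (Finset.univ : Finset (Fin l × Fin l × Fin l))
    (F := fun q w => e q.1 q.2.1 * (gamma00 θ D q.2.2 w
      * Phi1 θ D q.2.2 (gamma0 θ D q.1 q.2.1 q.2.2) w))
    (fun q _ => (tame_node_one θ hD q.1 q.2.1 q.2.2).const_mul _)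
  simp only [iterPhi_const_mul, Fintype.sum_prod_type, zero_add] at h
  refine (congrFun h w).symm.trans ?_
  unfold meanLevel
  congr 1
  ext w
  simp only [mean1, ← sum_Phi1_gamma0 θ hD e]
  rw [sum_rotate_three]
  refine Finset.sum_congr rfl fun i₃ _ => ?_
  simp only [Finset.mul_sum]
  exact Finset.sum_congr rfl fun i₁ _ => Finset.sum_congr rfl fun i₂ _ => mul_left_comm _ _ _

lemma tame_gammaPair {k : ℕ} (hk : 1 ≤ k) (r : ℕ) (i₁ i₂ p₁ p₂ i₃ p₃ : Fin l) :
    Tame fun _ : Unit => gammaPair r θ D k i₁ i₂ p₁ p₂ i₃ p₃ := by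
  obtain ⟨k, rfl⟩ := Nat.exists_eq_add_of_le' hk
  exact tame_iterPhi θ hD k (r - (k + 1))
    ((tame_node θ hD (k + 1) i₁ i₂ i₃).mul (tame_node θ hD (k + 1) p₁ p₂ p₃))

lemma tame_gamma1 (r : ℕ) (i₁ i₂ p₁ p₂ i₃ : Fin l) :
    Tame fun _ : Unit => gamma1 r θ D i₁ i₂ p₁ p₂ i₃ :=
  tame_iterPhi θ hD 0 (r - 1) ((posTame_gamma00 θ hD i₃).tame.mul (tame_Phi1 θ hD i₃
    ((posTame_gamma0 θ hD i₁ i₂ i₃).tame.mul (posTame_gamma0 θ hD p₁ p₂ i₃).tame)))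

lemma tame_gamma22 (r : ℕ) (i₁ i₂ p₁ p₂ i₃ : Fin l) :
    Tame fun _ : Unit => gamma22 r θ D i₁ i₂ p₁ p₂ i₃ :=
  tame_iterPhi θ hD 0 (r - 1) ((posTame_gamma00 θ hD i₃).tame.mul
    ((tame_Phi1 θ hD i₃ (posTame_gamma0 θ hD i₁ i₂ i₃).tame).mul
      (tame_Phi1 θ hD i₃ (posTame_gamma0 θ hD p₁ p₂ i₃).tame)))

lemma gammaPair_nonneg {k : ℕ} (hk : 1 ≤ k) (r : ℕ) (i₁ i₂ p₁ p₂ i₃ p₃ : Fin l)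
    (w : Config n d) : 0 ≤ gammaPair r θ D k i₁ i₂ p₁ p₂ i₃ p₃ w := by
  obtain ⟨k, rfl⟩ := Nat.exists_eq_add_of_le' hk
  exact iterPhi_nonneg θ hD k (r - (k + 1)) (fun w => mul_nonneg
    (node_nonneg θ hD (k + 1) i₁ i₂ i₃ w) (node_nonneg θ hD (k + 1) p₁ p₂ p₃ w)) w

lemma gamma22_nonneg (r : ℕ) (i₁ i₂ p₁ p₂ i₃ : Fin l) (w : Config n d) :
    0 ≤ gamma22 r θ D i₁ i₂ p₁ p₂ i₃ w :=
  iterPhi_nonneg θ hD 0 (r - 1) (fun w => mul_nonneg ((posTame_gamma00 θ hD i₃).pos () w).le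
    (mul_nonneg (Phi1_nonneg θ hD i₃ (fun w => ((posTame_gamma0 θ hD i₁ i₂ i₃).pos () w).le) w)
      (Phi1_nonneg θ hD i₃ (fun w => ((posTame_gamma0 θ hD p₁ p₂ i₃).pos () w).le) w))) w

/-- The squares of level means that differentiation produces are thereby averages of `e ⊗ e` under
`γ_{k+1}`; the case `e = 1` gives its total mass. -/
lemma sum_gammaPair {k : ℕ} (hk : 1 ≤ k) (r : ℕ) (e : Fin l → Fin l → ℝ) (w : Config n d) :
    ∑ i₁, ∑ i₂, ∑ p₁, ∑ p₂, ∑ i₃, ∑ p₃,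
      e i₁ i₂ * e p₁ p₂ * gammaPair r θ D k i₁ i₂ p₁ p₂ i₃ p₃ w
      = iterPhi θ D k (r - k) (fun w => meanLevel θ D e (k - 1) w ^ 2) w := by
  obtain ⟨k, rfl⟩ := Nat.exists_eq_add_of_le' hk
  have h := iterPhi_sum θ hD k (r - (k + 1))
    (Finset.univ : Finset (Fin l × Fin l × Fin l × Fin l × Fin l × Fin l))
    (F := fun q w => e q.1 q.2.1 * e q.2.2.1 q.2.2.2.1
      * (node θ D (k + 1) q.1 q.2.1 q.2.2.2.2.1 w
        * node θ D (k + 1) q.2.2.1 q.2.2.2.1 q.2.2.2.2.2 w))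
    (fun q _ => ((tame_node θ hD (k + 1) _ _ _).mul (tame_node θ hD (k + 1) _ _ _)).const_mul _)
  simp only [iterPhi_const_mul, Fintype.sum_prod_type] at h
  refine (congrFun h w).symm.trans ?_
  congr 1
  ext w
  simp only [← sum_node θ hD e (k + 1), sq, Finset.sum_mul_sum]
  refine Finset.sum_congr rfl fun i₁ _ => ?_
  rw [Finset.sum_comm]
  refine Finset.sum_congr rfl fun i₂ _ => Finset.sum_congr rfl fun p₁ _ =>
    Finset.sum_congr rfl fun p₂ _ => Finset.sum_congr rfl fun i₃ _ =>
    Finset.sum_congr rfl fun p₃ _ => ?_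
  ring

/-- The two index pairs share `i₃`, so the square stays inside the sum over `i₃`; this is the extra
square from the power `p`. -/
lemma sum_gamma22 (r : ℕ) (e : Fin l → Fin l → ℝ) (w : Config n d) :
    ∑ i₁, ∑ i₂, ∑ p₁, ∑ p₂, ∑ i₃, e i₁ i₂ * e p₁ p₂ * gamma22 r θ D i₁ i₂ p₁ p₂ i₃ w
      = iterPhi θ D 1 (r - 1) (fun w => ∑ i₃, gamma00 θ D i₃ w
        * Phi1 θ D i₃ (mean0 θ D (constEnergy e) i₃) w ^ 2) w := by
  have h := iterPhi_sum θ hD 0 (r - 1)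
    (Finset.univ : Finset (Fin l × Fin l × Fin l × Fin l × Fin l))
    (F := fun q w => e q.1 q.2.1 * e q.2.2.1 q.2.2.2.1
      * (gamma00 θ D q.2.2.2.2 w * (Phi1 θ D q.2.2.2.2 (gamma0 θ D q.1 q.2.1 q.2.2.2.2) w
        * Phi1 θ D q.2.2.2.2 (gamma0 θ D q.2.2.1 q.2.2.2.1 q.2.2.2.2) w)))
    (fun q _ => ((posTame_gamma00 θ hD _).tame.mul
      ((tame_Phi1 θ hD _ (posTame_gamma0 θ hD _ _ _).tame).mul
        (tame_Phi1 θ hD _ (posTame_gamma0 θ hD _ _ _).tame))).const_mul _)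
  simp only [iterPhi_const_mul, Fintype.sum_prod_type, zero_add] at h
  refine (congrFun h w).symm.trans ?_
  congr 1
  ext w
  rw [sum_rotate_five]
  refine Finset.sum_congr rfl fun i₃ _ => ?_
  rw [← sum_Phi1_gamma0 θ hD e, sq, Finset.sum_mul, Finset.mul_sum]
  refine Finset.sum_congr rfl fun i₁ _ => ?_
  rw [Finset.sum_mul, Finset.mul_sum]
  refine Finset.sum_congr rfl fun i₂ _ => ?_
  rw [Finset.mul_sum, Finset.mul_sum]
  refine Finset.sum_congr rfl fun p₁ _ => ?_
  rw [Finset.mul_sum, Finset.mul_sum]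
  refine Finset.sum_congr rfl fun p₂ _ => ?_
  ring

lemma sum_gamma1 (r : ℕ) (w : Config n d) :
    ∑ i₁, ∑ i₂, ∑ p₁, ∑ p₂, ∑ i₃, gamma1 r θ D i₁ i₂ p₁ p₂ i₃ w = 1 := by
  have h := iterPhi_sum θ hD 0 (r - 1)
    (Finset.univ : Finset (Fin l × Fin l × Fin l × Fin l × Fin l))
    (F := fun q w => gamma00 θ D q.2.2.2.2 w * Phi1 θ D q.2.2.2.2
      (fun w => gamma0 θ D q.1 q.2.1 q.2.2.2.2 w * gamma0 θ D q.2.2.1 q.2.2.2.1 q.2.2.2.2 w) w)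
    (fun q _ => (posTame_gamma00 θ hD _).tame.mul
      (tame_Phi1 θ hD _ ((posTame_gamma0 θ hD _ _ _).tame.mul (posTame_gamma0 θ hD _ _ _).tame)))
  simp only [Fintype.sum_prod_type, zero_add] at h
  refine (congrFun h w).symm.trans ?_
  have h1 : (fun w => ∑ i₁, ∑ i₂, ∑ p₁, ∑ p₂, ∑ i₃, gamma00 θ D i₃ w * Phi1 θ D i₃
      (fun w => gamma0 θ D i₁ i₂ i₃ w * gamma0 θ D p₁ p₂ i₃ w) w) = fun _ => 1 := by
    ext w
    rw [sum_rotate_five, ← sum_gamma00 θ hD w]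
    refine Finset.sum_congr rfl fun i₃ _ => ?_
    have h2 := Phi1_sum θ hD i₃ (Finset.univ : Finset (Fin l × Fin l × Fin l × Fin l))
      (F := fun q w => gamma0 θ D q.1 q.2.1 i₃ w * gamma0 θ D q.2.2.1 q.2.2.2 i₃ w)
      (fun q _ => (posTame_gamma0 θ hD _ _ _).tame.mul (posTame_gamma0 θ hD _ _ _).tame)
    simp only [Fintype.sum_prod_type, ← Finset.mul_sum, sum_gamma0 θ hD, mul_one,
      Phi1_one θ hD] at h2
    simp only [← Finset.mul_sum]
    rw [← congrFun h2 w, mul_one]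
  rw [h1, iterPhi_one θ hD 0]

end Weights

/-! ### Differentiability in the variances up to the boundary. -/

section SquareRoots

/-- A function whose partial derivatives are `α c * W α c` with continuous `W` is differentiable
as a function of the squares of its variables, up to the boundary of the orthant. -/
lemma hasFDerivWithinAt_comp_sqrt {ι : Type*} [Fintype ι] {f : (ι → ℝ) → ℝ}
    {W : ι → (ι → ℝ) → ℝ} (hW : ∀ c, Continuous (W c))
    (hf : ∀ α₀ α₁ : ι → ℝ, ∀ τ : ℝ, HasDerivAt (fun τ => f (α₀ + τ • α₁))
      (∑ c, α₁ c * ((α₀ + τ • α₁) c * W c (α₀ + τ • α₁))) τ)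
    {v₀ : ι → ℝ} (hv₀ : ∀ c, 0 ≤ v₀ c) :
    HasFDerivWithinAt (fun v => f fun c => √(v c))
      (∑ c, (1 / 2 * W c fun c => √(v₀ c)) • ContinuousLinearMap.proj (R := ℝ) (φ := fun _ : ι => ℝ) c)
      {v | ∀ c, 0 ≤ v c} v₀ := by
  refine .of_isLittleO (Asymptotics.isLittleO_iff.2 fun κ hκ => ?_)
  set α₀ : ι → ℝ := fun c => √(v₀ c) with hα₀
  obtain ⟨ε, hε, hεκ⟩ : ∃ ε > 0, ε * Fintype.card ι ≤ κ := by
    refine ⟨κ / (Fintype.card ι + 1), by positivity, ?_⟩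
    rw [div_mul_eq_mul_div, div_le_iff₀ (by positivity)]
    nlinarith
  have h1 : ∀ᶠ α in 𝓝 α₀, ∀ c, |W c α - W c α₀| < ε := by
    refine Filter.eventually_all.2 fun c => ?_
    simpa [Real.dist_eq] using (hW c).continuousAt.eventually (Metric.ball_mem_nhds _ hε)
  obtain ⟨ρ, hρ, hball⟩ := Metric.eventually_nhds_iff_ball.1 h1
  have hsq : Continuous fun v : ι → ℝ => fun c => √(v c) := by fun_prop
  have h2 : ∀ᶠ v in 𝓝 v₀, (fun c => √(v c)) ∈ Metric.ball α₀ ρ :=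
    hsq.continuousAt.eventually (Metric.ball_mem_nhds _ hρ)
  filter_upwards [mem_nhdsWithin_of_mem_nhds h2, self_mem_nhdsWithin] with v hv hv0
  set α₁ : ι → ℝ := (fun c => √(v c)) - α₀ with hα₁
  have hseg : ∀ τ ∈ Icc (0 : ℝ) 1, α₀ + τ • α₁ ∈ Metric.ball α₀ ρ := fun τ hτ =>
    (convex_ball α₀ ρ).add_smul_sub_mem (Metric.mem_ball_self hρ) hv hτ
  -- Subtracting the quadratic function `∑ c, 1 / 2 * W c α₀ * α c ^ 2`, which is linear in the
  -- squares, leaves only the oscillation of `W` in the derivative along the segment.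
  have hd : ∀ τ : ℝ, HasDerivAt
      (fun τ => f (α₀ + τ • α₁) - ∑ c, 1 / 2 * W c α₀ * ((α₀ + τ • α₁) c) ^ 2)
      (∑ c, α₁ c * (α₀ + τ • α₁) c * (W c (α₀ + τ • α₁) - W c α₀)) τ := by
    intro τ
    have h3 : HasDerivAt (fun τ : ℝ => ∑ c, 1 / 2 * W c α₀ * ((α₀ + τ • α₁) c) ^ 2)
        (∑ c, W c α₀ * (α₀ + τ • α₁) c * α₁ c) τ := by
      refine HasDerivAt.fun_sum fun c _ => ?_
      have h4 : HasDerivAt (fun τ : ℝ => (α₀ + τ • α₁) c) (α₁ c) τ := by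
        simpa using ((hasDerivAt_id' τ).mul_const (α₁ c)).const_add (α₀ c)
      refine ((h4.fun_pow 2).const_mul (1 / 2 * W c α₀)).congr_deriv ?_
      push_cast
      ring
    refine ((hf α₀ α₁ τ).sub h3).congr_deriv ?_
    rw [← Finset.sum_sub_distrib]
    exact Finset.sum_congr rfl fun c _ => by ring
  obtain ⟨ξ, hξ, hslope⟩ := exists_hasDerivAt_eq_slope _ _ (zero_lt_one' ℝ)
    (fun τ _ => (hd τ).continuousAt.continuousWithinAt) fun τ _ => hd τ
  have hend : α₀ + α₁ = fun c => √(v c) := by simp [hα₁]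
  have hdiff : f (fun c => √(v c)) - f α₀ - ∑ c, 1 / 2 * W c α₀ * (v c - v₀ c)
      = ∑ c, α₁ c * (α₀ + ξ • α₁) c * (W c (α₀ + ξ • α₁) - W c α₀) := by
    rw [hslope]
    simp only [one_smul, zero_smul, add_zero, sub_zero, div_one, hend]
    have : ∑ c, 1 / 2 * W c α₀ * (v c - v₀ c)
        = ∑ c, 1 / 2 * W c α₀ * √(v c) ^ 2 - ∑ c, 1 / 2 * W c α₀ * α₀ c ^ 2 := by
      rw [← Finset.sum_sub_distrib]
      refine Finset.sum_congr rfl fun c _ => ?_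
      rw [Real.sq_sqrt (hv0 c), hα₀, Real.sq_sqrt (hv₀ c)]
      ring
    rw [this]
    ring
  have hlin : (∑ c, (1 / 2 * W c α₀) • ContinuousLinearMap.proj (R := ℝ) (φ := fun _ : ι => ℝ) c)
      (v - v₀) = ∑ c, 1 / 2 * W c α₀ * (v c - v₀ c) := by
    simp
  rw [hlin, Real.norm_eq_abs, hdiff]
  refine (Finset.abs_sum_le_sum_abs _ _).trans ?_
  calc ∑ c, |α₁ c * (α₀ + ξ • α₁) c * (W c (α₀ + ξ • α₁) - W c α₀)|
      ≤ ∑ _c : ι, ‖v - v₀‖ * ε := by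
        refine Finset.sum_le_sum fun c _ => ?_
        rw [abs_mul]
        refine mul_le_mul ?_ (hball _ (hseg ξ ⟨hξ.1.le, hξ.2.le⟩) c).le (abs_nonneg _)
          (norm_nonneg _)
        -- The extra factor in the derivative compensates the singular square root: `|√v - √v₀| (√v
        -- + √v₀) = |v - v₀|`, so the error is linear in `v - v₀` even where `v₀` vanishes.
        have h5 : |(α₀ + ξ • α₁) c| ≤ √(v c) + √(v₀ c) := by
          have e1 : (α₀ + ξ • α₁) c = (1 - ξ) * √(v₀ c) + ξ * √(v c) := by
            simp [hα₁, hα₀]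
            ring
          have := Real.sqrt_nonneg (v c)
          have := Real.sqrt_nonneg (v₀ c)
          rw [e1, abs_of_nonneg (add_nonneg (mul_nonneg (by linarith [hξ.2]) ‹_›)
            (mul_nonneg hξ.1.le ‹_›))]
          nlinarith [hξ.1, hξ.2]
        calc |α₁ c * (α₀ + ξ • α₁) c| ≤ |α₁ c| * (√(v c) + √(v₀ c)) := by
              rw [abs_mul]
              exact mul_le_mul_of_nonneg_left h5 (abs_nonneg _)
          _ = |α₁ c * (√(v c) + √(v₀ c))| := by
              rw [abs_mul, abs_of_nonneg (a := √(v c) + √(v₀ c)) (by positivity)]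
          _ = |(v - v₀) c| := by
              congr 1
              have e1 := Real.sq_sqrt (hv0 c)
              have e2 := Real.sq_sqrt (hv₀ c)
              simp only [hα₁, hα₀, Pi.sub_apply]
              linear_combination e1 - e2
          _ ≤ ‖v - v₀‖ := norm_le_pi_norm (v - v₀) c
    _ = ε * Fintype.card ι * ‖v - v₀‖ := by
        rw [Finset.sum_const, Finset.card_univ, nsmul_eq_mul]
        ring
    _ ≤ κ * ‖v - v₀‖ := mul_le_mul_of_nonneg_right hεκ (norm_nonneg _)

end SquareRoots

/-! ### The level dependence of the averaged curvature. -/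

section LevelAverages

variable {n d l : ℕ} (θ : Params) (D : Energy n d l) (r : ℕ) (e : Fin l → Fin l → ℝ)

/-- The second derivative of the innermost level. -/
def baseCurv (w : Config n d) : ℝ := ∑ i₃, gamma00 θ D i₃ w * Phi1 θ D i₃ (quad0 θ D e i₃) w

/-- The loss of curvature from the level `k` to the level `k + 1`. -/
def loss : ℕ → Config n d → ℝ
  | 0 => fun _ => 0
  | 1 => fun w => (1 - θ.p) * θ.s * (∑ i₃, gamma00 θ D i₃ w
          * Phi1 θ D i₃ (mean0 θ D (constEnergy e) i₃) w ^ 2)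
      + θ.p * θ.s * (θ.m 1 - θ.m 2) * meanLevel θ D e 0 w ^ 2
  | j + 2 => fun w => θ.p * θ.s * (θ.m (j + 2) - θ.m (j + 3)) * meanLevel θ D e (j + 1) w ^ 2

/-- The total average of the curvature that a coordinate of level `k` sees. -/
def levelAvg : ℕ → ℝ
  | 0 => 0
  | 1 => expTop r (iterPhi θ D 1 (r - 1) (baseCurv θ D e))
  | j + 2 => expTop r (iterPhi θ D (j + 1) (r - (j + 1)) (curv θ D e j))

/-- The total average of the loss of curvature. -/
def lossAvg (k : ℕ) : ℝ := expTop r (iterPhi θ D k (r - k) (loss θ D e k))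

variable {D}

variable (hD : EnergyTame fun _ : Unit => D)
include hD

lemma tame_baseCurv : Tame fun _ : Unit => baseCurv θ D e :=
  .sum _ fun i₃ _ => (posTame_gamma00 θ hD i₃).tame.mul (tame_Phi1 θ hD i₃ (tame_quad0 θ hD e i₃))

lemma tame_sum_Phi1_sq : Tame fun _ : Unit => fun w => ∑ i₃, gamma00 θ D i₃ w
    * Phi1 θ D i₃ (mean0 θ D (constEnergy e) i₃) w ^ 2 :=
  .sum _ fun i₃ _ => (posTame_gamma00 θ hD i₃).tame.mul
    (.pow (tame_Phi1 θ hD i₃ (tame_mean0 θ hD (energyTame_const e) i₃)) 2)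

variable [Nonempty (Fin l)]

lemma expTop_iterPhi_sum (a j : ℕ) {ι : Type*} (s : Finset ι) (b : ι → ℝ)
    {F : ι → Config n d → ℝ} (hF : ∀ i ∈ s, Tame fun _ : Unit => F i) :
    expTop r (iterPhi θ D (a + 1) j (fun w => ∑ i ∈ s, b i * F i w))
      = ∑ i ∈ s, b i * expTop r (iterPhi θ D (a + 1) j (F i)) := by
  rw [iterPhi_sum θ hD a j s (F := fun i w => b i * F i w) fun i hi => (hF i hi).const_mul _]
  simp only [iterPhi_const_mul]
  rw [expTop_sum r s fun i hi => (tame_iterPhi θ hD a j (hF i hi)).const_mul _]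
  simp only [expTop_const_mul]

lemma expTop_iterPhi_sub (a j : ℕ) {F G : Config n d → ℝ} (hF : Tame fun _ : Unit => F)
    (hG : Tame fun _ : Unit => G) :
    expTop r (iterPhi θ D (a + 1) j (fun w => F w - G w))
      = expTop r (iterPhi θ D (a + 1) j F) - expTop r (iterPhi θ D (a + 1) j G) := by
  have h := expTop_iterPhi_sum θ r hD a j (Finset.univ : Finset (Fin 2)) ![1, -1]
    (F := ![F, G]) (by
      intro i _
      fin_cases i
      exacts [hF, hG])
  simpa [Fin.sum_univ_two, ← sub_eq_add_neg] using h

lemma tame_loss (k : ℕ) : Tame fun _ : Unit => loss θ D e k := by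
  rcases k with _ | _ | j
  · exact .const 0
  · have h1 := (tame_sum_Phi1_sq θ e hD).const_mul ((1 - θ.p) * θ.s)
    have h2 := (Tame.pow (tame_meanLevel θ hD e 0) 2).const_mul (θ.p * θ.s * (θ.m 1 - θ.m 2))
    exact h1.add h2
  · exact (Tame.pow (tame_meanLevel θ hD e (j + 1)) 2).const_mul _

/-- By its recursion `curv` subtracts one square per level, and the remaining outer operators are
linear. -/
lemma levelAvg_succ {k : ℕ} (hk : 1 ≤ k) (hkr : k ≤ r) :
    levelAvg θ D r e (k + 1) = levelAvg θ D r e k - lossAvg θ D r e k := by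
  match k with
  | 1 =>
    simp only [levelAvg, lossAvg, zero_add]
    rw [← expTop_iterPhi_sub θ r hD 0 (r - 1) (tame_baseCurv θ e hD) (tame_loss θ e hD 1)]
    simp only [loss, curv, sub_sub, zero_add]
    rfl
  | j + 2 =>
    simp only [levelAvg, lossAvg]
    have h1 : iterPhi θ D (j + 1) (r - (j + 1)) (curv θ D e j)
        = iterPhi θ D (j + 2) (r - (j + 2)) (Phi θ D (j + 2) (curv θ D e j)) := by
      rw [show r - (j + 1) = 1 + (r - (j + 2)) by omega, iterPhi_add]
      rfl
    rw [h1, ← expTop_iterPhi_sub θ r hD (j + 1) (r - (j + 2))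
      (tame_Phi θ hD j (tame_curv θ hD e j)) (tame_loss θ e hD (j + 2))]
    rfl

/-- The sum has the fixed range `Icc 1 r`, with the dependence on `k` in an indicator, so that it
can later be exchanged with the sum over coordinates. -/
lemma levelAvg_eq {k : ℕ} (hk : 1 ≤ k) (hkr : k ≤ r + 1) :
    levelAvg θ D r e k = levelAvg θ D r e 1
      - ∑ i ∈ Finset.Icc 1 r, if i < k then lossAvg θ D r e i else 0 := by
  induction k, hk using Nat.le_induction with
  | base =>
    rw [Finset.sum_eq_zero, sub_zero]
    intro i hi
    rw [if_neg]
    have := (Finset.mem_Icc.1 hi).1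
    omega
  | succ k hk ih =>
    rw [levelAvg_succ θ r e hD hk (by omega), ih (by omega)]
    have h : ∀ i ∈ Finset.Icc 1 r, (if i < k + 1 then lossAvg θ D r e i else 0)
        = (if i < k then lossAvg θ D r e i else 0) + if i = k then lossAvg θ D r e i else 0 := by
      intro i _
      rcases lt_trichotomy i k with h | h | h
      · simp [h, h.ne, h.trans (Nat.lt_succ_self k)]
      · simp [h]
      · simp [show ¬ i < k + 1 by omega, show ¬ i < k by omega, show i ≠ k by omega]
    rw [Finset.sum_congr rfl h, Finset.sum_add_distrib, Finset.sum_ite_eq',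
      if_pos (Finset.mem_Icc.2 ⟨hk, by omega⟩)]
    ring

/-- The innermost terms cancel for coordinates whose directions have no overlap within `i₁`. -/
lemma sum_levelAvg_one {ι : Type*} (s : Finset ι) (b : ι → ℝ) (e : ι → Fin l → Fin l → ℝ)
    (h : ∀ i₁ i₂ p₂, ∑ c ∈ s, b c * (e c i₁ i₂ * e c i₁ p₂) = 0) :
    ∑ c ∈ s, b c * levelAvg θ D r (e c) 1 = 0 := by
  simp only [levelAvg]
  rw [← expTop_iterPhi_sum θ r hD 0 (r - 1) s b fun c _ => tame_baseCurv θ (e c) hD]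
  have hq : ∀ i₃, (fun w => ∑ c ∈ s, b c * quad0 θ D (e c) i₃ w) = fun _ => 0 * 0 := by
    intro i₃
    ext w
    simp only [quad0, Finset.mul_sum]
    rw [Finset.sum_comm, zero_mul]
    refine Finset.sum_eq_zero fun i₁ _ => ?_
    have e1 : ∑ c ∈ s, b c * ∑ i₂, e c i₁ i₂ ^ 2 * gamma0 θ D i₁ i₂ i₃ w = 0 := by
      simp only [Finset.mul_sum]
      rw [Finset.sum_comm]
      refine Finset.sum_eq_zero fun i₂ _ => ?_
      calc _ = (∑ c ∈ s, b c * (e c i₁ i₂ * e c i₁ i₂)) * gamma0 θ D i₁ i₂ i₃ w := by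
            rw [Finset.sum_mul]
            exact Finset.sum_congr rfl fun c _ => by ring
        _ = 0 := by rw [h, zero_mul]
    -- The square of an average over `i₂` is a double sum over `i₂, p₂` with the same `i₁`, the only
    -- pairs that the hypothesis controls.
    have e2 : ∑ c ∈ s, b c
        * (∑ i₂, e c i₁ i₂ * (Afun θ D w i₁ i₂ i₃ / Cfun θ D w i₁ i₃)) ^ 2 = 0 := by
      simp only [sq, Finset.sum_mul_sum]
      simp only [Finset.mul_sum]
      rw [Finset.sum_comm]
      refine Finset.sum_eq_zero fun i₂ _ => ?_
      rw [Finset.sum_comm]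
      refine Finset.sum_eq_zero fun p₂ _ => ?_
      calc _ = (∑ c ∈ s, b c * (e c i₁ i₂ * e c i₁ p₂))
              * (Afun θ D w i₁ i₂ i₃ / Cfun θ D w i₁ i₃ * (Afun θ D w i₁ p₂ i₃ / Cfun θ D w i₁ i₃)) := by
            rw [Finset.sum_mul]
            exact Finset.sum_congr rfl fun c _ => by ring
        _ = 0 := by rw [h, zero_mul]
    simp only [Finset.mul_sum] at e1
    simp only [mul_add, Finset.sum_add_distrib, Finset.mul_sum]
    rw [e1, zero_add]
    calc _ = (θ.s - 1) * (Cfun θ D w i₁ i₃ ^ θ.s / Zfun θ D i₃ w) * (∑ c ∈ s, b c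
        * (∑ i₂, e c i₁ i₂ * (Afun θ D w i₁ i₂ i₃ / Cfun θ D w i₁ i₃)) ^ 2) := by
          rw [Finset.mul_sum]
          exact Finset.sum_congr rfl fun c _ => by ring
      _ = 0 := by rw [e2, mul_zero]
  -- Zero is written `0 * 0` so that linearity pulls a factor `0` out of the nested averages.
  have hz : (fun w => ∑ c ∈ s, b c * baseCurv θ D (e c) w) = fun _ => 0 * 0 := by
    ext w
    simp only [baseCurv, Finset.mul_sum]
    rw [Finset.sum_comm, zero_mul]
    refine Finset.sum_eq_zero fun i₃ _ => ?_
    have h1 := Phi1_sum θ hD i₃ s (F := fun c w => b c * quad0 θ D (e c) i₃ w)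
      fun c _ => (tame_quad0 θ hD (e c) i₃).const_mul _
    rw [hq] at h1
    simp only [Phi1_const_mul, zero_mul] at h1
    have h2 := congrFun h1 w
    have h3 : Phi1 θ D i₃ (fun _ => (0 : ℝ)) w = 0 := by simp [Phi1, expU]
    rw [h3] at h2
    calc _ = gamma00 θ D i₃ w * ∑ c ∈ s, b c * Phi1 θ D i₃ (quad0 θ D (e c) i₃) w := by
          rw [Finset.mul_sum]
          exact Finset.sum_congr rfl fun c _ => by ring
      _ = 0 := by rw [← h2, mul_zero]
  rw [hz, iterPhi_const_mul, expTop_const_mul, zero_mul]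

end LevelAverages

/-! ### Free energies of energies that are linear in Gaussian coordinates. -/

lemma DTame.log {n d : ℕ} {F L : ℝ → Config n d → ℝ} (hF : PosTame F) (hL : Tame L)
    (h : DTame F fun τ w => F τ w * L τ w) :
    DTame (fun τ w => Real.log (F τ w)) L :=
  ⟨hF.log.tame, hL, fun τ w => ((h.deriv τ w).log (hF.ne_zero τ w)).congr_deriv
    (mul_div_cancel_left₀ _ (hF.ne_zero τ w))⟩

/-- Energies that are linear in independent Gaussian coordinates. -/
structure LinModel (n d l r : ℕ) (ι : Type) [DecidableEq ι] where
  base : Fin l → Fin l → ℝ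
  z : ι → Config n d → ℝ
  δ : ι → Config n d
  lev : ι → ℕ
  e : ι → Fin l → Fin l → ℝ
  one_le_lev : ∀ c, 1 ≤ lev c
  lev_le : ∀ c, lev c ≤ r + 1
  coord : ∀ c, GaussCoord r (lev c) (z c) (δ c)
  shift : ∀ c c' w (τ : ℝ), z c (w + τ • δ c') = z c w + if c = c' then τ else 0

namespace LinModel

variable {n d l r : ℕ} {ι : Type} [DecidableEq ι] [Fintype ι] (M : LinModel n d l r ι)

/-- The energy with the coefficients `α`. -/
def energy (α : ι → ℝ) : Energy n d l := fun w i₁ i₂ i₃ =>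
  M.base i₁ i₃ + ∑ c, α c * (M.z c w * M.e c i₁ i₂)

/-- The contribution of the coordinate `c` to the energy. -/
def coordEnergy (c : ι) : Energy n d l := fun w i₁ i₂ _ => M.z c w * M.e c i₁ i₂

omit [Fintype ι] in
lemma energyTame_coordEnergy {X : Type*} [TopologicalSpace X] (c : ι) :
    EnergyTame fun _ : X => M.coordEnergy c := by
  intro i₁ i₂ i₃
  have h := ((M.coord c).tame.const_mul (M.e c i₁ i₂)).comp_param
    (a := fun _ : X => ()) continuous_const
  simpa only [coordEnergy, mul_comm] using h

lemma energyTame_energy : EnergyTame fun α : ι → ℝ => M.energy α := by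
  intro i₁ i₂ i₃
  exact (LinTame.const _).add (.sum _ fun c _ =>
    LinTame.param_mul (continuous_apply c) (M.energyTame_coordEnergy c i₁ i₂ i₃))

lemma energy_shift (α : ι → ℝ) (c : ι) (w : Config n d) (τ : ℝ) (i₁ i₂ i₃ : Fin l) :
    M.energy α (w + τ • M.δ c) i₁ i₂ i₃ = M.energy α w i₁ i₂ i₃ + τ * (α c * M.e c i₁ i₂) := by
  simp only [energy, M.shift, add_mul, mul_add, Finset.sum_add_distrib, ite_mul, zero_mul,
    mul_ite, mul_zero, Finset.sum_ite_eq', Finset.mem_univ, if_true]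
  ring

lemma energyDeriv_line (α₀ α₁ : ι → ℝ) :
    EnergyDeriv (fun τ : ℝ => M.energy (α₀ + τ • α₁))
      (fun _ w i₁ i₂ i₃ => ∑ c, α₁ c * M.coordEnergy c w i₁ i₂ i₃) where
  tame i₁ i₂ i₃ := (M.energyTame_energy i₁ i₂ i₃).comp_param
    (a := fun τ : ℝ => α₀ + τ • α₁) (by fun_prop)
  tame' i₁ i₂ i₃ := .sum _ fun c _ => (M.energyTame_coordEnergy c i₁ i₂ i₃).const_mul _
  deriv τ w i₁ i₂ i₃ := by
    refine (HasDerivAt.fun_sum fun c _ => ?_).const_add _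
    have h : HasDerivAt (fun τ : ℝ => (α₀ + τ • α₁) c) (α₁ c) τ := by
      simpa using ((hasDerivAt_id' τ).mul_const (α₁ c)).const_add (α₀ c)
    exact h.mul_const _

variable (θ : Params) [Nonempty (Fin l)]

/-- This is the continuity of the factors `W c` in `hasFDerivWithinAt_comp_sqrt`. -/
lemma continuous_levelAvg (e : Fin l → Fin l → ℝ) (k : ℕ) :
    Continuous fun α : ι → ℝ => levelAvg θ (M.energy α) r e k := by
  have aux : ∀ {F : (ι → ℝ) → Config n d → ℝ}, Tame F → ∀ a j, Continuous fun α =>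
      expTop r (iterPhi θ (M.energy α) (a + 1) j (F α)) := by
    intro F hF a j
    have h := tame_expTop (tame_iterPhi θ M.energyTame_energy a j hF) r
    exact h.cont.comp (continuous_id.prodMk (continuous_const (y := (0 : Config n d))))
  match k with
  | 0 => exact continuous_const
  | 1 =>
    exact aux (F := fun α w => baseCurv θ (M.energy α) e w)
      (.sum _ fun i₃ _ => (posTame_gamma00 θ M.energyTame_energy i₃).tame.mul
        (tame_Phi1 θ M.energyTame_energy i₃ (tame_quad0 θ M.energyTame_energy e i₃))) 0 (r - 1)
  | j + 2 => exact aux (tame_curv θ M.energyTame_energy e j) j (r - (j + 1))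

/-- Gaussian integration by parts for a coordinate of the energy. -/
lemma expTop_mean1_coordEnergy (hr : 1 ≤ r) (hm1 : θ.m 1 = 1) (hmr : θ.m (r + 1) = 0)
    (hm : ∀ k ∈ Finset.Icc 1 r, θ.m k ≠ 0) (α : ι → ℝ) (c : ι) :
    expTop r (iterPhi θ (M.energy α) 1 (r - 1) (mean1 θ (M.energy α) (M.coordEnergy c)))
      = α c * θ.β * levelAvg θ (M.energy α) r (M.e c) (M.lev c) := by
  have hD : EnergyTame fun _ : Unit => M.energy α := M.energyTame_energy.slice α
  have hz := M.coord c
  have hshift := M.energy_shift α c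
  have hmean0 : ∀ i₃, mean0 θ (M.energy α) (M.coordEnergy c) i₃
      = fun w => M.z c w * mean0 θ (M.energy α) (constEnergy (M.e c)) i₃ w := by
    intro i₃
    ext w
    simp only [mean0, coordEnergy, constEnergy, Finset.mul_sum]
    exact Finset.sum_congr rfl fun i₁ _ => Finset.sum_congr rfl fun i₂ _ => by ring
  rcases (M.one_le_lev c).eq_or_lt with hk | hk
  · have h1 : mean1 θ (M.energy α) (M.coordEnergy c)
        = fun w => α c * θ.β * baseCurv θ (M.energy α) (M.e c) w := by
      ext w
      simp only [mean1, hmean0, Phi1_mul_mean0 θ hD hz hshift hk.symm hr hm1, baseCurv,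
        Finset.mul_sum]
      exact Finset.sum_congr rfl fun i₃ _ => by ring
    rw [h1, iterPhi_const_mul, expTop_const_mul, ← hk]
    rfl
  -- A coordinate of level at least `2` is constant for all lower levels, so it is carried outside
  -- their averages and integrated by parts only at its own level.
  · obtain ⟨j, hj⟩ : ∃ j, M.lev c = j + 2 := ⟨M.lev c - 2, by omega⟩
    have hle := M.lev_le c
    have h1 : mean1 θ (M.energy α) (M.coordEnergy c)
        = fun w => M.z c w * mean1 θ (M.energy α) (constEnergy (M.e c)) w := by
      ext w
      simp only [mean1, hmean0, Phi1_mul_of_invariant θ _ (hz.invariant 1 le_rfl hk),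
        Finset.mul_sum]
      exact Finset.sum_congr rfl fun i₃ _ => by ring
    have h2 : iterPhi θ (M.energy α) 1 j (mean1 θ (M.energy α) (M.coordEnergy c))
        = fun w => M.z c w * meanLevel θ (M.energy α) (M.e c) j w := by
      rw [h1, iterPhi_mul_of_invariant θ 1 j fun k hk hk' => hz.invariant k (by omega) (by omega)]
      rfl
    have hm' : ∀ k ∈ Finset.Icc 1 (j + 1), θ.m k ≠ 0 := fun k hk =>
      hm k (Finset.Icc_subset_Icc_right (by omega) hk)
    -- At level `r + 1` the integrating expectation is `expTop`; at lower levels it is `Phi` of that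
    -- level, with further averages outside.
    rcases hle.eq_or_lt with hlr | hlr
    · have hrj : r = j + 1 := by omega
      have h3 := expTop_mul_meanLevel θ hD hz hshift hm1 j hrj hlr hmr hm'
      have h4 : r - 1 = j := by omega
      rw [h4, h2, h3, hj]
      simp only [levelAvg, hrj, Nat.sub_self]
      rfl
    · have h3 : Phi θ (M.energy α) (j + 2)
          (fun w => M.z c w * meanLevel θ (M.energy α) (M.e c) j w)
          = fun w => α c * θ.β * Phi θ (M.energy α) (j + 2) (curv θ (M.energy α) (M.e c) j) w :=
        funext fun w => Phi_mul_meanLevel θ hD hz hshift hm1 j hj (by omega) hm' w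
      have h4 : r - 1 = j + (1 + (r - (j + 2))) := by omega
      rw [h4, iterPhi_add, h2, iterPhi_add]
      have h5 : iterPhi θ (M.energy α) (1 + j) 1
          (fun w => M.z c w * meanLevel θ (M.energy α) (M.e c) j w)
          = fun w => α c * θ.β
            * iterPhi θ (M.energy α) (1 + j) 1 (curv θ (M.energy α) (M.e c) j) w := by
        simp only [iterPhi, show 1 + j + 0 + 1 = j + 2 by ring]
        exact h3
      rw [h5, iterPhi_const_mul, expTop_const_mul, hj, ← iterPhi_add]
      simp only [levelAvg, show r - (j + 1) = 1 + (r - (j + 2)) by omega, add_comm 1 j]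

/-- The derivative of `log ζ_r` is the average of the velocity `∑ c, α₁ c * z c * e c`, and
integration by parts replaces each `z c` by its coefficient. The resulting form `α c * W c` is the
input of `hasFDerivWithinAt_comp_sqrt`. -/
lemma hasDerivAt_freeEnergy (hr : 1 ≤ r) (hm1 : θ.m 1 = 1) (hmr : θ.m (r + 1) = 0)
    (hm : ∀ k ∈ Finset.Icc 1 r, θ.m k ≠ 0) (hp : θ.p ≠ 0) (α₀ α₁ : ι → ℝ) (τ : ℝ) :
    HasDerivAt (fun τ : ℝ => freeEnergy (n := n) r θ (M.energy (α₀ + τ • α₁)))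
      (∑ c, α₁ c * ((α₀ + τ • α₁) c * (θ.s * θ.β ^ 2 / (|θ.s| * √n)
        * levelAvg θ (M.energy (α₀ + τ • α₁)) r (M.e c) (M.lev c)))) τ := by
  obtain ⟨j, rfl⟩ : ∃ j, r = j + 1 := ⟨r - 1, by omega⟩
  have hE := M.energyDeriv_line α₀ α₁
  have h1 := (DTame.log (posTame_zeta θ hE.tame j)
    ((tame_iterPhi θ hE.tame 0 j (tame_mean1 θ hE.tame hE.tame')).const_mul _)
    (dTame_zeta θ hE j fun k hk => hm k (Finset.Icc_subset_Icc_right (by omega) hk))).const_mul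
      (1 / (θ.p * |θ.s| * Real.sqrt n * θ.m (j + 1)))
  refine ((h1.integral (resample_expTop (j + 1))).deriv τ 0).congr_deriv ?_
  set D := M.energy (α₀ + τ • α₁) with hDdef
  have hD : EnergyTame fun _ : Unit => D := M.energyTame_energy.slice _
  have hmj : θ.m (j + 1) ≠ 0 := hm (j + 1) (by simp)
  have hlin : mean1 θ D (fun w i₁ i₂ i₃ => ∑ c, α₁ c * M.coordEnergy c w i₁ i₂ i₃)
      = fun w => ∑ c, α₁ c * mean1 θ D (M.coordEnergy c) w := by
    have h0 : ∀ i₃, mean0 θ D (fun w i₁ i₂ i₃ => ∑ c, α₁ c * M.coordEnergy c w i₁ i₂ i₃) i₃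
        = fun w => ∑ c, α₁ c * mean0 θ D (M.coordEnergy c) i₃ w := by
      intro i₃
      ext w
      simp only [mean0, Finset.sum_mul, Finset.mul_sum]
      rw [(Finset.sum_congr rfl fun _ _ => Finset.sum_comm).trans Finset.sum_comm]
      exact Finset.sum_congr rfl fun c _ => Finset.sum_congr rfl fun i₁ _ =>
        Finset.sum_congr rfl fun i₂ _ => by ring
    ext w
    simp only [mean1, h0, Finset.mul_sum]
    rw [Finset.sum_comm]
    refine Finset.sum_congr rfl fun i₃ _ => ?_
    rw [Phi1_sum θ hD i₃ Finset.univ (F := fun c w => α₁ c * mean0 θ D (M.coordEnergy c) i₃ w)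
      fun c _ => (tame_mean0 θ hD (M.energyTame_coordEnergy c) i₃).const_mul _]
    simp only [Phi1_const_mul, Finset.mul_sum]
    exact Finset.sum_congr rfl fun c _ => by ring
  have hsum := expTop_iterPhi_sum θ (j + 1) hD 0 j Finset.univ α₁
    (F := fun c => mean1 θ D (M.coordEnergy c))
    fun c _ => tame_mean1 θ hD (M.energyTame_coordEnergy c)
  have hibp : ∀ c, expTop (j + 1) (iterPhi θ D 1 j (mean1 θ D (M.coordEnergy c)))
      = (α₀ + τ • α₁) c * θ.β * levelAvg θ D (j + 1) (M.e c) (M.lev c) := fun c =>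
    M.expTop_mean1_coordEnergy θ hr hm1 hmr hm (α₀ + τ • α₁) c
  have hgoal : expTop (j + 1) (fun w => 1 / (θ.p * |θ.s| * Real.sqrt n * θ.m (j + 1))
      * (θ.p * θ.s * θ.β * θ.m (j + 1) * iterPhi θ D (0 + 1) j
        (mean1 θ D (fun w i₁ i₂ i₃ => ∑ c, α₁ c * M.coordEnergy c w i₁ i₂ i₃)) w))
      = ∑ c, α₁ c * ((α₀ + τ • α₁) c * (θ.s * θ.β ^ 2 / (|θ.s| * √n)
        * levelAvg θ D (j + 1) (M.e c) (M.lev c))) := by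
    rw [expTop_const_mul, expTop_const_mul, hlin, hsum, Finset.mul_sum, Finset.mul_sum]
    refine Finset.sum_congr rfl fun c _ => ?_
    rw [zero_add, hibp]
    field_simp
  exact hgoal

/-- The free energy is a differentiable function of the variances of the coordinates. -/
lemma hasFDerivWithinAt_freeEnergy (hr : 1 ≤ r) (hm1 : θ.m 1 = 1) (hmr : θ.m (r + 1) = 0)
    (hm : ∀ k ∈ Finset.Icc 1 r, θ.m k ≠ 0) (hp : θ.p ≠ 0) {v₀ : ι → ℝ} (hv₀ : ∀ c, 0 ≤ v₀ c) :
    HasFDerivWithinAt (fun v : ι → ℝ => freeEnergy (n := n) r θ (M.energy fun c => √(v c)))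
      (∑ c, (1 / 2 * (θ.s * θ.β ^ 2 / (|θ.s| * √n)
        * levelAvg θ (M.energy fun c => √(v₀ c)) r (M.e c) (M.lev c))) •
          ContinuousLinearMap.proj (R := ℝ) (φ := fun _ : ι => ℝ) c)
      {v | ∀ c, 0 ≤ v c} v₀ :=
  hasFDerivWithinAt_comp_sqrt (f := fun α => freeEnergy (n := n) r θ (M.energy α))
    (W := fun c α => θ.s * θ.β ^ 2 / (|θ.s| * √n) * levelAvg θ (M.energy α) r (M.e c) (M.lev c))
    (fun c => continuous_const.mul (M.continuous_levelAvg θ (M.e c) (M.lev c)))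
    (M.hasDerivAt_freeEnergy θ hr hm1 hmr hm hp) hv₀

end LinModel

/-! ### Averages over two pairs of indices, and the signed averages `νₖ`. -/

/-- Functions of two pairs of indices. -/
abbrev PairFun (l : ℕ) : Type := Fin l → Fin l → Fin l → Fin l → ℝ

/-- A functional that averages with respect to a probability vector. -/
def IsAverage {l : ℕ} (A : PairFun l → ℝ) : Prop :=
  ∃ W : Fin l × Fin l × Fin l × Fin l → ℝ, (∀ q, 0 ≤ W q) ∧ ∑ q, W q = 1 ∧
    ∀ F : PairFun l, A F = ∑ q, F q.1 q.2.1 q.2.2.1 q.2.2.2 * W q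

namespace IsAverage

variable {l : ℕ} {A : PairFun l → ℝ} (hA : IsAverage A)
include hA

lemma sum {ι : Type*} (s : Finset ι) (b : ι → ℝ) (F : ι → PairFun l) :
    A (fun i₁ i₂ p₁ p₂ => ∑ c ∈ s, b c * F c i₁ i₂ p₁ p₂) = ∑ c ∈ s, b c * A (F c) := by
  obtain ⟨W, -, -, hW⟩ := hA
  simp only [hW, Finset.sum_mul, Finset.mul_sum]
  rw [Finset.sum_comm]
  exact Finset.sum_congr rfl fun _ _ => Finset.sum_congr rfl fun _ _ => by ring

lemma add (F G : PairFun l) :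
    A (fun i₁ i₂ p₁ p₂ => F i₁ i₂ p₁ p₂ + G i₁ i₂ p₁ p₂) = A F + A G := by
  obtain ⟨W, -, -, hW⟩ := hA
  simp only [hW, add_mul, Finset.sum_add_distrib]

lemma const_mul (b : ℝ) (F : PairFun l) :
    A (fun i₁ i₂ p₁ p₂ => b * F i₁ i₂ p₁ p₂) = b * A F := by
  obtain ⟨W, -, -, hW⟩ := hA
  simp only [hW, mul_assoc, Finset.mul_sum]

lemma const (b : ℝ) : A (fun _ _ _ _ => b) = b := by
  obtain ⟨W, -, h1, hW⟩ := hA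
  rw [hW, ← Finset.mul_sum, h1, mul_one]

lemma mono {F G : PairFun l} (h : ∀ i₁ i₂ p₁ p₂, F i₁ i₂ p₁ p₂ ≤ G i₁ i₂ p₁ p₂) : A F ≤ A G := by
  obtain ⟨W, h0, -, hW⟩ := hA
  rw [hW, hW]
  exact Finset.sum_le_sum fun q _ => mul_le_mul_of_nonneg_right (h _ _ _ _) (h0 q)

lemma abs_le {F G : PairFun l} (h : ∀ i₁ i₂ p₁ p₂, |F i₁ i₂ p₁ p₂| ≤ G i₁ i₂ p₁ p₂) :
    |A F| ≤ A G := by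
  refine _root_.abs_le.2 ⟨?_, hA.mono fun i₁ i₂ p₁ p₂ => (le_abs_self _).trans (h i₁ i₂ p₁ p₂)⟩
  have h1 := hA.const_mul (-1) G
  rw [neg_one_mul] at h1
  rw [← h1]
  exact hA.mono fun i₁ i₂ p₁ p₂ => by linarith [neg_abs_le (F i₁ i₂ p₁ p₂), h i₁ i₂ p₁ p₂]

end IsAverage

section Averages

variable {n : ℕ} (r : ℕ) (S : Data n) (θ : Params) [Nonempty (Fin S.l)]
  (hD : EnergyTame fun _ : Unit => D0 r S θ)
include hD

lemma isAverage_avg_one : IsAverage (avg r S θ 1) := by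
  have ht : ∀ q : Fin S.l × Fin S.l × Fin S.l × Fin S.l, Tame fun _ : Unit => fun w =>
      ∑ i₃, gamma1 r θ (D0 r S θ) q.1 q.2.1 q.2.2.1 q.2.2.2 i₃ w := fun q =>
    .sum _ fun i₃ _ => tame_gamma1 θ hD r _ _ _ _ i₃
  refine ⟨fun q => expTop r fun w =>
    ∑ i₃, gamma1 r θ (D0 r S θ) q.1 q.2.1 q.2.2.1 q.2.2.2 i₃ w, fun q => ?_, ?_, fun F => ?_⟩
  · refine integral_nonneg fun z => Finset.sum_nonneg fun i₃ _ => ?_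
    exact iterPhi_nonneg θ hD 0 (r - 1) (fun w => mul_nonneg
      ((posTame_gamma00 θ hD i₃).pos () w).le (Phi1_nonneg θ hD i₃ (fun w => mul_nonneg
        ((posTame_gamma0 θ hD _ _ i₃).pos () w).le ((posTame_gamma0 θ hD _ _ i₃).pos () w).le) w)) _
  · rw [← expTop_sum r Finset.univ fun q _ => ht q]
    simp only [Fintype.sum_prod_type, sum_gamma1 θ hD, expTop_const]
  · have h := expTop_sum r Finset.univ fun q _ => (ht q).const_mul (F q.1 q.2.1 q.2.2.1 q.2.2.2)
    simp only [expTop_const_mul] at h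
    rw [← h]
    simp only [Fintype.sum_prod_type, Finset.mul_sum, avg]

lemma isAverage_avg {k : ℕ} (hk : 1 ≤ k) : IsAverage (avg r S θ (k + 1)) := by
  have ht : ∀ q : Fin S.l × Fin S.l × Fin S.l × Fin S.l, Tame fun _ : Unit => fun w =>
      ∑ i₃, ∑ p₃, gammaPair r θ (D0 r S θ) k q.1 q.2.1 q.2.2.1 q.2.2.2 i₃ p₃ w := fun q =>
    .sum _ fun i₃ _ => .sum _ fun p₃ _ => tame_gammaPair θ hD hk r _ _ _ _ i₃ p₃
  refine ⟨fun q => expTop r fun w =>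
    ∑ i₃, ∑ p₃, gammaPair r θ (D0 r S θ) k q.1 q.2.1 q.2.2.1 q.2.2.2 i₃ p₃ w,
    fun q => ?_, ?_, fun F => ?_⟩
  · exact integral_nonneg fun z => Finset.sum_nonneg fun i₃ _ => Finset.sum_nonneg fun p₃ _ =>
      gammaPair_nonneg θ hD hk r _ _ _ _ i₃ p₃ _
  · rw [← expTop_sum r Finset.univ fun q _ => ht q]
    -- The total mass is the quadratic form at the constant direction `1`, whose level means are all
    -- `1`.
    have h1 := fun w => sum_gammaPair θ hD hk r (fun _ _ => 1) w
    obtain ⟨k, rfl⟩ := Nat.exists_eq_add_of_le' hk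
    simp only [one_mul, meanLevel_one θ hD, one_pow, iterPhi_one θ hD] at h1
    simp only [Fintype.sum_prod_type, h1, expTop_const]
  · have h := expTop_sum r Finset.univ fun q _ => (ht q).const_mul (F q.1 q.2.1 q.2.2.1 q.2.2.2)
    simp only [expTop_const_mul] at h
    rw [← h]
    obtain ⟨k, rfl⟩ := Nat.exists_eq_add_of_le' hk
    simp only [Fintype.sum_prod_type, Finset.mul_sum, avg]

lemma isAverage_avg22 : IsAverage (avg22 r S θ) := by
  have ht : ∀ q : Fin S.l × Fin S.l × Fin S.l × Fin S.l, Tame fun _ : Unit => fun w =>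
      ∑ i₃, gamma22 r θ (D0 r S θ) q.1 q.2.1 q.2.2.1 q.2.2.2 i₃ w := fun q =>
    .sum _ fun i₃ _ => tame_gamma22 θ hD r _ _ _ _ i₃
  refine ⟨fun q => expTop r fun w =>
    ∑ i₃, gamma22 r θ (D0 r S θ) q.1 q.2.1 q.2.2.1 q.2.2.2 i₃ w, fun q => ?_, ?_, fun F => ?_⟩
  · exact integral_nonneg fun z => Finset.sum_nonneg fun i₃ _ =>
      gamma22_nonneg θ hD r _ _ _ _ i₃ _
  · rw [← expTop_sum r Finset.univ fun q _ => ht q]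
    have h1 := fun w => sum_gamma22 θ hD r (fun _ _ => 1) w
    simp only [one_mul, mean0_constEnergy_one θ hD, Phi1_one θ hD, one_pow, mul_one,
      sum_gamma00 θ hD, iterPhi_one θ hD 0] at h1
    simp only [Fintype.sum_prod_type, h1, expTop_const]
  · have h := expTop_sum r Finset.univ fun q _ => (ht q).const_mul (F q.1 q.2.1 q.2.2.1 q.2.2.2)
    simp only [expTop_const_mul] at h
    rw [← h]
    simp only [Fintype.sum_prod_type, Finset.mul_sum, avg22]

omit [Nonempty (Fin S.l)] hD in
/-- The signed average `νₖ`. -/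
def nu (k : ℕ) (F : PairFun S.l) : ℝ :=
  (θ.m k - θ.m (k + 1)) * θ.p * avg r S θ (k + 1) F
    + if k = 1 then θ.m 1 * (1 - θ.p) * avg22 r S θ F else 0

lemma nu_sum {k : ℕ} (hk : 1 ≤ k) {ι : Type*} (s : Finset ι) (b : ι → ℝ) (F : ι → PairFun S.l) :
    nu r S θ k (fun i₁ i₂ p₁ p₂ => ∑ c ∈ s, b c * F c i₁ i₂ p₁ p₂)
      = ∑ c ∈ s, b c * nu r S θ k (F c) := by
  unfold nu
  rw [(isAverage_avg r S θ hD hk).sum, (isAverage_avg22 r S θ hD).sum]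
  simp only [mul_add, Finset.sum_add_distrib]
  congr 1
  · rw [Finset.mul_sum]
    exact Finset.sum_congr rfl fun c _ => by ring
  · split_ifs
    · rw [Finset.mul_sum]
      exact Finset.sum_congr rfl fun c _ => by ring
    · simp

lemma nu_add {k : ℕ} (hk : 1 ≤ k) (F G : PairFun S.l) :
    nu r S θ k (fun i₁ i₂ p₁ p₂ => F i₁ i₂ p₁ p₂ + G i₁ i₂ p₁ p₂)
      = nu r S θ k F + nu r S θ k G := by
  unfold nu
  rw [(isAverage_avg r S θ hD hk).add, (isAverage_avg22 r S θ hD).add]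
  split_ifs <;> ring

lemma nu_const_mul {k : ℕ} (hk : 1 ≤ k) (b : ℝ) (F : PairFun S.l) :
    nu r S θ k (fun i₁ i₂ p₁ p₂ => b * F i₁ i₂ p₁ p₂) = b * nu r S θ k F := by
  unfold nu
  rw [(isAverage_avg r S θ hD hk).const_mul, (isAverage_avg22 r S θ hD).const_mul]
  split_ifs <;> ring

/-- For `k = 1` the `γ₂₂` part completes `(m 1 - m 2) p` to `m 1 - m 2 p`. These masses are the
coefficients that summation by parts produces in the correction of `ψ₁`. -/
lemma nu_const {k : ℕ} (hk : 1 ≤ k) (b : ℝ) :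
    nu r S θ k (fun _ _ _ _ => b)
      = b * (θ.m k * omega k θ.p - θ.m (k + 1) * omega (k + 1) θ.p) := by
  unfold nu
  rw [(isAverage_avg r S θ hD hk).const, (isAverage_avg22 r S θ hD).const]
  have : k + 1 ≠ 1 := by omega
  unfold omega
  rw [if_neg this]
  split_ifs with h
  · subst h
    ring
  · ring

/-- The coefficients of the squares lost at level `k` are `s` times those of `νₖ`; for `k = 1` the
match of the `γ₂₂` part uses `m 1 = 1`. -/
lemma lossAvg_eq {k : ℕ} (hk : 1 ≤ k) (hm1 : θ.m 1 = 1) (e : Fin S.l → Fin S.l → ℝ) :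
    lossAvg θ (D0 r S θ) r e k
      = θ.s * nu r S θ k fun i₁ i₂ p₁ p₂ => e i₁ i₂ * e p₁ p₂ := by
  have h1 := fun w => sum_gammaPair θ hD hk r e w
  have havg : avg r S θ (k + 1) (fun i₁ i₂ p₁ p₂ => e i₁ i₂ * e p₁ p₂)
      = expTop r (iterPhi θ (D0 r S θ) k (r - k)
        fun w => meanLevel θ (D0 r S θ) e (k - 1) w ^ 2) := by
    obtain ⟨k, rfl⟩ := Nat.exists_eq_add_of_le' hk
    simp only [avg, h1]
  rcases k with _ | _ | j
  · omega
  · have h2 := fun w => sum_gamma22 θ hD r e w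
    have havg22 : avg22 r S θ (fun i₁ i₂ p₁ p₂ => e i₁ i₂ * e p₁ p₂)
        = expTop r (iterPhi θ (D0 r S θ) 1 (r - 1) fun w => ∑ i₃, gamma00 θ (D0 r S θ) i₃ w
          * Phi1 θ (D0 r S θ) i₃ (mean0 θ (D0 r S θ) (constEnergy e) i₃) w ^ 2) := by
      simp only [avg22, h2]
    have h3 := expTop_iterPhi_sum θ r hD 0 (r - 1) (Finset.univ : Finset (Fin 2))
      ![(1 - θ.p) * θ.s, θ.p * θ.s * (θ.m 1 - θ.m 2)]
      (F := ![fun w => ∑ i₃, gamma00 θ (D0 r S θ) i₃ w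
          * Phi1 θ (D0 r S θ) i₃ (mean0 θ (D0 r S θ) (constEnergy e) i₃) w ^ 2,
        fun w => meanLevel θ (D0 r S θ) e 0 w ^ 2]) (by
          intro i _
          fin_cases i
          exacts [tame_sum_Phi1_sq θ e hD, (tame_meanLevel θ hD e 0).pow 2])
    simp only [Fin.sum_univ_two, Matrix.cons_val_zero, Matrix.cons_val_one, zero_add] at h3
    simp only [zero_add, lossAvg, loss, nu, if_true] at havg ⊢
    rw [h3, havg, havg22, hm1]
    ring
  · simp only [lossAvg, loss, iterPhi_const_mul, expTop_const_mul, nu,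
      show j + 1 + 1 = j + 2 from rfl] at havg ⊢
    rw [havg, if_neg (by omega)]
    simp only [show j + 2 - 1 = j + 1 from rfl]
    ring

end Averages

/-! ### The energy `D0` as a linear Gaussian model, with its variances. -/

section Model

variable {n : ℕ} (r : ℕ) (S : Data n)

/-- The scalar Gaussian coordinates: the entries of `G`, and those of the `𝒰ₖ`. -/
abbrev Coord (n d r : ℕ) : Type := (Fin d × Fin n) ⊕ (Fin (r + 1) × (Unit ⊕ (Fin d ⊕ Fin n)))

/-- The energies of the model, as linear functions of the Gaussian coordinates. -/
def dataModel : LinModel n S.d S.l r (Coord n S.d r) where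
  base i₁ i₃ := S.f (S.xbar i₃) (S.x i₁)
  z
    | .inl (j, i) => fun w => w.1 j i
    | .inr (k, .inl _) => fun w => (w.2 (k + 1)).1
    | .inr (k, .inr (.inl j)) => fun w => (w.2 (k + 1)).2.1 j
    | .inr (k, .inr (.inr i)) => fun w => (w.2 (k + 1)).2.2 i
  δ
    | .inl (j, i) => (Pi.single j (Pi.single i 1), 0)
    | .inr (k, .inl _) => (0, Pi.single (k + 1) (1, 0))
    | .inr (k, .inr (.inl j)) => (0, Pi.single (k + 1) (0, Pi.single j 1, 0))
    | .inr (k, .inr (.inr i)) => (0, Pi.single (k + 1) (0, 0, Pi.single i 1))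
  lev
    | .inl _ => r + 1
    | .inr (k, _) => k + 1
  e
    | .inl (j, i) => fun i₁ i₂ => S.y i₂ j * S.x i₁ i
    | .inr (_, .inl _) => fun _ _ => 1
    | .inr (_, .inr (.inl j)) => fun _ i₂ => S.y i₂ j
    | .inr (_, .inr (.inr i)) => fun i₁ _ => S.x i₁ i
  one_le_lev c := by rcases c with _ | ⟨k, _⟩ <;> simp
  lev_le c := by
    rcases c with _ | ⟨k, _⟩
    · exact le_rfl
    · exact Nat.succ_le_of_lt k.2
  coord c := by
    rcases c with ⟨j, i⟩ | ⟨k, _ | j | i⟩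
    · exact .of_gaussG (gaussIBP_gaussG j i)
    · exact .of_gaussU (by simp) k.2 gaussIBP_gaussU_fst
    · exact .of_gaussU (by simp) k.2 (gaussIBP_gaussU_snd j)
    · exact .of_gaussU (by simp) k.2 (gaussIBP_gaussU_trd i)
  shift c c' w τ := by
    rcases c with ⟨j, i⟩ | ⟨k, _ | j | i⟩ <;> rcases c' with ⟨j', i'⟩ | ⟨k', _ | j' | i'⟩ <;>
      simp [Pi.single_apply, apply_ite, ite_and, Fin.ext_iff] <;>
      split_ifs <;> simp_all [Pi.single_apply, Fin.ext_iff]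

end Model

lemma sum_Icc_one_eq_sum_fin (r : ℕ) (f : ℕ → ℝ) :
    ∑ k ∈ Finset.Icc 1 (r + 1), f k = ∑ k : Fin (r + 1), f (k + 1) := by
  rw [Fin.sum_univ_eq_sum_range fun k => f (k + 1), Finset.range_eq_Ico, Finset.sum_Ico_add']
  rfl

section Energy

variable {n : ℕ} (r : ℕ) (S : Data n) (θ : Params)

/-- The variances of the Gaussian coordinates. -/
def coordVar (d : ℕ) : Coord n d r → ℝ
  | .inl _ => θ.t
  | .inr (k, .inl _) => θ.t * (θ.P k * θ.Q k - θ.P (k + 1) * θ.Q (k + 1))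
  | .inr (k, .inr (.inl _)) => (1 - θ.t) * (θ.P k - θ.P (k + 1))
  | .inr (k, .inr (.inr _)) => (1 - θ.t) * (θ.Q k - θ.Q (k + 1))

variable {S} in
-- Unit norms remove the norm factors, and `√t √x = √(t x)` needs only `0 ≤ t`. The index `k : Fin
-- (r + 1)` stands for level `k + 1`, so its increments run from `k` to `k + 1`.
lemma D0_eq_energy (hx : ∀ i, ‖S.x i‖ = 1) (hy : ∀ i, ‖S.y i‖ = 1) (ht : θ.t ∈ Icc (0 : ℝ) 1) :
    D0 r S θ = (dataModel r S).energy fun c => √(coordVar r θ S.d c) := by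
  ext w i₁ i₂ i₃
  simp only [D0, D0S, LinModel.energy, dataModel, coordVar, hx, hy, Fintype.sum_sum_type,
    Fintype.sum_prod_type, Params.a, Params.b, Params.c, sum_Icc_one_eq_sum_fin, mul_one,
    Real.sqrt_mul ht.1, Real.sqrt_mul (sub_nonneg.2 ht.2), Finset.univ_unique, Finset.sum_singleton,
    Finset.sum_add_distrib, Nat.add_sub_cancel]
  have e1 : √θ.t * ∑ j, S.y i₂ j * ∑ i, w.1 j i * S.x i₁ i
      = ∑ j, ∑ i, √θ.t * (w.1 j i * (S.y i₂ j * S.x i₁ i)) := by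
    simp only [Finset.mul_sum]
    exact Finset.sum_congr rfl fun _ _ => Finset.sum_congr rfl fun _ _ => by ring
  have e2 : √(1 - θ.t) * ∑ j, S.y i₂ j * ∑ k : Fin (r + 1),
        √(θ.P k - θ.P (k + 1)) * (w.2 (k + 1)).2.1 j
      = ∑ k : Fin (r + 1), ∑ j, √(1 - θ.t) * √(θ.P k - θ.P (k + 1))
        * ((w.2 (k + 1)).2.1 j * S.y i₂ j) := by
    simp only [Finset.mul_sum]
    rw [Finset.sum_comm]
    exact Finset.sum_congr rfl fun _ _ => Finset.sum_congr rfl fun _ _ => by ring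
  have e3 : √(1 - θ.t) * ∑ i, (∑ k : Fin (r + 1),
        √(θ.Q k - θ.Q (k + 1)) * (w.2 (k + 1)).2.2 i) * S.x i₁ i
      = ∑ k : Fin (r + 1), ∑ i, √(1 - θ.t) * √(θ.Q k - θ.Q (k + 1))
        * ((w.2 (k + 1)).2.2 i * S.x i₁ i) := by
    simp only [Finset.mul_sum, Finset.sum_mul]
    rw [Finset.sum_comm]
    exact Finset.sum_congr rfl fun _ _ => Finset.sum_congr rfl fun _ _ => by ring
  have e4 : √θ.t * ∑ k : Fin (r + 1), √(θ.P k * θ.Q k - θ.P (k + 1) * θ.Q (k + 1))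
        * (w.2 (k + 1)).1
      = ∑ k : Fin (r + 1), √θ.t * √(θ.P k * θ.Q k - θ.P (k + 1) * θ.Q (k + 1))
        * (w.2 (k + 1)).1 := by
    rw [Finset.mul_sum]
    exact Finset.sum_congr rfl fun _ _ => by ring
  rw [e1, e2, e3, e4]
  ring

variable {S θ} in
lemma energyTame_D0 (hx : ∀ i, ‖S.x i‖ = 1) (hy : ∀ i, ‖S.y i‖ = 1) (ht : θ.t ∈ Icc (0 : ℝ) 1) :
    EnergyTame fun _ : Unit => D0 r S θ := by
  rw [D0_eq_energy r θ hx hy ht]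
  exact (dataModel r S).energyTame_energy.slice _

end Energy

section Congr

variable {n d l : ℕ} (r : ℕ) {θ θ' : Params} (D : Energy n d l)

lemma zeta_congr (hβ : θ.β = θ'.β) (hp : θ.p = θ'.p) (hs : θ.s = θ'.s) (hm : θ.m = θ'.m) (k : ℕ) :
    zeta θ D k = zeta θ' D k := by
  match k with
  | 0 => rfl
  | 1 =>
    ext w
    simp only [zeta, EZ, Zfun, Cfun, Afun, hβ, hp, hs, hm]
  | k + 2 =>
    ext w
    simp only [zeta, hm, zeta_congr hβ hp hs hm (k + 1)]

/-- Along a path the scalar parameters can thus be frozen, and only the energy moves. -/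
lemma freeEnergy_congr (hβ : θ.β = θ'.β) (hp : θ.p = θ'.p) (hs : θ.s = θ'.s) (hm : θ.m = θ'.m) :
    freeEnergy (n := n) r θ D = freeEnergy (n := n) r θ' D := by
  simp only [freeEnergy, zeta_congr D hβ hp hs hm, hp, hs, hm]

end Congr

section Ordered

variable {r : ℕ} {v : ℕ → ℝ} (h : Ordered r v)
include h

lemma Ordered.succ_le {k : ℕ} (hk : k ≤ r) : v (k + 1) ≤ v k := by
  simpa using h.2.2 (k + 1) (Finset.mem_Icc.2 ⟨by omega, by omega⟩)

lemma Ordered.mem_Icc {k : ℕ} (hk : k ≤ r + 1) : v k ∈ Icc (0 : ℝ) 1 := by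
  constructor
  · have : ∀ j ≤ r + 1, 0 ≤ v (r + 1 - j) := by
      intro j
      induction j with
      | zero => intro _; simp [h.2.1]
      | succ j ih =>
        intro hj
        have h1 := h.succ_le (k := r + 1 - (j + 1)) (by omega)
        rw [show r + 1 - (j + 1) + 1 = r + 1 - j by omega] at h1
        exact (ih (by omega)).trans h1
    simpa [Nat.sub_sub_self hk] using this (r + 1 - k) (by omega)
  · induction k with
    | zero => exact h.1.le
    | succ k ih => exact (h.succ_le (by omega)).trans (ih (by omega))

end Ordered

lemma coordVar_nonneg {n d r : ℕ} {θ : Params} (hP : Ordered r θ.P) (hQ : Ordered r θ.Q)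
    (ht : θ.t ∈ Icc (0 : ℝ) 1) (c : Coord n d r) : 0 ≤ coordVar r θ d c := by
  rcases c with _ | ⟨k, _ | _ | _⟩
  · exact ht.1
  · have hk : (k : ℕ) ≤ r := Nat.lt_succ_iff.1 k.2
    refine mul_nonneg ht.1 (sub_nonneg.2 ?_)
    exact mul_le_mul (hP.succ_le hk) (hQ.succ_le hk) (hQ.mem_Icc (by omega)).1
      (hP.mem_Icc (by omega)).1
  · have hk : (k : ℕ) ≤ r := Nat.lt_succ_iff.1 k.2
    exact mul_nonneg (sub_nonneg.2 ht.2) (sub_nonneg.2 (hP.succ_le hk))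
  · have hk : (k : ℕ) ≤ r := Nat.lt_succ_iff.1 k.2
    exact mul_nonneg (sub_nonneg.2 ht.2) (sub_nonneg.2 (hQ.succ_le hk))

/-! ### The derivative of the covariance, and of `ψ` along a path. -/

section Kernel

variable {n : ℕ} (r : ℕ) (S : Data n)

/-- The derivatives of the variances, from the derivatives `dP`, `dQ` of `𝐩`, `𝐪`. -/
def coordVarDeriv (θ : Params) (dP dQ : ℕ → ℝ) (d : ℕ) : Coord n d r → ℝ
  | .inl _ => 1
  | .inr (k, .inl _) => (θ.P k * θ.Q k + θ.t * (dP k * θ.Q k + θ.P k * dQ k))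
      - (θ.P (k + 1) * θ.Q (k + 1)
        + θ.t * (dP (k + 1) * θ.Q (k + 1) + θ.P (k + 1) * dQ (k + 1)))
  | .inr (k, .inr (.inl _)) => (-θ.P k + (1 - θ.t) * dP k)
      - (-θ.P (k + 1) + (1 - θ.t) * dP (k + 1))
  | .inr (k, .inr (.inr _)) => (-θ.Q k + (1 - θ.t) * dQ k)
      - (-θ.Q (k + 1) + (1 - θ.t) * dQ (k + 1))

lemma sum_telescope_from (g : ℕ → ℝ) {i : ℕ} (hi : i ≤ r + 1) :
    ∑ k : Fin (r + 1), (if i < (k : ℕ) + 1 then g k - g (k + 1) else 0) = g i - g (r + 1) := by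
  rw [Fin.sum_univ_eq_sum_range (fun k => if i < k + 1 then g k - g (k + 1) else 0)]
  induction r with
  | zero =>
    rcases Nat.le_one_iff_eq_zero_or_eq_one.1 hi with rfl | rfl <;> simp
  | succ r ih =>
    rw [Finset.sum_range_succ]
    rcases hi.eq_or_lt with rfl | h
    · rw [Finset.sum_eq_zero, if_neg (by omega)]
      · simp
      · intro k hk
        rw [Finset.mem_range] at hk
        rw [if_neg (by omega)]
    · rw [ih (by omega), if_pos (by omega)]
      ring

/-- The derivative of the covariance of the levels above `i`. -/
lemma sum_coordVarDeriv {θ : Params} {dP dQ : ℕ → ℝ} (hP : θ.P (r + 1) = 0) (hQ : θ.Q (r + 1) = 0)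
    (hdP : dP (r + 1) = 0) (hdQ : dQ (r + 1) = 0) {i : ℕ} (hi : i ≤ r) (i₁ i₂ p₁ p₂ : Fin S.l) :
    ∑ c, (if i < (dataModel r S).lev c then coordVarDeriv r θ dP dQ S.d c else 0)
        * ((dataModel r S).e c i₁ i₂ * (dataModel r S).e c p₁ p₂)
      = (θ.P i - inner ℝ (S.x p₁) (S.x i₁)) * (θ.Q i - inner ℝ (S.y p₂) (S.y i₂))
        + (dP i * (θ.t * θ.Q i + (1 - θ.t) * inner ℝ (S.y p₂) (S.y i₂))
          + dQ i * (θ.t * θ.P i + (1 - θ.t) * inner ℝ (S.x p₁) (S.x i₁))) := by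
  have hX : (inner ℝ (S.x p₁) (S.x i₁) : ℝ) = ∑ j, S.x i₁ j * S.x p₁ j := by
    simp [PiLp.inner_apply]
  have hY : (inner ℝ (S.y p₂) (S.y i₂) : ℝ) = ∑ j, S.y i₂ j * S.y p₂ j := by
    simp [PiLp.inner_apply]
  -- The variances above level `i` telescope to their value at `i`, since the value at `r + 1` is
  -- zero. The result is the derivative of `t (X Y + 𝐩ᵢ 𝐪ᵢ) + (1 - t) (𝐩ᵢ Y + 𝐪ᵢ X)`.
  have t1 := sum_telescope_from r
    (fun k => θ.P k * θ.Q k + θ.t * (dP k * θ.Q k + θ.P k * dQ k)) (hi.trans (Nat.le_succ r))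
  have t2 := sum_telescope_from r
    (fun k => -θ.P k + (1 - θ.t) * dP k) (hi.trans (Nat.le_succ r))
  have t3 := sum_telescope_from r
    (fun k => -θ.Q k + (1 - θ.t) * dQ k) (hi.trans (Nat.le_succ r))
  simp only [hP, hQ, hdP, hdQ] at t1 t2 t3
  have e1 : ∑ j, ∑ j', S.y i₂ j * S.x i₁ j' * (S.y p₂ j * S.x p₁ j')
      = (∑ j, S.y i₂ j * S.y p₂ j) * ∑ j', S.x i₁ j' * S.x p₁ j' := by
    rw [Finset.sum_mul_sum]
    exact Finset.sum_congr rfl fun _ _ => Finset.sum_congr rfl fun _ _ => by ring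
  have f1 : ∑ k : Fin (r + 1), (if i < (k : ℕ) + 1 then
        coordVarDeriv r θ dP dQ S.d (.inr (k, .inl ()) : Coord n S.d r) else 0) * (1 * 1)
      = θ.P i * θ.Q i + θ.t * (dP i * θ.Q i + θ.P i * dQ i) := by
    simp only [mul_one]
    exact t1.trans (by ring)
  have f2 : ∑ k : Fin (r + 1), ∑ j, (if i < (k : ℕ) + 1 then
        coordVarDeriv r θ dP dQ S.d (.inr (k, .inr (.inl j)) : Coord n S.d r) else 0)
          * (S.y i₂ j * S.y p₂ j)
      = (-θ.P i + (1 - θ.t) * dP i) * ∑ j, S.y i₂ j * S.y p₂ j := by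
    simp only [← Finset.mul_sum, coordVarDeriv, ← Finset.sum_mul]
    rw [t2]
    ring
  have f3 : ∑ k : Fin (r + 1), ∑ j, (if i < (k : ℕ) + 1 then
        coordVarDeriv r θ dP dQ S.d (.inr (k, .inr (.inr j)) : Coord n S.d r) else 0)
          * (S.x i₁ j * S.x p₁ j)
      = (-θ.Q i + (1 - θ.t) * dQ i) * ∑ j, S.x i₁ j * S.x p₁ j := by
    simp only [← Finset.mul_sum, coordVarDeriv, ← Finset.sum_mul]
    rw [t3]
    ring
  have f0 : ∑ j, ∑ j', (if i < r + 1 then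
        coordVarDeriv r θ dP dQ S.d (.inl (j, j') : Coord n S.d r) else 0)
          * (S.y i₂ j * S.x i₁ j' * (S.y p₂ j * S.x p₁ j'))
      = (∑ j, S.y i₂ j * S.y p₂ j) * ∑ j', S.x i₁ j' * S.x p₁ j' := by
    simp only [if_pos (Nat.lt_succ_of_le hi), coordVarDeriv, one_mul]
    exact e1
  rw [hX, hY]
  simp only [Fintype.sum_sum_type, Fintype.sum_prod_type, Finset.sum_add_distrib,
    Finset.univ_unique, Finset.sum_singleton]
  simp only [dataModel]
  refine (congrArg₂ (· + ·) f0 (congrArg₂ (· + ·) f1 (congrArg₂ (· + ·) f2 f3))).trans ?_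
  ring

end Kernel

section Derivative

variable {n : ℕ} {r : ℕ} {S : Data n} [Nonempty (Fin S.l)]

lemma pref_eq (θ : Params) : pref n θ = |θ.s| * θ.β ^ 2 / (2 * √n) := by
  unfold pref
  rcases lt_trichotomy θ.s 0 with h | h | h
  · rw [Real.sign_of_neg h, abs_of_neg h]
    ring
  · simp [h]
  · rw [Real.sign_of_pos h, abs_of_pos h]
    ring

/-- The derivative of `ψ` along a path, in terms of the averages `νₖ`. -/
lemma hasDerivWithinAt_psi (hr : 1 ≤ r) (hx : ∀ i, ‖S.x i‖ = 1) (hy : ∀ i, ‖S.y i‖ = 1)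
    {m : ℕ → ℝ} (hm : Admissible r m) {θ : ℝ → Params} {β p s : ℝ} {P Q : ℝ → ℕ → ℝ}
    (hθ : ∀ t, θ t = ⟨β, p, s, t, m, P t, Q t⟩) (hp : p ≠ 0) (hs : s ≠ 0)
    (hP : ∀ t ∈ Icc (0 : ℝ) 1, Ordered r (P t)) (hQ : ∀ t ∈ Icc (0 : ℝ) 1, Ordered r (Q t))
    {t : ℝ} (ht : t ∈ Icc (0 : ℝ) 1) {dP dQ : ℕ → ℝ}
    (hPd : ∀ k ≤ r + 1, HasDerivWithinAt (fun t => P t k) (dP k) (Icc 0 1) t)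
    (hQd : ∀ k ≤ r + 1, HasDerivWithinAt (fun t => Q t k) (dQ k) (Icc 0 1) t)
    (hdP0 : dP 0 = 0) (hdQ0 : dQ 0 = 0) (hdP : dP (r + 1) = 0) (hdQ : dQ (r + 1) = 0) :
    HasDerivWithinAt (fun τ => psi r S (θ τ))
      (-pref n (θ t) * ∑ k ∈ Finset.Icc 1 r, nu r S (θ t) k fun i₁ i₂ p₁ p₂ =>
        (P t k - inner ℝ (S.x p₁) (S.x i₁)) * (Q t k - inner ℝ (S.y p₂) (S.y i₂))
        + (dP k * (t * Q t k + (1 - t) * inner ℝ (S.y p₂) (S.y i₂))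
          + dQ k * (t * P t k + (1 - t) * inner ℝ (S.x p₁) (S.x i₁)))) (Icc 0 1) t := by
  set M := dataModel r S with hM
  have hβt : ∀ τ, (θ τ).β = β := fun τ => by rw [hθ]
  have hpt : ∀ τ, (θ τ).p = p := fun τ => by rw [hθ]
  have hst : ∀ τ, (θ τ).s = s := fun τ => by rw [hθ]
  have hmt : ∀ τ, (θ τ).m = m := fun τ => by rw [hθ]
  have htt : ∀ τ, (θ τ).t = τ := fun τ => by rw [hθ]
  have hPt : ∀ τ, (θ τ).P = P τ := fun τ => by rw [hθ]
  have hQt : ∀ τ, (θ τ).Q = Q τ := fun τ => by rw [hθ]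
  have hnn : ∀ τ ∈ Icc (0 : ℝ) 1, ∀ c, 0 ≤ coordVar (n := n) r (θ τ) S.d c := fun τ hτ c =>
    coordVar_nonneg (by rw [hPt]; exact hP τ hτ) (by rw [hQt]; exact hQ τ hτ)
      (by rw [htt]; exact hτ) c
  have hpsi : ∀ τ ∈ Icc (0 : ℝ) 1, psi r S (θ τ) = freeEnergy (n := n) r (θ t)
      (M.energy fun c => √(coordVar r (θ τ) S.d c)) := by
    intro τ hτ
    rw [psi, D0_eq_energy r (θ τ) hx hy (by rw [htt]; exact hτ)]
    exact freeEnergy_congr r _ (by rw [hβt, hβt]) (by rw [hpt, hpt]) (by rw [hst, hst])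
      (by rw [hmt, hmt])
  have hvar : HasDerivWithinAt (fun τ => coordVar (n := n) r (θ τ) S.d)
      (coordVarDeriv r (θ t) dP dQ S.d) (Icc 0 1) t := by
    have hid := hasDerivWithinAt_id t (Icc (0 : ℝ) 1)
    refine hasDerivWithinAt_pi.2 fun c => ?_
    rcases c with _ | ⟨k, _ | _ | _⟩
    · simp only [coordVar, coordVarDeriv, htt]
      exact hid
    · have hk : (k : ℕ) ≤ r := Nat.lt_succ_iff.1 k.2
      simp only [coordVar, coordVarDeriv, htt, hPt, hQt]
      refine (hid.mul (((hPd k (by omega)).mul (hQd k (by omega))).sub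
        ((hPd (k + 1) (by omega)).mul (hQd (k + 1) (by omega))))).congr_deriv ?_
      simp
      ring
    · have hk : (k : ℕ) ≤ r := Nat.lt_succ_iff.1 k.2
      simp only [coordVar, coordVarDeriv, htt, hPt]
      refine ((hid.const_sub 1).mul ((hPd k (by omega)).sub
        (hPd (k + 1) (by omega)))).congr_deriv ?_
      simp
      ring
    · have hk : (k : ℕ) ≤ r := Nat.lt_succ_iff.1 k.2
      simp only [coordVar, coordVarDeriv, htt, hQt]
      refine ((hid.const_sub 1).mul ((hQd k (by omega)).sub
        (hQd (k + 1) (by omega)))).congr_deriv ?_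
      simp
      ring
  have hF := M.hasFDerivWithinAt_freeEnergy (θ t) hr (by rw [hmt]; exact hm.2.1)
    (by rw [hmt]; exact hm.2.2.1) (by rw [hmt]; exact hm.2.2.2) (by rw [hpt]; exact hp) (hnn t ht)
  have hmaps : MapsTo (fun τ => coordVar (n := n) r (θ τ) S.d) (Icc 0 1) {v | ∀ c, 0 ≤ v c} :=
    fun τ hτ => hnn τ hτ
  refine ((hF.comp_hasDerivWithinAt t hvar hmaps).congr
    (fun τ hτ => hpsi τ hτ) (hpsi t ht)).congr_deriv ?_
  have ht' : (θ t).t ∈ Icc (0 : ℝ) 1 := by rw [htt]; exact ht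
  have hD : EnergyTame fun _ : Unit => D0 r S (θ t) := energyTame_D0 r hx hy ht'
  rw [← D0_eq_energy r (θ t) hx hy ht']
  have hP' := hP t ht
  have hQ' := hQ t ht
  have hker : ∀ i ≤ r, ∀ i₁ i₂ p₁ p₂,
      ∑ c, (if i < M.lev c then coordVarDeriv r (θ t) dP dQ S.d c else 0)
        * (M.e c i₁ i₂ * M.e c p₁ p₂)
      = (P t i - inner ℝ (S.x p₁) (S.x i₁)) * (Q t i - inner ℝ (S.y p₂) (S.y i₂))
        + (dP i * (t * Q t i + (1 - t) * inner ℝ (S.y p₂) (S.y i₂))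
          + dQ i * (t * P t i + (1 - t) * inner ℝ (S.x p₁) (S.x i₁))) := by
    intro i hi i₁ i₂ p₁ p₂
    have := sum_coordVarDeriv r S (θ := θ t) (dP := dP) (dQ := dQ) (by rw [hPt]; exact hP'.2.1)
      (by rw [hQt]; exact hQ'.2.1) hdP hdQ hi i₁ i₂ p₁ p₂
    rw [hPt, hQt, htt] at this
    exact this
  -- The kernel at `i = 0` vanishes for `p₁ = i₁`: there `X = ‖x‖² = 1 = 𝐩₀`, and `𝐩₀`, `𝐪₀` have
  -- zero derivative. By `sum_levelAvg_one` the innermost curvature then drops out.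
  have hbase : ∑ c, coordVarDeriv r (θ t) dP dQ S.d c * levelAvg (θ t) (D0 r S (θ t)) r (M.e c) 1
      = 0 := by
    refine sum_levelAvg_one (θ t) r hD Finset.univ _ _ fun i₁ i₂ p₂ => ?_
    have h0 := hker 0 (Nat.zero_le r) i₁ i₂ i₁ p₂
    simp only [Nat.pos_of_ne_zero (Nat.one_le_iff_ne_zero.1 (M.one_le_lev _)),
      if_true] at h0
    rw [h0, hdP0, hdQ0, hP'.1, hQ'.1, real_inner_self_eq_norm_sq, hx]
    ring
  have hlevel : ∀ c, levelAvg (θ t) (D0 r S (θ t)) r (M.e c) (M.lev c)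
      = levelAvg (θ t) (D0 r S (θ t)) r (M.e c) 1 - ∑ i ∈ Finset.Icc 1 r,
        if i < M.lev c then s * nu r S (θ t) i (fun i₁ i₂ p₁ p₂ => M.e c i₁ i₂ * M.e c p₁ p₂)
        else 0 := by
    intro c
    rw [levelAvg_eq (θ t) r (M.e c) hD (M.one_le_lev c) (M.lev_le c)]
    congr 1
    refine Finset.sum_congr rfl fun i hi => ?_
    rw [lossAvg_eq r S (θ t) hD (Finset.mem_Icc.1 hi).1 (by rw [hmt]; exact hm.2.1), hst]
  have hmain : ∑ c, coordVarDeriv r (θ t) dP dQ S.d c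
        * levelAvg (θ t) (D0 r S (θ t)) r (M.e c) (M.lev c)
      = -(s * ∑ k ∈ Finset.Icc 1 r, nu r S (θ t) k fun i₁ i₂ p₁ p₂ =>
        (P t k - inner ℝ (S.x p₁) (S.x i₁)) * (Q t k - inner ℝ (S.y p₂) (S.y i₂))
        + (dP k * (t * Q t k + (1 - t) * inner ℝ (S.y p₂) (S.y i₂))
          + dQ k * (t * P t k + (1 - t) * inner ℝ (S.x p₁) (S.x i₁)))) := by
    -- Only the losses remain; exchanging the sums tests `νᵢ` against the covariance derivative of
    -- the levels above `i`.
    have h0 : ∑ c, coordVarDeriv r (θ t) dP dQ S.d c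
          * levelAvg (θ t) (D0 r S (θ t)) r (M.e c) (M.lev c)
        = -∑ c, ∑ i ∈ Finset.Icc 1 r, coordVarDeriv r (θ t) dP dQ S.d c * if i < M.lev c then
          s * nu r S (θ t) i (fun i₁ i₂ p₁ p₂ => M.e c i₁ i₂ * M.e c p₁ p₂) else 0 := by
      refine eq_neg_of_add_eq_zero_left ((Finset.sum_add_distrib.symm.trans ?_).trans hbase)
      refine Finset.sum_congr rfl fun c _ => ?_
      rw [hlevel c, mul_sub, Finset.mul_sum, sub_add_cancel]
    rw [h0, Finset.sum_comm, Finset.mul_sum]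
    congr 1
    refine Finset.sum_congr rfl fun i hi => ?_
    have hi' := Finset.mem_Icc.1 hi
    have h1 := nu_sum r S (θ t) hD hi'.1 Finset.univ
      (fun c => if i < M.lev c then coordVarDeriv r (θ t) dP dQ S.d c else 0)
      (fun c i₁ i₂ p₁ p₂ => M.e c i₁ i₂ * M.e c p₁ p₂)
    simp only [hker i hi'.2] at h1
    rw [h1, Finset.mul_sum]
    refine Finset.sum_congr rfl fun c _ => ?_
    split_ifs <;> ring
  simp only [FunLike.coe_sum, Finset.sum_apply, FunLike.coe_smul,
    Pi.smul_apply, ContinuousLinearMap.proj_apply, smul_eq_mul]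
  rw [pref_eq, hst, hβt]
  have h2 : ∑ c, 1 / 2 * (s * β ^ 2 / (|s| * √n) * levelAvg (θ t) (D0 r S (θ t)) r (M.e c) (M.lev c))
        * coordVarDeriv r (θ t) dP dQ S.d c
      = s * β ^ 2 / (2 * |s| * √n) * ∑ c, coordVarDeriv r (θ t) dP dQ S.d c
        * levelAvg (θ t) (D0 r S (θ t)) r (M.e c) (M.lev c) := by
    rw [Finset.mul_sum]
    refine Finset.sum_congr rfl fun c _ => ?_
    ring
  rw [h2, hmain]
  have h3 : |s| ≠ 0 := abs_ne_zero.2 hs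
  have h4 : s * s = |s| * |s| := (abs_mul_abs_self s).symm
  have h5 : s * β ^ 2 / (2 * |s| * √n) * s = |s| * β ^ 2 / (2 * √n) := by
    rw [div_mul_eq_mul_div, mul_right_comm, h4]
    -- If `√n = 0`, both sides are zero, because division by zero gives zero.
    by_cases hn : (√n : ℝ) = 0
    · simp [hn]
    · field_simp
  rw [← h5]
  ring

end Derivative

/-! ### Stationarity, and the derivative of `ψ₁`. -/

section UnitNorms

variable {n : ℕ} {r : ℕ} {S : Data n} [Nonempty (Fin S.l)] {θ : Params}
  (hx : ∀ i, ‖S.x i‖ = 1) (hy : ∀ i, ‖S.y i‖ = 1)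
include hx hy

lemma avg_mags (ht : θ.t ∈ Icc (0 : ℝ) 1) {k : ℕ} (hk : 1 ≤ k) : avg r S θ k (mags S) = 1 := by
  have hD := energyTame_D0 r hx hy ht
  have h : mags S = fun _ _ _ _ => 1 := by
    ext i₁ i₂ p₁ p₂
    simp [mags, hx, hy]
  rw [h]
  match k with
  | 1 => exact (isAverage_avg_one r S θ hD).const 1
  | k + 2 => exact (isAverage_avg r S θ hD (k := k + 1) (by omega)).const 1

/-- The correction term that turns `ψ` into `ψ₁`, and `ψ_S` into the bound. -/
lemma psi1_eq (ht : θ.t ∈ Icc (0 : ℝ) 1) :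
    psi1 r S θ = -pref n θ * ∑ k ∈ Finset.Icc 1 (r + 1),
      (θ.P (k - 1) * θ.Q (k - 1) - θ.P k * θ.Q k) * θ.m k * omega k θ.p + psi r S θ := by
  unfold psi1
  congr 2
  refine Finset.sum_congr rfl fun k hk => ?_
  have hk' := (Finset.mem_Icc.1 hk).1
  rw [avg_mags hx hy ht hk', avg_mags hx hy ht (hk'.trans (Nat.le_succ k)), mul_one, mul_one]

omit [Nonempty (Fin S.l)] hy in
lemma devX_eq (k : ℕ) : devX S θ k = fun i₁ _ p₁ _ => θ.P k - inner ℝ (S.x p₁) (S.x i₁) := by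
  ext i₁ i₂ p₁ p₂
  simp [devX, hx]

omit [Nonempty (Fin S.l)] hx in
lemma devY_eq (k : ℕ) : devY S θ k = fun _ i₂ _ p₂ => θ.Q k - inner ℝ (S.y p₂) (S.y i₂) := by
  ext i₁ i₂ p₁ p₂
  simp [devY, hy]

omit [Nonempty (Fin S.l)] hy in
lemma statP_eq (k : ℕ) :
    statP r S θ k = (1 - θ.t) * pref n θ * nu r S θ k (devY S θ k) := by
  unfold statP nu
  simp only [hx, one_mul, mul_one]
  split_ifs with h
  · subst h
    ring
  · ring

omit [Nonempty (Fin S.l)] hx in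
lemma statQ_eq (k : ℕ) :
    statQ r S θ k = (1 - θ.t) * pref n θ * nu r S θ k (devX S θ k) := by
  unfold statQ nu
  simp only [hy, one_mul, mul_one]
  split_ifs with h
  · subst h
    ring
  · ring

end UnitNorms

/-- The product of the deviations of the two overlaps from their targets. -/
def devXY {n : ℕ} (S : Data n) (θ : Params) (k : ℕ) : PairFun S.l := fun i₁ i₂ p₁ p₂ =>
  devX S θ k i₁ i₂ p₁ p₂ * devY S θ k i₁ i₂ p₁ p₂

lemma phiVanishes_iff {n : ℕ} {r : ℕ} {S : Data n} {θ : Params} (hs : θ.s ≠ 0) {k : ℕ}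
    (hk : 1 ≤ k) : PhiVanishes r S θ k ↔ nu r S θ k (devXY S θ k) = 0 := by
  have h : phi r S θ (k + 1) + (if k = 1 then phi22 r S θ else 0)
      = -θ.s * nu r S θ k (devXY S θ k) := by
    have hk1 : k + 1 ≠ 1 := by omega
    unfold phi phi22 nu omega
    rw [Nat.add_sub_cancel, if_neg hk1]
    split_ifs with h
    · subst h
      unfold devXY
      ring
    · unfold devXY
      ring
  rw [PhiVanishes, h]
  simp [hs]

lemma sum_by_parts (r : ℕ) (g c : ℕ → ℝ) (h0 : g 0 = 0) (hr : g (r + 1) = 0) :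
    ∑ k ∈ Finset.Icc 1 (r + 1), (g (k - 1) - g k) * c k
      = -∑ k ∈ Finset.Icc 1 r, g k * (c k - c (k + 1)) := by
  have h : ∀ q, ∑ k ∈ Finset.Icc 1 (q + 1), (g (k - 1) - g k) * c k
      = -∑ k ∈ Finset.Icc 1 q, g k * (c k - c (k + 1)) - g (q + 1) * c (q + 1) := by
    intro q
    induction q with
    | zero => simp [h0]
    | succ q ih =>
      rw [Finset.sum_Icc_succ_top (by omega), ih, Finset.sum_Icc_succ_top (by omega),
        Nat.add_sub_cancel]
      ring
  rw [h, hr]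
  ring

section Derivative

variable {n : ℕ} {r : ℕ} {S : Data n} [Nonempty (Fin S.l)]

/-- Along a stationary path the derivative of `ψ₁` only sees the products of the deviations. -/
lemma hasDerivWithinAt_psi1 (hr : 1 ≤ r) (hx : ∀ i, ‖S.x i‖ = 1) (hy : ∀ i, ‖S.y i‖ = 1)
    {m : ℕ → ℝ} (hm : Admissible r m) {θ : ℝ → Params} {β p s : ℝ} {P Q : ℝ → ℕ → ℝ}
    (hθ : ∀ t, θ t = ⟨β, p, s, t, m, P t, Q t⟩) (hp : p ≠ 0) (hs : s ≠ 0)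
    (hP : ∀ t ∈ Icc (0 : ℝ) 1, Ordered r (P t)) (hQ : ∀ t ∈ Icc (0 : ℝ) 1, Ordered r (Q t))
    (hPd : ∀ k ∈ Finset.Icc 1 r, DifferentiableOn ℝ (fun t => P t k) (Icc 0 1))
    (hQd : ∀ k ∈ Finset.Icc 1 r, DifferentiableOn ℝ (fun t => Q t k) (Icc 0 1))
    {t : ℝ} (ht : t ∈ Icc (0 : ℝ) 1)
    (hstatP : ∀ k ∈ Finset.Icc 1 r, statP r S (θ t) k = 0)
    (hstatQ : ∀ k ∈ Finset.Icc 1 r, statQ r S (θ t) k = 0) :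
    HasDerivWithinAt (fun τ => psi1 r S (θ τ))
      (-pref n (θ t) * ∑ k ∈ Finset.Icc 1 r, nu r S (θ t) k (devXY S (θ t) k)) (Icc 0 1) t := by
  -- The components `0` and `r + 1` are constant on `[0, 1]`, so their derivatives vanish; the
  -- others are differentiable by assumption.
  have key : ∀ R : ℝ → ℕ → ℝ, (∀ t ∈ Icc (0 : ℝ) 1, Ordered r (R t)) →
      (∀ k ∈ Finset.Icc 1 r, DifferentiableOn ℝ (fun t => R t k) (Icc 0 1)) →
      ∃ dR : ℕ → ℝ, dR 0 = 0 ∧ dR (r + 1) = 0 ∧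
        ∀ k ≤ r + 1, HasDerivWithinAt (fun t => R t k) (dR k) (Icc 0 1) t := by
    intro R hR hRd
    have hu : UniqueDiffWithinAt ℝ (Icc (0 : ℝ) 1) t := uniqueDiffOn_Icc_zero_one t ht
    have c0 : HasDerivWithinAt (fun t => R t 0) 0 (Icc 0 1) t :=
      (hasDerivWithinAt_const t _ 1).congr (fun τ hτ => (hR τ hτ).1) (hR t ht).1
    have c1 : HasDerivWithinAt (fun t => R t (r + 1)) 0 (Icc 0 1) t :=
      (hasDerivWithinAt_const t _ 0).congr (fun τ hτ => (hR τ hτ).2.1) (hR t ht).2.1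
    refine ⟨fun k => derivWithin (fun t => R t k) (Icc 0 1) t, c0.derivWithin hu,
      c1.derivWithin hu, fun k hk => DifferentiableWithinAt.hasDerivWithinAt ?_⟩
    rcases Nat.eq_zero_or_pos k with rfl | hk0
    · exact c0.differentiableWithinAt
    · rcases hk.eq_or_lt with rfl | hk1
      · exact c1.differentiableWithinAt
      · exact hRd k (Finset.mem_Icc.2 ⟨hk0, Nat.lt_succ_iff.1 hk1⟩) t ht
  obtain ⟨dP, hdP0, hdPr, hPd'⟩ := key P hP hPd
  obtain ⟨dQ, hdQ0, hdQr, hQd'⟩ := key Q hQ hQd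
  have hpsi := hasDerivWithinAt_psi hr hx hy hm hθ hp hs hP hQ ht hPd' hQd' hdP0 hdQ0 hdPr hdQr
  have htt : (θ t).t = t := by rw [hθ]
  have hPt : (θ t).P = P t := by rw [hθ]
  have hQt : (θ t).Q = Q t := by rw [hθ]
  have hmt : (θ t).m = m := by rw [hθ]
  have hpt : (θ t).p = p := by rw [hθ]
  have hpref : ∀ τ, pref n (θ τ) = pref n (θ t) := fun τ => by simp only [pref, hθ]
  have ht' : (θ t).t ∈ Icc (0 : ℝ) 1 := by rw [htt]; exact ht
  have hD := energyTame_D0 r hx hy ht'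
  have hcorr : HasDerivWithinAt (fun τ => ∑ k ∈ Finset.Icc 1 (r + 1),
        (P τ (k - 1) * Q τ (k - 1) - P τ k * Q τ k) * m k * omega k p)
      (∑ k ∈ Finset.Icc 1 (r + 1),
        ((dP (k - 1) * Q t (k - 1) + P t (k - 1) * dQ (k - 1)) - (dP k * Q t k + P t k * dQ k))
          * (m k * omega k p)) (Icc 0 1) t := by
    refine HasDerivWithinAt.fun_sum fun k hk => ?_
    have hk' := (Finset.mem_Icc.1 hk).2
    simp only [mul_assoc (_ - _)]
    exact (((hPd' (k - 1) (by omega)).mul (hQd' (k - 1) (by omega))).sub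
      ((hPd' k hk').mul (hQd' k hk'))).mul_const _
  rw [sum_by_parts r (fun k => dP k * Q t k + P t k * dQ k) (fun k => m k * omega k p)
    (by simp [hdP0, hdQ0]) (by simp [hdPr, hdQr])] at hcorr
  have hform : ∀ τ ∈ Icc (0 : ℝ) 1, psi1 r S (θ τ) = -pref n (θ t) * (∑ k ∈ Finset.Icc 1 (r + 1),
        (P τ (k - 1) * Q τ (k - 1) - P τ k * Q τ k) * m k * omega k p) + psi r S (θ τ) := by
    intro τ hτ
    rw [psi1_eq hx hy (by rw [hθ]; exact hτ), hpref, hθ τ]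
  refine (((hcorr.const_mul (-pref n (θ t))).add hpsi).congr hform (hform t ht)).congr_deriv ?_
  -- If the prefactor is zero there is nothing to prove; otherwise it can be cancelled from the
  -- stationarity equations.
  rw [← mul_add, mul_eq_mul_left_iff, or_iff_not_imp_right]
  intro hpref0
  rw [neg_eq_zero] at hpref0
  rw [neg_add_eq_sub, ← Finset.sum_sub_distrib]
  refine Finset.sum_congr rfl fun k hk => ?_
  have hk1 := (Finset.mem_Icc.1 hk).1
  have hsP := hstatP k hk
  have hsQ := hstatQ k hk
  rw [statP_eq hx, htt, mul_right_comm, mul_eq_zero, or_iff_left hpref0] at hsP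
  rw [statQ_eq hy, htt, mul_right_comm, mul_eq_zero, or_iff_left hpref0] at hsQ
  -- The terms with `𝐩ₖ'`, `𝐪ₖ'` are split into the constant `(𝐩ₖ 𝐪ₖ)'`, which the correction
  -- cancels, and multiples of the single deviations, which stationarity cancels.
  have hfun : (fun i₁ i₂ p₁ p₂ =>
        (P t k - inner ℝ (S.x p₁) (S.x i₁)) * (Q t k - inner ℝ (S.y p₂) (S.y i₂))
        + (dP k * (t * Q t k + (1 - t) * inner ℝ (S.y p₂) (S.y i₂))
          + dQ k * (t * P t k + (1 - t) * inner ℝ (S.x p₁) (S.x i₁))))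
      = fun i₁ i₂ p₁ p₂ => devXY S (θ t) k i₁ i₂ p₁ p₂
        + ((dP k * Q t k + P t k * dQ k)
          + (-((1 - t) * dP k) * devY S (θ t) k i₁ i₂ p₁ p₂
            + -((1 - t) * dQ k) * devX S (θ t) k i₁ i₂ p₁ p₂)) := by
    ext i₁ i₂ p₁ p₂
    rw [devXY, devX_eq hx, devY_eq hy, hPt, hQt]
    ring
  rw [hfun, nu_add r S (θ t) hD hk1,
    nu_add r S (θ t) hD hk1 (fun _ _ _ _ => dP k * Q t k + P t k * dQ k) fun i₁ i₂ p₁ p₂ =>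
      -((1 - t) * dP k) * devY S (θ t) k i₁ i₂ p₁ p₂
        + -((1 - t) * dQ k) * devX S (θ t) k i₁ i₂ p₁ p₂,
    nu_const r S (θ t) hD hk1,
    nu_add r S (θ t) hD hk1 (fun i₁ i₂ p₁ p₂ => -((1 - t) * dP k) * devY S (θ t) k i₁ i₂ p₁ p₂)
      fun i₁ i₂ p₁ p₂ => -((1 - t) * dQ k) * devX S (θ t) k i₁ i₂ p₁ p₂,
    nu_const_mul r S (θ t) hD hk1 _ (devY S (θ t) k),
    nu_const_mul r S (θ t) hD hk1 _ (devX S (θ t) k), hmt, hpt]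
  linear_combination -dP k * hsP - dQ k * hsQ

end Derivative

/-! ### The effect of scalar noise that is common to all indices. -/

section Gaussian

variable {n d : ℕ}

lemma integral_exp_mul_gaussU_fst (b : ℝ) :
    ∫ u, Real.exp (b * u.1) ∂(gaussU n d) = Real.exp (b ^ 2 / 2) := by
  have h := integral_fun_fst (μ := gaussianReal 0 1)
    (ν := (Measure.pi fun _ : Fin d => gaussianReal 0 1).prod
      (Measure.pi fun _ : Fin n => gaussianReal 0 1)) fun u : ℝ => Real.exp (b * u)
  have h2 := congrFun (mgf_id_gaussianReal (μ := 0) (v := 1)) b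
  simp only [mgf, id] at h2
  rw [gaussU, h, h2]
  simp

lemma integral_gaussU_fst : ∫ u, u.1 ∂(gaussU n d) = 0 := by
  have h := integral_fun_fst (μ := gaussianReal 0 1)
    (ν := (Measure.pi fun _ : Fin d => gaussianReal 0 1).prod
      (Measure.pi fun _ : Fin n => gaussianReal 0 1)) fun u : ℝ => u
  rw [gaussU, h]
  simp

lemma expU_mul_exp (k : ℕ) {F g : Config n d → ℝ} (hF : ∀ w u, F (setU k w u) = F w)
    (hg : ∀ w u, g (setU k w u) = g w) (b : ℝ) (w : Config n d) :
    expU k (fun w => F w * Real.exp (b * (w.2 k).1 + g w)) w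
      = F w * Real.exp (b ^ 2 / 2 + g w) := by
  have h : ∀ u, F (setU k w u) * Real.exp (b * ((setU k w u).2 k).1 + g (setU k w u))
      = (F w * Real.exp (g w)) * Real.exp (b * u.1) := by
    intro u
    rw [hF, hg, Real.exp_add]
    simp only [Function.update_self]
    ring
  unfold expU
  refine (integral_congr_ae (.of_forall h)).trans ?_
  rw [integral_const_mul, integral_exp_mul_gaussU_fst, Real.exp_add]
  ring

lemma expU_of_invariant (k : ℕ) {F : Config n d → ℝ} (hF : ∀ w u, F (setU k w u) = F w)
    (w : Config n d) : expU k F w = F w := by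
  refine (integral_congr_ae (.of_forall (hF w))).trans ?_
  simp

end Gaussian

section ScalarNoise

variable {n d l : ℕ} (r : ℕ) (θ : Params) (a : ℕ → ℝ)

/-- The scalar noise of the levels above `j`. -/
def scalarNoise (j : ℕ) (w : Config n d) : ℝ :=
  ∑ k ∈ Finset.Icc (j + 1) (r + 1), a k * (w.2 k).1

lemma scalarNoise_eq {j : ℕ} (hj : j ≤ r) (w : Config n d) :
    scalarNoise r a j w = a (j + 1) * (w.2 (j + 1)).1 + scalarNoise r a (j + 1) w := by
  have h : Finset.Icc (j + 1 + 1) (r + 1) = Finset.Ioc (j + 1) (r + 1) := by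
    ext
    simp only [Finset.mem_Icc, Finset.mem_Ioc]
    omega
  unfold scalarNoise
  rw [h, Finset.add_sum_Ioc_eq_sum_Icc (f := fun k => a k * (w.2 k).1) (Nat.succ_le_succ hj)]

lemma scalarNoise_setU {j k : ℕ} (hk : k ≤ j) (w : Config n d) (u : NoiseU n d) :
    scalarNoise r a j (setU k w u) = scalarNoise r a j w := by
  refine Finset.sum_congr rfl fun i hi => ?_
  have : i ≠ k := by
    have := (Finset.mem_Icc.1 hi).1
    omega
  simp [this]

/-- The accumulated second moments of the scalar noise of the levels up to `k`. -/
def scalarMoment (k : ℕ) : ℝ := ∑ j ∈ Finset.Icc 1 k, a j ^ 2 * θ.m j * omega j θ.p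

variable {D D' : Energy n d l} (hD : ∀ w w', w.1 = w'.1 → D w = D w')

section
include hD

/-- At `t = 1` the energy `D0S` depends on `G` only, so its `ζₖ` is constant in the `𝒰ⱼ` and every
`𝔼_{𝒰ⱼ}` acts trivially on it. -/
lemma zeta_eq_of_fst_eq (k : ℕ) {w w' : Config n d} (h : w.1 = w'.1) :
    zeta θ D k w = zeta θ D k w' := by
  induction k generalizing w w' with
  | zero => rfl
  | succ k ih =>
    match k with
    | 0 =>
      refine Finset.sum_congr rfl fun i₃ _ => congrArg (· ^ θ.p)
        (integral_congr_ae (.of_forall fun u => ?_))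
      simp only [Zfun, Cfun, Afun, hD (setU 1 w u) (setU 1 w' u) h]
    | k + 1 =>
      simp only [zeta, expU]
      exact integral_congr_ae (.of_forall fun u => congrArg (· ^ _) (ih h))

end

variable [Nonempty (Fin l)]
  (hD' : ∀ w i₁ i₂ i₃, D' w i₁ i₂ i₃ = D w i₁ i₂ i₃ + scalarNoise r a 0 w)
include hD'

omit [Nonempty (Fin l)] in
lemma Zfun_add_scalarNoise (i₃ : Fin l) (w : Config n d) :
    Zfun θ D' i₃ w = Zfun θ D i₃ w * Real.exp (θ.s * θ.β * scalarNoise r a 0 w) := by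
  unfold Zfun
  rw [Finset.sum_mul]
  refine Finset.sum_congr rfl fun i₁ _ => ?_
  have h : Cfun θ D' w i₁ i₃ = Cfun θ D w i₁ i₃ * Real.exp (θ.β * scalarNoise r a 0 w) := by
    unfold Cfun Afun
    rw [Finset.sum_mul]
    exact Finset.sum_congr rfl fun i₂ _ => by rw [hD', mul_add, Real.exp_add]
  have h0 : 0 ≤ Cfun θ D w i₁ i₃ := Finset.sum_nonneg fun _ _ => (Real.exp_pos _).le
  rw [h, Real.mul_rpow h0 (Real.exp_pos _).le,
    ← Real.exp_mul]
  ring_nf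

include hD

omit [Nonempty (Fin l)] in
-- Level `1` is integrated before the power `p` is taken, so its Gaussian factor contributes `(s β
-- a₁)² / 2` without `p`; hence `omega 1 p = 1`.
lemma EZ_add_scalarNoise (hm1 : θ.m 1 = 1) (i₃ : Fin l) (w : Config n d) :
    EZ θ D' i₃ w = EZ θ D i₃ w * Real.exp (θ.s * θ.β * scalarNoise r a 1 w
      + (θ.s * θ.β) ^ 2 / 2 * scalarMoment θ a 1) := by
  have hZ : ∀ w u, Zfun θ D i₃ (setU 1 w u) = Zfun θ D i₃ w := fun w u => by
    simp only [Zfun, Cfun, Afun, hD (setU 1 w u) w rfl]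
  unfold EZ
  simp only [hm1, Real.rpow_one]
  rw [expU_of_invariant 1 hZ]
  have h := expU_mul_exp 1 hZ (g := fun w => θ.s * θ.β * scalarNoise r a 1 w)
    (fun w u => by rw [scalarNoise_setU r a le_rfl]) (θ.s * θ.β * a 1) w
  refine Eq.trans ?_ (h.trans ?_)
  · congr 1
    ext w
    rw [Zfun_add_scalarNoise r θ a hD', scalarNoise_eq r a (Nat.zero_le r)]
    ring_nf
  · simp only [scalarMoment, Finset.Icc_self, Finset.sum_singleton, hm1, omega, if_true]
    ring_nf

/-- Independent scalar noise multiplies `ζ` by a log-normal factor. -/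
lemma zeta_add_scalarNoise (hE : EnergyTame fun _ : Unit => D) (hm1 : θ.m 1 = 1)
    (hm : ∀ k ∈ Finset.Icc 1 r, θ.m k ≠ 0) {k : ℕ} (hk : k < r) (w : Config n d) :
    zeta θ D' (k + 1) w = zeta θ D (k + 1) w * Real.exp (θ.p * θ.m (k + 1) *
      (θ.s * θ.β * scalarNoise r a (k + 1) w
        + (θ.s * θ.β) ^ 2 / 2 * scalarMoment θ a (k + 1))) := by
  induction k generalizing w with
  | zero =>
    simp only [zeta]
    rw [Finset.sum_mul]
    refine Finset.sum_congr rfl fun i₃ _ => ?_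
    rw [EZ_add_scalarNoise r θ a hD hD' hm1, Real.mul_rpow ((posTame_EZ θ hE i₃).pos () w).le
      (Real.exp_pos _).le, ← Real.exp_mul, hm1]
    ring_nf
  | succ k ih =>
    have hmk : θ.m (k + 1) ≠ 0 := hm _ (Finset.mem_Icc.2 ⟨by omega, by omega⟩)
    have hz : ∀ w u, zeta θ D (k + 1) (setU (k + 2) w u) ^ (θ.m (k + 2) / θ.m (k + 1))
        = zeta θ D (k + 1) w ^ (θ.m (k + 2) / θ.m (k + 1)) := fun w u => by
      rw [zeta_eq_of_fst_eq θ hD (k + 1) (w := setU (k + 2) w u) (w' := w) rfl]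
    -- The Gaussian of level `k + 2` has coefficient `b = p m_{k+2} s β a_{k+2}`. Pulling `p m_{k+2}
    -- (s β)² / 2` out of `b² / 2` leaves `a_{k+2}² m_{k+2} p`, the new term of `scalarMoment`.
    have h := expU_mul_exp (k + 2)
      (F := fun w => zeta θ D (k + 1) w ^ (θ.m (k + 2) / θ.m (k + 1))) hz
      (g := fun w => θ.p * θ.m (k + 2) * (θ.s * θ.β * scalarNoise r a (k + 2) w
        + (θ.s * θ.β) ^ 2 / 2 * scalarMoment θ a (k + 1)))
      (fun w u => by rw [scalarNoise_setU r a le_rfl])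
      (θ.p * θ.m (k + 2) * (θ.s * θ.β * a (k + 2))) w
    rw [show zeta θ D (k + 1 + 1) w = _ from expU_of_invariant (k + 2) hz w]
    refine Eq.trans ?_ (h.trans ?_)
    · rw [zeta]
      congr 1
      ext w
      rw [ih (by omega), Real.mul_rpow ((posTame_zeta θ hE k).pos () w).le (Real.exp_pos _).le,
        ← Real.exp_mul, scalarNoise_eq r a (by omega)]
      congr 2
      field_simp
      ring
    · congr 2
      have h1 : scalarMoment θ a (k + 2)
          = scalarMoment θ a (k + 1) + a (k + 2) ^ 2 * θ.m (k + 2) * θ.p := by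
        unfold scalarMoment
        rw [Finset.sum_Icc_succ_top (by omega), omega, if_neg (by omega)]
      rw [h1]
      ring

/-- The free energy is shifted by the second moment of the scalar noise. -/
lemma freeEnergy_add_scalarNoise (hE : EnergyTame fun _ : Unit => D) (hr : 1 ≤ r)
    (hm1 : θ.m 1 = 1) (hmr : θ.m (r + 1) = 0) (hm : ∀ k ∈ Finset.Icc 1 r, θ.m k ≠ 0)
    (hp : θ.p ≠ 0) :
    freeEnergy (n := n) r θ D'
      = freeEnergy (n := n) r θ D + pref n θ * scalarMoment θ a (r + 1) := by
  obtain ⟨q, rfl⟩ : ∃ q, r = q + 1 := ⟨r - 1, by omega⟩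
  have hz := posTame_zeta θ hE q
  have hmq : θ.m (q + 1) ≠ 0 := hm _ (Finset.mem_Icc.2 ⟨hr, le_rfl⟩)
  set c := 1 / (θ.p * |θ.s| * √n * θ.m (q + 1)) with hc
  have hlog : ∀ w : Config n d, c * Real.log (zeta θ D' (q + 1) w)
      = c * Real.log (zeta θ D (q + 1) w)
        + ((c * (θ.p * θ.m (q + 1) * (θ.s * θ.β * a (q + 2)))) * (w.2 (q + 2)).1
        + c * (θ.p * θ.m (q + 1) * ((θ.s * θ.β) ^ 2 / 2 * scalarMoment θ a (q + 1)))) := by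
    intro w
    rw [zeta_add_scalarNoise (q + 1) θ a hD hD' hE hm1 hm (Nat.lt_succ_self q),
      Real.log_mul (hz.ne_zero () w) (Real.exp_pos _).ne', Real.log_exp,
      scalarNoise_eq (q + 1) a le_rfl]
    have h0 : scalarNoise (q + 1) a (q + 1 + 1) w = 0 := by simp [scalarNoise]
    rw [h0]
    ring
  have i1 : Integrable (fun z : NoiseG n d × NoiseU n d =>
      c * Real.log (zeta θ D (q + 1) (z.1, Function.update 0 (q + 1 + 1) z.2)))
      ((gaussG n d).prod (gaussU n d)) :=
    (resample_expTop (q + 1)).integrable (hz.log.const_mul c).tame () 0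
  have i2 : Integrable (fun z : NoiseG n d × NoiseU n d => z.2.1)
      ((gaussG n d).prod (gaussU n d)) :=
    (expMoments_gaussU.integrable continuous_fst
      (.of_le_norm fun y => norm_fst_le y)).comp_snd _
  have e2 : ∫ z : NoiseG n d × NoiseU n d, c * (θ.p * θ.m (q + 1) * (θ.s * θ.β * a (q + 2)))
      * z.2.1 ∂((gaussG n d).prod (gaussU n d)) = 0 := by
    rw [integral_const_mul, integral_fun_snd (f := fun u : NoiseU n d => u.1),
      integral_gaussU_fst, smul_zero, mul_zero]
  have i3 : Integrable (fun z : NoiseG n d × NoiseU n d =>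
      c * (θ.p * θ.m (q + 1) * (θ.s * θ.β * a (q + 2))) * z.2.1
        + c * (θ.p * θ.m (q + 1) * ((θ.s * θ.β) ^ 2 / 2 * scalarMoment θ a (q + 1))))
      ((gaussG n d).prod (gaussU n d)) := (i2.const_mul _).add (integrable_const _)
  unfold freeEnergy expTop
  simp only [← hc, hlog, Function.update_self]
  rw [integral_add i1 i3, integral_add (i2.const_mul _) (integrable_const _), e2]
  -- The last level enters `log ζ_r` linearly and has mean zero; correspondingly its term in
  -- `scalarMoment` carries the factor `m (r + 1) = 0`.
  have h1 : scalarMoment θ a (q + 1 + 1) = scalarMoment θ a (q + 1) := by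
    unfold scalarMoment
    rw [Finset.sum_Icc_succ_top (by omega), hmr]
    ring
  rw [h1, pref_eq]
  simp only [integral_const, probReal_univ, one_smul, zero_add]
  congr 1
  rw [hc]
  have h4 : θ.s * θ.s = |θ.s| * |θ.s| := (abs_mul_abs_self θ.s).symm
  by_cases hs : θ.s = 0
  · simp [hs]
  have hs' : |θ.s| ≠ 0 := abs_ne_zero.2 hs
  by_cases hn : (√n : ℝ) = 0
  · simp [hn]
  · rw [mul_pow, sq θ.s, h4]
    field_simp

end ScalarNoise

/-! ### The values of `ψ₁` at `t = 1` and `t = 0`. -/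

section Endpoints

variable {n : ℕ} {r : ℕ} {S : Data n} [Nonempty (Fin S.l)] {θ : Params}
  (hx : ∀ i, ‖S.x i‖ = 1) (hy : ∀ i, ‖S.y i‖ = 1)
include hx hy

/-- At `t = 1` the correction in `ψ₁` cancels the contribution of the scalar noise. -/
lemma psi1_one (hr : 1 ≤ r) (hm : Admissible r θ.m) (hp : θ.p ≠ 0) (hP : Ordered r θ.P)
    (hQ : Ordered r θ.Q) (ht : θ.t = 1) : psi1 r S θ = psiS r S θ := by
  have hE : EnergyTame fun _ : Unit => D0S r S θ := by
    -- For constant `𝐩 = 𝐪 = 1` all `aₖ` vanish, and at `t = 1` the terms with `bₖ`, `cₖ` are absent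
    -- anyway; tameness of `D0S` is thus inherited from `D0`.
    have h : D0S r S θ = D0 r S { θ with P := fun _ => 1, Q := fun _ => 1 } := by
      ext w i₁ i₂ i₃
      simp [D0, D0S, Params.a, ht]
    rw [h]
    exact energyTame_D0 r hx hy (by simp [ht])
  have hfst : ∀ w w', w.1 = w'.1 → D0S r S θ w = D0S r S θ w' := by
    intro w w' h
    ext i₁ i₂ i₃
    simp [D0S, ht, h]
  have hnoise : ∀ w i₁ i₂ i₃, D0 r S θ w i₁ i₂ i₃
      = D0S r S θ w i₁ i₂ i₃ + scalarNoise r θ.a 0 w := by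
    intro w i₁ i₂ i₃
    simp [D0, scalarNoise, ht, hx, hy]
  have hmom : scalarMoment θ θ.a (r + 1) = ∑ k ∈ Finset.Icc 1 (r + 1),
      (θ.P (k - 1) * θ.Q (k - 1) - θ.P k * θ.Q k) * θ.m k * omega k θ.p := by
    refine Finset.sum_congr rfl fun k hk => ?_
    have hk' := Finset.mem_Icc.1 hk
    rw [Params.a, Real.sq_sqrt]
    obtain ⟨j, rfl⟩ : ∃ j, k = j + 1 := ⟨k - 1, by omega⟩
    rw [Nat.add_sub_cancel, sub_nonneg]
    exact mul_le_mul (hP.succ_le (by omega)) (hQ.succ_le (by omega)) (hQ.mem_Icc (by omega)).1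
      (hP.mem_Icc (by omega)).1
  rw [psi1_eq hx hy (by simp [ht]), psi, psiS, freeEnergy_add_scalarNoise r θ θ.a hfst hnoise hE hr
    hm.2.1 hm.2.2.1 hm.2.2.2 hp, hmom]
  ring

/-- At `t = 0` the scalar noise is absent. -/
lemma psi1_zero (ht : θ.t = 0) : psi1 r S θ = bound r S θ := by
  have h : D0 r S θ = D0S r S θ := by
    ext w i₁ i₂ i₃
    simp [D0, ht]
  rw [psi1_eq hx hy (by simp [ht]), bound, psi, psiS, h]

end Endpoints

/-! ### Passage to the limit in `n`. -/

section Calculus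

/-- Functions with uniformly bounded, pointwise vanishing derivatives become constant. -/
lemma tendsto_sub_of_tendsto_deriv {f D : ℕ → ℝ → ℝ} {B : ℝ}
    (hf : ∀ n ≥ 1, ∀ t ∈ Icc (0 : ℝ) 1, HasDerivWithinAt (f n) (D n t) (Icc 0 1) t)
    (hB : ∀ n ≥ 1, ∀ t ∈ Icc (0 : ℝ) 1, |D n t| ≤ B)
    (hD : ∀ t ∈ Icc (0 : ℝ) 1, Tendsto (fun n => D n t) atTop (𝓝 0))
    {t t' : ℝ} (ht : t ∈ Icc (0 : ℝ) 1) (ht' : t' ∈ Icc (0 : ℝ) 1) :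
    Tendsto (fun n => f n t - f n t') atTop (𝓝 0) := by
  wlog h : t' ≤ t generalizing t t'
  · simpa using (this ht' ht (le_of_not_ge h)).neg
  have hsub : Ioo t' t ⊆ Ioo 0 1 := Ioo_subset_Ioo ht'.1 ht.2
  have hderiv : ∀ n ≥ 1, ∀ τ ∈ Ioo t' t, HasDerivAt (f n) (D n τ) τ := fun n hn τ hτ =>
    (hf n hn τ (Ioo_subset_Icc_self (hsub hτ))).hasDerivAt (Icc_mem_nhds (hsub hτ).1 (hsub hτ).2)
  have hbound : ∀ n ≥ 1, ∀ᵐ τ ∂(volume.restrict (Ioo t' t)), ‖deriv (f n) τ‖ ≤ B := by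
    intro n hn
    filter_upwards [ae_restrict_mem measurableSet_Ioo] with τ hτ
    rw [(hderiv n hn τ hτ).deriv]
    exact hB n hn τ (Ioo_subset_Icc_self (hsub hτ))
  -- Neither continuity nor measurability of `D n` is assumed: `deriv (f n)` is always measurable
  -- and agrees with `D n` inside the interval, where it is bounded, which suffices for the
  -- fundamental theorem of calculus.
  have hftc : ∀ n ≥ 1, f n t - f n t' = ∫ τ in Ioo t' t, deriv (f n) τ := by
    intro n hn
    have hint : IntegrableOn (deriv (f n)) (Ioo t' t) :=
      (integrable_const B).mono' (measurable_deriv _).aestronglyMeasurable (hbound n hn)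
    rw [← integral_Ioc_eq_integral_Ioo, ← intervalIntegral.integral_of_le h]
    refine (intervalIntegral.integral_eq_sub_of_hasDerivAt_of_le h ?_
      (fun τ hτ => (hderiv n hn τ hτ).differentiableAt.hasDerivAt) ?_).symm
    · exact fun τ hτ => ((hf n hn τ ⟨ht'.1.trans hτ.1, hτ.2.trans ht.2⟩).continuousWithinAt).mono
        (Icc_subset_Icc ht'.1 ht.2)
    · rwa [intervalIntegrable_iff_integrableOn_Ioo_of_le h]
  have hlim : Tendsto (fun n => ∫ τ in Ioo t' t, deriv (f n) τ) atTop
      (𝓝 (∫ _ in Ioo t' t, (0 : ℝ))) := by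
    refine tendsto_integral_filter_of_dominated_convergence (fun _ => B)
      (.of_forall fun n => (measurable_deriv _).aestronglyMeasurable) ?_ (integrable_const B) ?_
    · filter_upwards [eventually_ge_atTop 1] with n hn using hbound n hn
    · filter_upwards [ae_restrict_mem measurableSet_Ioo] with τ hτ
      refine (hD τ (Ioo_subset_Icc_self (hsub hτ))).congr' ?_
      filter_upwards [eventually_ge_atTop 1] with n hn using (hderiv n hn τ hτ).deriv.symm
  rw [integral_zero] at hlim
  refine hlim.congr' ?_
  filter_upwards [eventually_ge_atTop 1] with n hn using (hftc n hn).symm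

end Calculus

section EReal

variable {u v : ℕ → ℝ} (h : Tendsto (fun n => u n - v n) atTop (𝓝 0))
include h

lemma tendsto_coe_sub : Tendsto (fun n => ((u n - v n : ℝ) : EReal)) atTop (𝓝 0) :=
  (continuous_coe_real_ereal.tendsto 0).comp h

omit h in
lemma coe_eq_add_coe_sub (u v : ℕ → ℝ) : (fun n => (u n : EReal))
    = (fun n => (v n : EReal)) + fun n => ((u n - v n : ℝ) : EReal) := by
  ext n
  rw [Pi.add_apply, ← EReal.coe_add, add_sub_cancel]

/-- Addition on `EReal` is continuous at `(L, 0)` even for infinite `L`, because the second summand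
is finite. -/
lemma tendsto_coe_of_tendsto_sub {L : EReal}
    (hv : Tendsto (fun n => (v n : EReal)) atTop (𝓝 L)) :
    Tendsto (fun n => (u n : EReal)) atTop (𝓝 L) := by
  have hc := EReal.continuousAt_add (p := (L, 0)) (.inr EReal.zero_ne_bot) (.inr EReal.zero_ne_top)
  have := hc.tendsto.comp (hv.prodMk_nhds (tendsto_coe_sub h))
  rw [add_zero] at this
  rw [coe_eq_add_coe_sub u v]
  exact this

lemma liminf_coe_le_of_tendsto_sub :
    liminf (fun n => (v n : EReal)) atTop ≤ liminf (fun n => (u n : EReal)) atTop := by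
  have h0 := (tendsto_coe_sub h).liminf_eq
  rw [coe_eq_add_coe_sub u v]
  refine le_trans ?_ EReal.le_liminf_add
  rw [h0, add_zero]

lemma limsup_coe_le_of_tendsto_sub :
    limsup (fun n => (v n : EReal)) atTop ≤ limsup (fun n => (u n : EReal)) atTop := by
  have h0 := (tendsto_coe_sub h).liminf_eq
  rw [coe_eq_add_coe_sub u v]
  refine le_trans ?_ EReal.le_limsup_add
  rw [h0, add_zero]

end EReal

/-! ### Bounds on the derivative of `ψ₁`. -/

section Estimates

variable {n : ℕ} {r : ℕ} {S : Data n} [Nonempty (Fin S.l)] {θ : Params}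
  (hx : ∀ i, ‖S.x i‖ = 1) (hy : ∀ i, ‖S.y i‖ = 1)

/-- `2 |a b| ≤ a² + b²` is applied under `γ_{k+1}` and `γ₂₂` separately. Both signed coefficients
then appear in absolute value, which is why concentration is stated in terms of `|νₖ|`. -/
lemma abs_nu_devXY_le (hD : EnergyTame fun _ : Unit => D0 r S θ) {k : ℕ} (hk : 1 ≤ k) :
    |nu r S θ k (devXY S θ k)|
      ≤ 1 / 2 * meanSq r S θ k (devX S θ k) + 1 / 2 * meanSq r S θ k (devY S θ k) := by
  have key : ∀ A : PairFun S.l → ℝ, IsAverage A → |A (devXY S θ k)|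
      ≤ 1 / 2 * A (fun i₁ i₂ p₁ p₂ => devX S θ k i₁ i₂ p₁ p₂ ^ 2)
        + 1 / 2 * A (fun i₁ i₂ p₁ p₂ => devY S θ k i₁ i₂ p₁ p₂ ^ 2) := by
    intro A hA
    rw [← hA.const_mul, ← hA.const_mul, ← hA.add]
    refine hA.abs_le fun i₁ i₂ p₁ p₂ => ?_
    rw [devXY, abs_mul, ← sq_abs (devX S θ k i₁ i₂ p₁ p₂), ← sq_abs (devY S θ k i₁ i₂ p₁ p₂)]
    nlinarith [two_mul_le_add_sq |devX S θ k i₁ i₂ p₁ p₂| |devY S θ k i₁ i₂ p₁ p₂|]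
  have h1 := mul_le_mul_of_nonneg_left (key _ (isAverage_avg r S θ hD hk))
    (abs_nonneg ((θ.m k - θ.m (k + 1)) * θ.p))
  have h2 := mul_le_mul_of_nonneg_left (key _ (isAverage_avg22 r S θ hD))
    (abs_nonneg (θ.m 1 * (1 - θ.p)))
  rw [← abs_mul] at h1 h2
  unfold nu meanSq
  split_ifs with hk1
  · subst hk1
    refine (abs_add_le _ _).trans ((add_le_add h1 h2).trans_eq ?_)
    ring
  · rw [add_zero]
    refine h1.trans_eq ?_
    ring

lemma abs_inner_le_one {E : Type*} [NormedAddCommGroup E] [InnerProductSpace ℝ E] {a b : E}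
    (ha : ‖a‖ = 1) (hb : ‖b‖ = 1) : |(inner ℝ a b : ℝ)| ≤ 1 := by
  simpa [ha, hb] using abs_real_inner_le_norm a b

include hx hy

omit [Nonempty (Fin S.l)] in
-- Components of `𝐩`, `𝐪` lie in `[0, 1]` and overlaps of unit vectors in `[-1, 1]`, so each
-- deviation is at most `2` in absolute value.
lemma abs_devXY_le (hP : Ordered r θ.P) (hQ : Ordered r θ.Q) {k : ℕ} (hk : k ≤ r)
    (i₁ i₂ p₁ p₂ : Fin S.l) : |devXY S θ k i₁ i₂ p₁ p₂| ≤ 4 := by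
  have h1 := hP.mem_Icc (k := k) (by omega)
  have h2 := hQ.mem_Icc (k := k) (by omega)
  have h3 := abs_le.1 (abs_inner_le_one (hx p₁) (hx i₁))
  have h4 := abs_le.1 (abs_inner_le_one (hy p₂) (hy i₂))
  have h5 : |devX S θ k i₁ i₂ p₁ p₂| ≤ 2 := by
    rw [devX_eq hx, abs_le]
    constructor <;> linarith [h1.1, h1.2, h3.1, h3.2]
  have h6 : |devY S θ k i₁ i₂ p₁ p₂| ≤ 2 := by
    rw [devY_eq hy, abs_le]
    constructor <;> linarith [h2.1, h2.2, h4.1, h4.2]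
  rw [devXY, abs_mul]
  exact (mul_le_mul h5 h6 (abs_nonneg _) (by norm_num)).trans_eq (by norm_num)

/-- The bound involves only `𝐦` and `p`, hence is uniform in `n` and `t`, as dominated convergence
requires. -/
lemma abs_nu_devXY_le_const (ht : θ.t ∈ Icc (0 : ℝ) 1) (hP : Ordered r θ.P)
    (hQ : Ordered r θ.Q) {k : ℕ} (hk : k ∈ Finset.Icc 1 r) :
    |nu r S θ k (devXY S θ k)|
      ≤ |(θ.m k - θ.m (k + 1)) * θ.p| * 4 + |θ.m 1 * (1 - θ.p)| * 4 := by
  obtain ⟨hk1, hkr⟩ := Finset.mem_Icc.1 hk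
  have hD := energyTame_D0 r hx hy ht
  have key : ∀ A : PairFun S.l → ℝ, IsAverage A → |A (devXY S θ k)| ≤ 4 := fun A hA =>
    (hA.abs_le (abs_devXY_le hx hy hP hQ hkr)).trans_eq (hA.const 4)
  unfold nu
  refine (abs_add_le _ _).trans (add_le_add ?_ ?_)
  · rw [abs_mul]
    exact mul_le_mul_of_nonneg_left (key _ (isAverage_avg r S θ hD hk1)) (abs_nonneg _)
  · split_ifs
    · rw [abs_mul]
      exact mul_le_mul_of_nonneg_left (key _ (isAverage_avg22 r S θ hD)) (abs_nonneg _)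
    · rw [abs_zero]
      positivity

end Estimates

lemma abs_pref_le {n : ℕ} {θ : Params} {K : ℝ} (h : θ.β ^ 2 / √n ≤ K) :
    |-pref n θ| ≤ |θ.s| / 2 * K := by
  have h1 : pref n θ = |θ.s| / 2 * (θ.β ^ 2 / √n) := by
    rw [pref_eq]
    ring
  rw [abs_neg, h1, abs_of_nonneg (by positivity)]
  exact mul_le_mul_of_nonneg_left h (by positivity)

end Blirp

end

/-! ### The theorem: derivative, limits and comparison of the endpoints. -/

theorem corollary7
    (r : ℕ) (hr : 1 ≤ r)
    -- for every dimension `n`, the sets and functions of the model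
    (S : ∀ n : ℕ, Blirp.Data n)
    (hl : ∀ n ≥ 1, 0 < (S n).l)
    (hx : ∀ n ≥ 1, ∀ i, ‖(S n).x i‖ = 1)
    (hy : ∀ n ≥ 1, ∀ i, ‖(S n).y i‖ = 1)
    -- the scalars; `β` may be constant, or grow with `n` like `n ^ (1 / 4)`
    (β : ℕ → ℝ) (hβ0 : ∀ n ≥ 1, 0 ≤ β n)
    (hβ : ∃ K : ℝ, ∀ n : ℕ, 1 ≤ n → β n ^ 2 / Real.sqrt n ≤ K)
    (p s : ℝ) (hp : 0 < p) (hs : s ≠ 0)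
    -- the fixed vector `𝐦`
    (m : ℕ → ℝ) (hm : Blirp.Admissible r m)
    -- the paths `t ↦ 𝐩(t)`, `t ↦ 𝐪(t)`, for every `n`
    (P Q : ℕ → ℝ → ℕ → ℝ)
    (hP : ∀ n ≥ 1, ∀ t ∈ Icc (0 : ℝ) 1, Blirp.Ordered r (P n t))
    (hQ : ∀ n ≥ 1, ∀ t ∈ Icc (0 : ℝ) 1, Blirp.Ordered r (Q n t))
    (hPd : ∀ n ≥ 1, ∀ k ∈ Finset.Icc 1 r, DifferentiableOn ℝ (fun t => P n t k) (Icc 0 1))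
    (hQd : ∀ n ≥ 1, ∀ k ∈ Finset.Icc 1 r, DifferentiableOn ℝ (fun t => Q n t k) (Icc 0 1))
    (θ : ℕ → ℝ → (ℕ → ℝ) → Blirp.Params)
    (hθ : ∀ n t μ, θ n t μ = ⟨β n, p, s, t, μ, P n t, Q n t⟩)
    -- the `𝐩`- and `𝐪`-stationarity equations
    (hstatP : ∀ n ≥ 1, ∀ t ∈ Icc (0 : ℝ) 1, ∀ k ∈ Finset.Icc 1 r,
      Blirp.statP r (S n) (θ n t m) k = 0)
    (hstatQ : ∀ n ≥ 1, ∀ t ∈ Icc (0 : ℝ) 1, ∀ k ∈ Finset.Icc 1 r,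
      Blirp.statQ r (S n) (θ n t m) k = 0)
    -- concentration of the overlaps, or vanishing of the corresponding `φ`
    (hconc : ∀ t ∈ Icc (0 : ℝ) 1, ∀ k ∈ Finset.Icc 1 r,
      Blirp.Concentrates r S (fun n => θ n t m) k ∨
        ∀ n ≥ 1, Blirp.PhiVanishes r (S n) (θ n t m) k)
    -- the range of the infimum: any set of admissible vectors that contains `𝐦`
    (M : Set (ℕ → ℝ)) (hM : M ⊆ {μ | Blirp.Admissible r μ}) (hmM : m ∈ M) :
    -- the derivative of `ψ₁` along the path is zero wherever the `φ` are zero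
    (∀ n ≥ 1, ∀ t ∈ Icc (0 : ℝ) 1,
      (∀ k ∈ Finset.Icc 1 r, Blirp.PhiVanishes r (S n) (θ n t m) k) →
        HasDerivWithinAt (fun τ => Blirp.psi1 r (S n) (θ n τ m)) 0 (Icc 0 1) t) ∧
    -- and it exists and is asymptotically zero in any case
    (∀ t ∈ Icc (0 : ℝ) 1, ∃ D : ℕ → ℝ,
      (∀ n ≥ 1,
        HasDerivWithinAt (fun τ => Blirp.psi1 r (S n) (θ n τ m)) (D n) (Icc 0 1) t) ∧
      Tendsto D atTop (𝓝 0)) ∧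
    -- `ψ₁` is asymptotically constant along the path
    (∀ t ∈ Icc (0 : ℝ) 1, ∀ t' ∈ Icc (0 : ℝ) 1,
      Tendsto (fun n => Blirp.psi1 r (S n) (θ n t m) - Blirp.psi1 r (S n) (θ n t' m))
        atTop (𝓝 0) ∧
      ∀ L : EReal,
        Tendsto (fun n => (Blirp.psi1 r (S n) (θ n t m) : EReal)) atTop (𝓝 L) ↔
          Tendsto (fun n => (Blirp.psi1 r (S n) (θ n t' m) : EReal)) atTop (𝓝 L)) ∧
    -- the inequality between the limits, and between the lower and the upper limits
    (∀ A B : EReal,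
      Tendsto (fun n => (Blirp.psiS r (S n) (θ n 1 m) : EReal)) atTop (𝓝 A) →
      Tendsto (fun n => ⨅ μ ∈ M, (Blirp.bound r (S n) (θ n 0 μ) : EReal)) atTop (𝓝 B) →
      A ≥ B) ∧
    liminf (fun n => (Blirp.psiS r (S n) (θ n 1 m) : EReal)) atTop ≥
      liminf (fun n => ⨅ μ ∈ M, (Blirp.bound r (S n) (θ n 0 μ) : EReal)) atTop ∧
    limsup (fun n => (Blirp.psiS r (S n) (θ n 1 m) : EReal)) atTop ≥
      limsup (fun n => ⨅ μ ∈ M, (Blirp.bound r (S n) (θ n 0 μ) : EReal)) atTop := by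
  have hne : ∀ n ≥ 1, Nonempty (Fin (S n).l) := fun n hn => ⟨⟨0, hl n hn⟩⟩
  obtain ⟨K, hK⟩ := hβ
  have hpref : ∀ n ≥ 1, ∀ t, |-Blirp.pref n (θ n t m)| ≤ |s| / 2 * K := fun n hn t => by
    have h := Blirp.abs_pref_le (n := n) (θ := θ n t m) (K := K) (by rw [hθ]; exact hK n hn)
    rwa [show (θ n t m).s = s by rw [hθ]] at h
  set D : ℕ → ℝ → ℝ := fun n t => -Blirp.pref n (θ n t m) * ∑ k ∈ Finset.Icc 1 r,
    Blirp.nu r (S n) (θ n t m) k (Blirp.devXY (S n) (θ n t m) k) with hDdef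
  have hderiv : ∀ n ≥ 1, ∀ t ∈ Icc (0 : ℝ) 1,
      HasDerivWithinAt (fun τ => Blirp.psi1 r (S n) (θ n τ m)) (D n t) (Icc 0 1) t := by
    intro n hn t ht
    have := hne n hn
    exact Blirp.hasDerivWithinAt_psi1 hr (hx n hn) (hy n hn) hm (fun t => hθ n t m) hp.ne' hs
      (hP n hn) (hQ n hn) (hPd n hn) (hQd n hn) ht (hstatP n hn t ht) (hstatQ n hn t ht)
  have habs : ∀ n ≥ 1, ∀ t, |D n t| ≤ |s| / 2 * K * ∑ k ∈ Finset.Icc 1 r,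
      |Blirp.nu r (S n) (θ n t m) k (Blirp.devXY (S n) (θ n t m) k)| := by
    intro n hn t
    rw [hDdef, abs_mul]
    exact mul_le_mul (hpref n hn t) (Finset.abs_sum_le_sum_abs _ _) (abs_nonneg _)
      ((abs_nonneg _).trans (hpref n hn t))
  have hphi : ∀ n t, ∀ k ∈ Finset.Icc 1 r, Blirp.PhiVanishes r (S n) (θ n t m) k →
      Blirp.nu r (S n) (θ n t m) k (Blirp.devXY (S n) (θ n t m) k) = 0 := fun n t k hk h =>
    (Blirp.phiVanishes_iff (by rw [hθ]; exact hs) (Finset.mem_Icc.1 hk).1).1 h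
  have hDlim : ∀ t ∈ Icc (0 : ℝ) 1, Tendsto (fun n => D n t) atTop (𝓝 0) := by
    intro t ht
    have hnu : ∀ k ∈ Finset.Icc 1 r, Tendsto
        (fun n => |Blirp.nu r (S n) (θ n t m) k (Blirp.devXY (S n) (θ n t m) k)|)
        atTop (𝓝 0) := by
      intro k hk
      rcases hconc t ht k hk with ⟨h1, h2⟩ | h
      · refine squeeze_zero' (.of_forall fun _ => abs_nonneg _) ?_
          (by simpa using (h1.const_mul (1 / 2)).add (h2.const_mul (1 / 2)))
        filter_upwards [eventually_ge_atTop 1] with n hn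
        have := hne n hn
        exact Blirp.abs_nu_devXY_le (Blirp.energyTame_D0 r (hx n hn) (hy n hn)
          (by rw [hθ]; exact ht)) (Finset.mem_Icc.1 hk).1
      · refine tendsto_const_nhds.congr' ?_
        filter_upwards [eventually_ge_atTop 1] with n hn
        rw [hphi n t k hk (h n hn), abs_zero]
    have hlim := (tendsto_finsetSum _ hnu).const_mul (|s| / 2 * K)
    rw [Finset.sum_const_zero, mul_zero] at hlim
    rw [tendsto_zero_iff_abs_tendsto_zero]
    refine squeeze_zero' (.of_forall fun _ => abs_nonneg _) ?_ hlim
    filter_upwards [eventually_ge_atTop 1] with n hn using habs n hn t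
  -- The boundedness of `β² / √n` makes the prefactor bounded, so the right side depends on neither
  -- `n` nor `t`.
  have hDbound : ∀ n ≥ 1, ∀ t ∈ Icc (0 : ℝ) 1, |D n t| ≤ |s| / 2 * K * ∑ k ∈ Finset.Icc 1 r,
      (|(m k - m (k + 1)) * p| * 4 + |m 1 * (1 - p)| * 4) := by
    intro n hn t ht
    have := hne n hn
    refine (habs n hn t).trans (mul_le_mul_of_nonneg_left (Finset.sum_le_sum fun k hk => ?_)
      ((abs_nonneg _).trans (hpref n hn t)))
    have h := Blirp.abs_nu_devXY_le_const (θ := θ n t m) (hx n hn) (hy n hn)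
      (by rw [hθ]; exact ht) (by rw [hθ]; exact hP n hn t ht) (by rw [hθ]; exact hQ n hn t ht) hk
    rwa [show (θ n t m).m = m by rw [hθ], show (θ n t m).p = p by rw [hθ]] at h
  have hconst : ∀ t ∈ Icc (0 : ℝ) 1, ∀ t' ∈ Icc (0 : ℝ) 1, Tendsto (fun n =>
      Blirp.psi1 r (S n) (θ n t m) - Blirp.psi1 r (S n) (θ n t' m)) atTop (𝓝 0) :=
    fun t ht t' ht' => Blirp.tendsto_sub_of_tendsto_deriv hderiv hDbound hDlim ht ht'
  have h0 : (0 : ℝ) ∈ Icc (0 : ℝ) 1 := left_mem_Icc.2 zero_le_one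
  have h1 : (1 : ℝ) ∈ Icc (0 : ℝ) 1 := right_mem_Icc.2 zero_le_one
  have hone : ∀ n ≥ 1, Blirp.psi1 r (S n) (θ n 1 m) = Blirp.psiS r (S n) (θ n 1 m) := by
    intro n hn
    have := hne n hn
    exact Blirp.psi1_one (hx n hn) (hy n hn) hr (by rw [hθ]; exact hm) (by rw [hθ]; exact hp.ne')
      (by rw [hθ]; exact hP n hn 1 h1) (by rw [hθ]; exact hQ n hn 1 h1) (by rw [hθ])
  have hzero : ∀ n ≥ 1, Blirp.psi1 r (S n) (θ n 0 m) = Blirp.bound r (S n) (θ n 0 m) := by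
    intro n hn
    have := hne n hn
    exact Blirp.psi1_zero (hx n hn) (hy n hn) (by rw [hθ])
  -- The inequality in the last conclusions arises only here, from using `𝐦` itself as a competitor;
  -- the rest is asymptotic equality.
  have hinf : ∀ n, (⨅ μ ∈ M, (Blirp.bound r (S n) (θ n 0 μ) : EReal))
      ≤ (Blirp.bound r (S n) (θ n 0 m) : EReal) := fun n => iInf₂_le m hmM
  have hdiff : Tendsto (fun n => Blirp.psiS r (S n) (θ n 1 m) - Blirp.bound r (S n) (θ n 0 m))
      atTop (𝓝 0) := by
    refine (hconst 1 h1 0 h0).congr' ?_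
    filter_upwards [eventually_ge_atTop 1] with n hn
    rw [hone n hn, hzero n hn]
  have hdiff' : Tendsto (fun n => Blirp.bound r (S n) (θ n 0 m) - Blirp.psiS r (S n) (θ n 1 m))
      atTop (𝓝 0) := by simpa using hdiff.neg
  refine ⟨fun n hn t ht hvan => ?_, fun t ht => ⟨fun n => D n t, fun n hn => hderiv n hn t ht,
    hDlim t ht⟩, fun t ht t' ht' => ⟨hconst t ht t' ht', fun L =>
      ⟨Blirp.tendsto_coe_of_tendsto_sub (hconst t' ht' t ht),
        Blirp.tendsto_coe_of_tendsto_sub (hconst t ht t' ht')⟩⟩, fun A B hA hB => ?_, ?_, ?_⟩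
  · refine (hderiv n hn t ht).congr_deriv ?_
    rw [hDdef]
    simp only
    rw [Finset.sum_eq_zero fun k hk => hphi n t k hk (hvan k hk), mul_zero]
  · exact le_of_tendsto_of_tendsto' hB (Blirp.tendsto_coe_of_tendsto_sub hdiff' hA) hinf
  · exact (liminf_le_liminf (.of_forall hinf)).trans (Blirp.liminf_coe_le_of_tendsto_sub hdiff)
  · exact (limsup_le_limsup (.of_forall hinf)).trans (Blirp.limsup_coe_le_of_tendsto_sub hdiff)
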